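/- Let $M$ be a smooth $3$-manifold (Hausdorff, second countable, without boundary; not necessarily compact, connected or oriented) with a cooriented contact structure $\xi$, i.e. $\xi=\ker\alpha$, cooriented by $\alpha$, for some smooth $1$-form $\alpha$ on $M$ with $\alpha\wedge d\alpha$ nowhere zero. A contactomorphism of $(M,\xi)$ is a diffeomorphism $g\colon M\to M$ with $Tg(\xi)=\xi$ that preserves the coorientation. Two contactomorphisms $g,h$ of $(M,\xi)$ are contact isotopic if there is a family $(\varphi_t)_{t\in[0,1]}$ of contactomorphisms of $(M,\xi)$, with $(t,x)\mapsto\varphi_t(x)$ smooth on $[0,1]\times M$, such that $\varphi_0=g$ and $\varphi_1=h$. Let $K\subset M$ be a Legendrian knot, i.e. the image of a smooth embedding of $S^1$ into $M$ that is everywhere tangent to $\xi$, and let $g$ be a contactomorphism of $(M,\xi)$ that fixes $K$ pointwise. Then $g$ is contact isotopic to a contactomorphism $h$ of $(M,\xi)$ that is the identity on some open neighbourhood of $K$. -/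

import Mathlib

open scoped Manifold ContDiff

noncomputable section

namespace ContactTopology

/-- The model space `ℝ³`. -/
abbrev E3 : Type := EuclideanSpace ℝ (Fin 3)

section OneForms

variable (M : Type*) [TopologicalSpace M] [ChartedSpace E3 M] [IsManifold (𝓡 3) ∞ M]

/-- Smooth `1`-forms on a smooth `3`-manifold: smooth sections of the cotangent bundle. -/
abbrev OneForm : Type _ :=
  Cₛ^∞⟮𝓡 3; E3 →L[ℝ] ℝ, fun x : M => TangentSpace (𝓡 3) x →L[ℝ] Bundle.Trivial M ℝ x⟯

variable {M}

/-- The `1`-form `α` read in the preferred chart `e` at `x`, i.e. the pullback `(e⁻¹)^* α`,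
a `1`-form on (an open subset of) `ℝ³`. -/
def OneForm.inChart (α : OneForm M) (x : M) (y : E3) : E3 →L[ℝ] ℝ :=
  (α ((extChartAt (𝓡 3) x).symm y) :
      TangentSpace (𝓡 3) ((extChartAt (𝓡 3) x).symm y) →L[ℝ] ℝ).comp
    (mfderiv 𝓘(ℝ, E3) (𝓡 3) (extChartAt (𝓡 3) x).symm y)

/-- The exterior derivative `dα` at `x`: with `e` the preferred chart at `x`, it is
`e^* d((e⁻¹)^* α)`. -/
def OneForm.d (α : OneForm M) (x : M) : TangentSpace (𝓡 3) x [⋀^Fin 2]→L[ℝ] ℝ :=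
  (extDeriv (fun y : E3 => ContinuousAlternatingMap.ofSubsingleton ℝ E3 ℝ (0 : Fin 1)
      (α.inChart x y)) (extChartAt (𝓡 3) x x)).compContinuousLinearMap
    (mfderiv (𝓡 3) 𝓘(ℝ, E3) (extChartAt (𝓡 3) x) x)

/-- The value of the `3`-form `α ∧ dα` at `x` on tangent vectors `u, v, w`. -/
def OneForm.wedgeD (α : OneForm M) (x : M) (u v w : TangentSpace (𝓡 3) x) : ℝ :=
  (α x u : ℝ) * α.d x ![v, w] + (α x v : ℝ) * α.d x ![w, u] + (α x w : ℝ) * α.d x ![u, v]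

/-- A contact form: a smooth `1`-form `α` such that `α ∧ dα` vanishes nowhere. -/
def OneForm.IsContact (α : OneForm M) : Prop :=
  ∀ x : M, ∃ u v w : TangentSpace (𝓡 3) x, α.wedgeD x u v w ≠ 0

end OneForms

variable (M : Type*) [TopologicalSpace M] [ChartedSpace E3 M] [IsManifold (𝓡 3) ∞ M]

/-- A cooriented contact structure on a `3`-manifold: a plane field `ξ ⊂ TM` together with a choice
of positive side of each plane `ξ_x` in `T_x M` (an orientation of the line `T_x M / ξ_x`), which
are given as the kernel and the positive half-spaces of some contact form. -/
structure CoorientedContactStructure where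
  /-- the contact plane `ξ_x` -/
  plane : ∀ x : M, Submodule ℝ (TangentSpace (𝓡 3) x)
  /-- the open half-space of `T_x M` on the positive side of `ξ_x` -/
  pos : ∀ x : M, Set (TangentSpace (𝓡 3) x)
  exists_form : ∃ α : OneForm M, α.IsContact ∧
    ∀ (x : M) (v : TangentSpace (𝓡 3) x),
      (v ∈ plane x ↔ (α x v : ℝ) = 0) ∧ (v ∈ pos x ↔ 0 < (α x v : ℝ))

variable {M}

namespace CoorientedContactStructure

variable (ξ : CoorientedContactStructure M)

/-- A contactomorphism of `(M, ξ)`: a diffeomorphism `g` of `M` with `Tg(ξ) = ξ` that preserves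
the coorientation. -/
def IsContactomorphism (g : M ≃ₘ^∞⟮𝓡 3, 𝓡 3⟯ M) : Prop :=
  ∀ x : M,
    (ξ.plane x).map (mfderiv (𝓡 3) (𝓡 3) g x).toLinearMap = ξ.plane (g x) ∧
    mfderiv (𝓡 3) (𝓡 3) g x '' ξ.pos x = ξ.pos (g x)

/-- `g` and `h` are contact isotopic: they are joined by a family `φ_t`, `t ∈ [0,1]`, of
contactomorphisms that is smooth on `[0,1] × M`. The values `φ_t` for `t ∉ [0,1]` play no role. -/
def ContactIsotopic (g h : M ≃ₘ^∞⟮𝓡 3, 𝓡 3⟯ M) : Prop :=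
  ∃ φ : ℝ → (M ≃ₘ^∞⟮𝓡 3, 𝓡 3⟯ M),
    ContMDiffOn (𝓘(ℝ, ℝ).prod (𝓡 3)) (𝓡 3) ∞ (fun p : ℝ × M => φ p.1 p.2)
      (Set.Icc (0 : ℝ) 1 ×ˢ Set.univ) ∧
    (∀ t ∈ Set.Icc (0 : ℝ) 1, ξ.IsContactomorphism (φ t)) ∧
    φ 0 = g ∧ φ 1 = h

/-- A Legendrian knot: a smoothly embedded circle that is everywhere tangent to `ξ`. -/
def IsLegendrianKnot (K : Set M) : Prop :=
  ∃ γ : Circle → M, Manifold.IsSmoothEmbedding (𝓡 1) (𝓡 3) ∞ γ ∧ Set.range γ = K ∧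
    ∀ (z : Circle) (v : TangentSpace (𝓡 1) z), mfderiv (𝓡 1) (𝓡 3) γ z v ∈ ξ.plane (γ z)

end CoorientedContactStructure

end ContactTopology

end

/-! Around each of its points, a Legendrian knot has a Darboux chart in which ξ is the cooriented
kernel of dz - y dx and K is the x-axis. Read there, a contactomorphism (x, y, z) ↦ (X, Y, Z) fixing
the axis satisfies dZ - Y dX = f (dz - y dx) with f > 0. Along the axis this forces ∂Y/∂y = f, so
(x, Y, z) are coordinates near it. In them W = Z - XY has dW = f dz - f y dx - X dY, hence W
recovers the map: X = -W_Y, y = -W_x / W_z, Z = W - Y W_Y. The conditions on W are W_z > 0 and, on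
the axis, W = 0, W_x = 0, W_Y = -x. They are convex, they imply the nondegeneracy W_xY = -1 on the
axis, and z - xY, which generates the identity, satisfies them. So the affine path W_t = W + tQ with
Q = z - xY - W deforms the germ to the identity through contact germs fixing the axis
(`IsAxisContact.exists_generating`, `IsAxisGenerating.affinePath`).

The germs are extended to M without integrating a contact vector field. To pass from W_t to W_t +
sQ, multiply Q by a bump function. For small s, the perturbed source and target maps are the old
ones precomposed with compactly supported diffeomorphisms Θ_s and Ω_s. In the coordinates given by
the target map of W_t, the map Ω_s Θ_s⁻¹ is then a compactly supported contact transformation that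
carries the old germ to the new one (`IsAxisGenerating.nonempty_generatingStep`,
`IsDarbouxChart.exists_contactIsotopic_step`). The admissible s depends on t, but steps can be taken
in both directions, so connectedness of [0, 1] leads from t = 0 to t = 1.

Compactness of K reduces the theorem to such local modifications. They do not disturb each other:
where the map is already the identity, W = z - xY, so Q = 0 and the new isotopy is the identity
there (`IsDarbouxChart.exists_contactIsotopic_eq_self`, `exists_contactIsotopic_eq_self_near`).

For the Darboux charts, the immersion normal form straightens K, a family of scalar ODEs kills one
component of α, and α = b (dz - y dx) where the contact condition makes y a coordinate. Smooth
dependence of the ODE on parameters is obtained from the inverse function theorem in a Banach space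
of curves. -/

open scoped Manifold ContDiff Topology

noncomputable section

namespace ContactTopology

/-! ### Inverse function theorems for smooth maps. -/

section LocalDiffeo

variable {E F : Type*} [NormedAddCommGroup E] [NormedSpace ℝ E] [CompleteSpace E]
  [NormedAddCommGroup F] [NormedSpace ℝ F]

/-- Inverse function theorem for smooth maps, with a smooth inverse on the whole target. -/
theorem exists_openPartialHomeomorph_of_hasFDerivAt {f : E → F} {S : Set E} (hS : IsOpen S)
    (hf : ContDiffOn ℝ ∞ f S) {x₀ : E} (hx₀ : x₀ ∈ S) {A : E ≃L[ℝ] F}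
    (hA : HasFDerivAt f (A : E →L[ℝ] F) x₀) :
    ∃ e : OpenPartialHomeomorph E F, x₀ ∈ e.source ∧ e.source ⊆ S ∧ (∀ x, e x = f x) ∧
      ContDiffOn ℝ ∞ e.symm e.target := by
  have hfx : ContDiffAt ℝ ∞ f x₀ := hf.contDiffAt (hS.mem_nhds hx₀)
  let e₀ := hfx.toOpenPartialHomeomorph f hA (by simp)
  have hcont : ContinuousOn (fderiv ℝ f) S :=
    hf.continuousOn_fderiv_of_isOpen hS (by simp)
  -- Invertible operators form an open set, so shrinking the source to points with invertible
  -- differential makes the inverse smooth on the whole target, not only at `f x₀`.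
  have hev : ∀ᶠ x in 𝓝 x₀, x ∈ S ∧
      fderiv ℝ f x ∈ Set.range (ContinuousLinearEquiv.toContinuousLinearMap (M₁ := E) (M₂ := F)
        (σ₁₂ := RingHom.id ℝ)) := by
    refine Filter.Eventually.and (hS.mem_nhds hx₀) ?_
    refine (hcont.continuousAt (hS.mem_nhds hx₀)).eventually_mem ?_
    rw [hA.fderiv]
    exact A.nhds
  obtain ⟨T, hT, hTo, hxT⟩ := eventually_nhds_iff.1 hev
  refine ⟨e₀.restrOpen T hTo, ⟨hfx.mem_toOpenPartialHomeomorph_source hA (by simp), hxT⟩,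
    fun x hx => (hT x hx.2).1, fun x => rfl, ?_⟩
  intro y hy
  have hy' := (e₀.restrOpen T hTo).map_target hy
  obtain ⟨hyS, B, hB⟩ := hT _ hy'.2
  have hfy : ContDiffAt ℝ ∞ f ((e₀.restrOpen T hTo).symm y) := hf.contDiffAt (hS.mem_nhds hyS)
  refine ((e₀.restrOpen T hTo).contDiffAt_symm (f₀' := B) hy ?_ hfy).contDiffWithinAt
  rw [hB]
  exact (hfy.differentiableAt (by simp)).hasFDerivAt

/-- An injective smooth map with invertible differentials on an open set is an open partial
homeomorphism with a smooth inverse. -/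
theorem exists_openPartialHomeomorph_of_injOn [Nonempty E] {f : E → F} {S : Set E} (hS : IsOpen S)
    (hf : ContDiffOn ℝ ∞ f S) (hinj : Set.InjOn f S)
    (hA : ∀ x ∈ S, ∃ A : E ≃L[ℝ] F, HasFDerivAt f (A : E →L[ℝ] F) x) :
    ∃ e : OpenPartialHomeomorph E F, e.source = S ∧ (∀ x, e x = f x) ∧
      ContDiffOn ℝ ∞ e.symm e.target := by
  have hopen : IsOpenMap (S.domRestrict f) := by
    rw [isOpenMap_iff_nhds_le]
    rintro ⟨x, hx⟩
    obtain ⟨A, hAx⟩ := hA x hx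
    have h1 : Filter.map f (𝓝 x) = 𝓝 (f x) :=
      ((hf.contDiffAt (hS.mem_nhds hx)).hasStrictFDerivAt' hAx (by simp)).map_nhds_eq_of_equiv
    have h2 : Filter.map ((↑) : S → E) (𝓝 ⟨x, hx⟩) = 𝓝 x := map_nhds_subtype_coe_eq_nhds hx
      (hS.mem_nhds hx)
    change 𝓝 (f x) ≤ Filter.map (f ∘ ((↑) : S → E)) _
    rw [← Filter.map_map, h2, h1]
  let e := OpenPartialHomeomorph.ofContinuousOpenRestrict (hinj.toPartialEquiv f S)
    hf.continuousOn hopen hS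
  refine ⟨e, rfl, fun x => rfl, fun y hy => ?_⟩
  have hyS : e.symm y ∈ S := e.map_target hy
  obtain ⟨A, hAx⟩ := hA _ hyS
  exact (e.contDiffAt_symm (f₀' := A) hy hAx
    (hf.contDiffAt (hS.mem_nhds hyS))).contDiffWithinAt

end LocalDiffeo

/-! ### Smoothness of superposition operators on spaces of continuous functions. -/

section Nemytskii

universe u

variable {K : Type*} [TopologicalSpace K] [CompactSpace K]
  {E F : Type u} [NormedAddCommGroup E] [NormedSpace ℝ E]
  [NormedAddCommGroup F] [NormedSpace ℝ F]

/-- Pointwise application of a family of operators to a function, as a bounded bilinear map. -/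
def pointwiseApply : C(K, E →L[ℝ] F) →L[ℝ] C(K, E) →L[ℝ] C(K, F) :=
  LinearMap.mkContinuous₂
    (LinearMap.mk₂ ℝ (fun (L : C(K, E →L[ℝ] F)) (h : C(K, E)) =>
        (⟨fun k => L k (h k), by fun_prop⟩ : C(K, F)))
      (fun _ _ _ => by ext; simp) (fun _ _ _ => by ext; simp)
      (fun _ _ _ => by ext; simp) (fun _ _ _ => by ext; simp)) 1
    (fun L h => by
      rw [ContinuousMap.norm_le _ (by positivity)]
      intro k
      rw [one_mul]
      refine ((L k).le_opNorm (h k)).trans ?_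
      gcongr
      exacts [L.norm_coe_le_norm k, h.norm_coe_le_norm k])

@[simp]
theorem pointwiseApply_apply (L : C(K, E →L[ℝ] F)) (h : C(K, E)) (k : K) :
    pointwiseApply L h k = L k (h k) := rfl

/-- The mean value inequality is applied at each `k` to `v` minus its linearisation at `y k`, on the
segment from `y k` to `y k + h k`. Uniformity in `k` comes from continuity of `y ↦ v' ∘ y` in the
sup norm, so `E` need not be locally compact. -/
theorem hasFDerivAt_comp_continuousMap (v : C(E, F)) (v' : C(E, E →L[ℝ] F))
    (hv : ∀ x, HasFDerivAt v (v' x) x) (y : C(K, E)) :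
    HasFDerivAt (fun y : C(K, E) => v.comp y) (pointwiseApply (v'.comp y)) y := by
  rw [hasFDerivAt_iff_isLittleO_nhds_zero, Asymptotics.isLittleO_iff]
  intro ε hε
  have hc : ContinuousAt (fun y : C(K, E) => v'.comp y) y :=
    (ContinuousMap.continuous_postcomp v').continuousAt
  obtain ⟨δ, hδ, hball⟩ := (Metric.continuousAt_iff (α := C(K, E))
    (β := C(K, E →L[ℝ] F)) (f := fun y => v'.comp y)).1 hc ε hε
  filter_upwards [Metric.ball_mem_nhds (0 : C(K, E)) hδ] with h hh
  rw [mem_ball_zero_iff] at hh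
  rw [ContinuousMap.norm_le _ (by positivity)]
  intro k
  have key : ‖(fun x => v x - v' (y k) x) (y k + h k) - (fun x => v x - v' (y k) x) (y k)‖ ≤
      ε * ‖(y k + h k) - y k‖ := by
    refine Convex.norm_image_sub_le_of_norm_hasFDerivWithin_le (𝕜 := ℝ)
      (s := segment ℝ (y k) (y k + h k)) (f' := fun x => v' x - v' (y k))
      (fun x _ => ((hv x).sub (v' (y k)).hasFDerivAt).hasFDerivWithinAt) ?_
      (convex_segment _ _) (left_mem_segment _ _ _) (right_mem_segment _ _ _)
    intro x hx
    rw [segment_eq_image'] at hx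
    obtain ⟨θ, hθ, rfl⟩ := hx
    -- A point of the segment is the value at `k` of the curve `y + θ • h`, which is uniformly close
    -- to `y`.
    have h1 : dist (y + θ • h) y < δ := by
      rw [dist_eq_norm, add_sub_cancel_left, norm_smul, Real.norm_of_nonneg hθ.1]
      exact (mul_le_of_le_one_left (norm_nonneg _) hθ.2).trans_lt hh
    have h2 := (ContinuousMap.dist_lt_iff hε).1 (hball h1) k
    rw [dist_eq_norm] at h2
    simpa using h2.le
  have h3 : ‖h k‖ ≤ ‖h‖ := h.norm_coe_le_norm k
  calc _ = ‖(fun x => v x - v' (y k) x) (y k + h k) - (fun x => v x - v' (y k) x) (y k)‖ := by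
          simp only [ContinuousMap.sub_apply, ContinuousMap.comp_apply, ContinuousMap.add_apply,
            pointwiseApply_apply, map_add]
          congr 1
          abel
    _ ≤ ε * ‖h k‖ := by simpa using key
    _ ≤ ε * ‖h‖ := by gcongr

/-- The derivative is the superposition operator of `fderiv ℝ v` followed by a bounded linear map,
so the order drops by one while `F` becomes `E →L[ℝ] F`. This is why the induction generalises `F`,
and why both spaces lie in one universe. -/
theorem contDiff_nat_comp_continuousMap (n : ℕ) {E F : Type u} [NormedAddCommGroup E]
    [NormedSpace ℝ E] [NormedAddCommGroup F] [NormedSpace ℝ F] (v : C(E, F))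
    (hv : ContDiff ℝ ∞ v) : ContDiff ℝ n (fun y : C(K, E) => v.comp y) := by
  induction n generalizing F with
  | zero => exact contDiff_zero.2 (ContinuousMap.continuous_postcomp v)
  | succ n ih =>
    have hv' : ContDiff ℝ ∞ (fderiv ℝ v) := (contDiff_infty_iff_fderiv.1 hv).2
    let v' : C(E, E →L[ℝ] F) := ⟨fderiv ℝ v, hv'.continuous⟩
    refine contDiff_succ_iff_hasFDerivAt.2 ⟨fun y => pointwiseApply (v'.comp y), ?_, fun y =>
      hasFDerivAt_comp_continuousMap v v' (fun x => ?_) y⟩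
    · exact pointwiseApply.contDiff.comp (ih v' hv')
    · exact (hv.differentiable (by simp) x).hasFDerivAt

/-- The superposition operator `y ↦ v ∘ y` of a smooth map is smooth. -/
theorem contDiff_comp_continuousMap (v : C(E, F)) (hv : ContDiff ℝ ∞ v) :
    ContDiff ℝ ∞ (fun y : C(K, E) => v.comp y) :=
  contDiff_infty.2 fun n => contDiff_nat_comp_continuousMap n v hv

end Nemytskii

/-- Coordinate space `ℝ³`, with coordinates named `(x, y, z)`. -/
abbrev V3 : Type := ℝ × ℝ × ℝ

/-! ### Smooth dependence on parameters for a scalar ODE. -/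

section ScalarODE

/-- The indefinite integral on `[0, 1]` as a bounded operator. -/
def integralOp : C(unitInterval, ℝ) →L[ℝ] C(unitInterval, ℝ) :=
  LinearMap.mkContinuous
    { toFun := fun u => ⟨fun τ => ∫ s in (0 : ℝ)..τ, u (Set.projIcc 0 1 zero_le_one s),
        (intervalIntegral.continuous_primitive (fun a b =>
          (u.continuous.comp continuous_projIcc).intervalIntegrable a b) 0).comp
          continuous_subtype_val⟩
      map_add' := fun u v => by
        ext τ
        exact intervalIntegral.integral_add
          ((u.continuous.comp continuous_projIcc).intervalIntegrable _ _)
          ((v.continuous.comp continuous_projIcc).intervalIntegrable _ _)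
      map_smul' := fun c u => by
        ext τ
        exact intervalIntegral.integral_smul c _ } 1
    (fun u => by
      rw [ContinuousMap.norm_le _ (by positivity)]
      intro τ
      refine (intervalIntegral.norm_integral_le_of_norm_le_const (C := ‖u‖)
        (fun s _ => u.norm_coe_le_norm _)).trans ?_
      rw [sub_zero, abs_of_nonneg τ.2.1, one_mul]
      exact mul_le_of_le_one_right (norm_nonneg _) τ.2.2)

theorem integralOp_apply (u : C(unitInterval, ℝ)) (τ : unitInterval) :
    integralOp u τ = ∫ s in (0 : ℝ)..τ, u (Set.projIcc 0 1 zero_le_one s) := rfl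

/-- The curve `s ↦ (x, s w, y s)` attached to parameters `(x, w, c)` and a function `y`. -/
def graphCurve : V3 × C(unitInterval, ℝ) →L[ℝ] C(unitInterval, V3) :=
  LinearMap.mkContinuous
    { toFun := fun q => ⟨fun s => (q.1.1, s * q.1.2.1, q.2 s), by fun_prop⟩
      map_add' := fun u v => by ext s <;> simp [mul_add]
      map_smul' := fun c u => by ext s <;> simp [mul_left_comm] } 1
    (fun q => by
      rw [ContinuousMap.norm_le _ (by positivity)]
      intro s
      rw [one_mul]
      have h1 : ‖q.1‖ ≤ ‖q‖ := norm_fst_le q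
      have h2 : ‖q.2‖ ≤ ‖q‖ := norm_snd_le q
      have h3 : ‖q.1.1‖ ≤ ‖q.1‖ := norm_fst_le q.1
      have h4 : ‖q.1.2.1‖ ≤ ‖q.1‖ := (norm_fst_le q.1.2).trans (norm_snd_le q.1)
      refine norm_prod_le_iff.2 ⟨h3.trans h1, norm_prod_le_iff.2 ⟨?_, ?_⟩⟩
      · change ‖(s : ℝ) * q.1.2.1‖ ≤ _
        rw [norm_mul, Real.norm_of_nonneg s.2.1]
        exact (mul_le_of_le_one_left (norm_nonneg _) s.2.2).trans (h4.trans h1)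
      · exact (q.2.norm_coe_le_norm s).trans h2)

theorem graphCurve_apply (q : V3 × C(unitInterval, ℝ)) (s : unitInterval) :
    graphCurve q s = (q.1.1, (s : ℝ) * q.1.2.1, q.2 s) := rfl

variable (F : C(V3, ℝ))

/-- The right hand side of the rescaled integral equation. -/
def picardMap (q : V3 × C(unitInterval, ℝ)) : C(unitInterval, ℝ) :=
  q.2 - q.1.2.2 • (1 : C(unitInterval, ℝ)) - q.1.2.1 • integralOp (F.comp (graphCurve q))

theorem contDiff_integralOp_graphCurve (hF : ContDiff ℝ ∞ F) :
    ContDiff ℝ ∞ (fun q => integralOp (F.comp (graphCurve q))) :=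
  integralOp.contDiff.comp ((contDiff_comp_continuousMap F hF).comp graphCurve.contDiff)

theorem contDiff_picardMap (hF : ContDiff ℝ ∞ F) : ContDiff ℝ ∞ (picardMap F) := by
  have := contDiff_integralOp_graphCurve F hF
  unfold picardMap
  fun_prop

/-- The integral term carries the factor w, which vanishes at the origin. Its derivative there sees
only the variation of w, the partial derivative in the curve is the identity, and the total
derivative is a shear. -/
theorem exists_equiv_hasFDerivAt_picardMap (hF : ContDiff ℝ ∞ F) :
    ∃ A : (V3 × C(unitInterval, ℝ)) ≃L[ℝ] (V3 × C(unitInterval, ℝ)),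
      HasFDerivAt (fun q => (q.1, picardMap F q))
        (A : (V3 × C(unitInterval, ℝ)) →L[ℝ] (V3 × C(unitInterval, ℝ))) 0 := by
  have hQ := ((contDiff_integralOp_graphCurve F hF).differentiable (by simp) 0).hasFDerivAt
  set Q := fun q => integralOp (F.comp (graphCurve q)) with hQdef
  let pw : V3 →L[ℝ] ℝ := (ContinuousLinearMap.fst ℝ ℝ ℝ).comp (ContinuousLinearMap.snd ℝ ℝ (ℝ × ℝ))
  let pc : V3 →L[ℝ] ℝ := (ContinuousLinearMap.snd ℝ ℝ ℝ).comp (ContinuousLinearMap.snd ℝ ℝ (ℝ × ℝ))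
  let T : V3 →L[ℝ] C(unitInterval, ℝ) :=
    -(pc.smulRight (1 : C(unitInterval, ℝ))) - pw.smulRight (Q 0)
  refine ⟨ContinuousLinearEquiv.skewProd (.refl ℝ _) (.refl ℝ _) T, ?_⟩
  have h1 : HasFDerivAt (fun q : V3 × C(unitInterval, ℝ) => q.1)
    (ContinuousLinearMap.fst ℝ V3 C(unitInterval, ℝ)) 0 := hasFDerivAt_fst
  have h2 : HasFDerivAt (fun q : V3 × C(unitInterval, ℝ) => q.2)
    (ContinuousLinearMap.snd ℝ V3 C(unitInterval, ℝ)) 0 := hasFDerivAt_snd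
  have hw : HasFDerivAt (fun q : V3 × C(unitInterval, ℝ) => q.1.2.1)
    (pw.comp (ContinuousLinearMap.fst ℝ V3 C(unitInterval, ℝ))) 0 :=
    (pw.comp (ContinuousLinearMap.fst ℝ V3 C(unitInterval, ℝ))).hasFDerivAt
  have hc : HasFDerivAt (fun q : V3 × C(unitInterval, ℝ) => q.1.2.2)
    (pc.comp (ContinuousLinearMap.fst ℝ V3 C(unitInterval, ℝ))) 0 :=
    (pc.comp (ContinuousLinearMap.fst ℝ V3 C(unitInterval, ℝ))).hasFDerivAt
  have := h1.prodMk ((h2.sub (hc.smul_const (1 : C(unitInterval, ℝ)))).sub (hw.smul hQ))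
  refine this.congr_fderiv ?_
  refine ContinuousLinearMap.ext fun q => Prod.ext rfl ?_
  simp [T, pc, pw, sub_eq_add_neg, add_assoc]

variable {F} in
theorem picardMap_eq_zero_iff {q : V3 × C(unitInterval, ℝ)} :
    picardMap F q = 0 ↔ ∀ τ : unitInterval, q.2 τ = q.1.2.2 + q.1.2.1 *
      ∫ s in (0 : ℝ)..τ, F (graphCurve q (Set.projIcc 0 1 zero_le_one s)) := by
  rw [ContinuousMap.ext_iff]
  refine forall_congr' fun τ => ?_
  change q.2 τ - q.1.2.2 * 1 - q.1.2.1 * _ = 0 ↔ _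
  rw [integralOp_apply, mul_one, sub_sub, sub_eq_zero]
  rfl

/-- Slow a curve `y` on `[0, 1]` down by a factor `t ∈ [0, 1]`. -/
def slowDown (t : unitInterval) (y : C(unitInterval, ℝ)) : C(unitInterval, ℝ) :=
  ⟨fun s => y (t * s), by fun_prop⟩

theorem norm_slowDown_le (t : unitInterval) (y : C(unitInterval, ℝ)) : ‖slowDown t y‖ ≤ ‖y‖ :=
  (ContinuousMap.norm_le _ (norm_nonneg _)).2 fun s => y.norm_coe_le_norm (t * s)

-- Substituting `t * s` in the integral shows that slowing a solution down by `t` replaces w by t w.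
-- Hence the value at `t` of the solution curve for (x, w, c) is the endpoint for (x, t w, c), which
-- turns the integral equation into a statement about the w-derivative of the endpoint.
variable {F} in
theorem picardMap_slowDown {p : V3} {y : C(unitInterval, ℝ)} (h : picardMap F (p, y) = 0)
    (t : unitInterval) : picardMap F ((p.1, t * p.2.1, p.2.2), slowDown t y) = 0 := by
  rw [picardMap_eq_zero_iff] at h ⊢
  intro τ
  have h1 := h (t * τ)
  change y (t * τ) = _
  rw [h1]
  have h2 := intervalIntegral.mul_integral_comp_mul_left (a := 0) (b := (τ : ℝ)) (c := (t : ℝ))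
    (f := fun s => F (graphCurve (p, y) (Set.projIcc 0 1 zero_le_one s)))
  simp only [mul_zero] at h2
  dsimp only
  rw [Set.Icc.coe_mul, ← h2, mul_comm (t : ℝ) p.2.1, mul_assoc]
  congr 3
  refine intervalIntegral.integral_congr fun s hs => ?_
  rw [Set.uIcc_of_le τ.2.1] at hs
  have hs1 : s ∈ Set.Icc (0 : ℝ) 1 := ⟨hs.1, hs.2.trans τ.2.2⟩
  have hs2 : (t : ℝ) * s ∈ Set.Icc (0 : ℝ) 1 :=
    ⟨mul_nonneg t.2.1 hs1.1, mul_le_one₀ t.2.2 hs1.1 hs1.2⟩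
  simp only [graphCurve_apply, Set.projIcc_of_mem zero_le_one hs1,
    Set.projIcc_of_mem zero_le_one hs2]
  refine congrArg F (Prod.ext rfl (Prod.ext ?_ rfl))
  dsimp only
  ring

/-- Smooth dependence on parameters and initial values for a scalar ordinary differential
equation: `P (x, w, c)` is the value at time `w` of the solution of `u' = F (x, w, u)` with
`u 0 = c`. -/
theorem exists_smooth_ode_solution (hF : ContDiff ℝ ∞ F) :
    ∃ (S : Set V3) (P : V3 → ℝ), IsOpen S ∧ (0 : V3) ∈ S ∧ ContDiffOn ℝ ∞ P S ∧
      (∀ x c, (x, 0, c) ∈ S → P (x, 0, c) = c) ∧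
      ∀ p ∈ S, fderiv ℝ P p (0, 1, 0) = F (p.1, p.2.1, P p) := by
  obtain ⟨A, hA⟩ := exists_equiv_hasFDerivAt_picardMap F hF
  obtain ⟨e, he0, -, hef, hes⟩ := exists_openPartialHomeomorph_of_hasFDerivAt isOpen_univ
    (contDiff_fst.prodMk (contDiff_picardMap F hF)).contDiffOn (Set.mem_univ _) hA
  have hΦ0 : picardMap F 0 = 0 := by simp [picardMap]
  obtain ⟨ρ, hρ, hball⟩ := Metric.isOpen_iff.1 e.open_source 0 he0
  let Y : V3 → C(unitInterval, ℝ) := fun p => (e.symm (p, 0)).2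
  let D : Set V3 := {p | (p, (0 : C(unitInterval, ℝ))) ∈ e.target}
  have hDo : IsOpen D := e.open_target.preimage (by fun_prop)
  have hYsm : ContDiffOn ℝ ∞ Y D := contDiff_snd.comp_contDiffOn
    (hes.comp (by fun_prop : ContDiffOn ℝ ∞ (fun p : V3 => (p, (0 : C(unitInterval, ℝ)))) D)
      (fun p hp => hp))
  have hYeq : ∀ p ∈ D, e.symm (p, 0) = (p, Y p) ∧ picardMap F (p, Y p) = 0 := by
    intro p hp
    have h1 := e.right_inv hp
    rw [hef] at h1
    have h2 : (e.symm (p, 0)).1 = p := congrArg Prod.fst h1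
    have h3 : e.symm (p, 0) = (p, Y p) := Prod.ext h2 rfl
    refine ⟨h3, ?_⟩
    rw [h3] at h1
    exact congrArg Prod.snd h1
  -- Local uniqueness: any small zero of `picardMap` is the one given by the inverse function
  -- theorem. It identifies slowed-down solutions with `Y` at the rescaled parameter.
  have hkey : ∀ p y, ‖p‖ < ρ → ‖y‖ < ρ → picardMap F (p, y) = 0 → p ∈ D ∧ Y p = y := by
    intro p y hp hy hpy
    have hs : (p, y) ∈ e.source := hball (by
      rw [mem_ball_zero_iff]; exact max_lt hp hy)
    have h1 : e (p, y) = (p, 0) := by rw [hef, hpy]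
    refine ⟨?_, ?_⟩
    · change (p, _) ∈ e.target
      rw [← h1]; exact e.map_source hs
    · change (e.symm (p, 0)).2 = y
      rw [← h1, e.left_inv hs]
  let S : Set V3 := Metric.ball 0 ρ ∩ (D ∩ Y ⁻¹' Metric.ball 0 ρ)
  have hSo : IsOpen S := Metric.isOpen_ball.inter
    (hYsm.continuousOn.isOpen_inter_preimage hDo Metric.isOpen_ball)
  have hSD : S ⊆ D := fun p hp => hp.2.1
  let P : V3 → ℝ := fun p => Y p 1
  have hPsm : ContDiffOn ℝ ∞ P S :=
    (ContDiff.comp_contDiffOn (g := fun y : C(unitInterval, ℝ) => y 1)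
      (ContinuousMap.evalCLM (M := ℝ) ℝ (1 : unitInterval)).contDiff hYsm).mono hSD
  have h0S : (0 : V3) ∈ S := by
    obtain ⟨h1, h2⟩ := hkey 0 0 (by simpa using hρ) (by simpa using hρ) hΦ0
    refine ⟨by simpa using hρ, h1, ?_⟩
    rw [Set.mem_preimage, h2]
    simpa using hρ
  have hscale : ∀ p ∈ S, ∀ t : unitInterval, P (p.1, t * p.2.1, p.2.2) = Y p t := by
    intro p hp t
    have h1 := picardMap_slowDown (hYeq p (hSD hp)).2 t
    have hpn : ‖((p.1, t * p.2.1, p.2.2) : V3)‖ < ρ := by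
      refine lt_of_le_of_lt ?_ (mem_ball_zero_iff.1 hp.1)
      refine norm_prod_le_iff.2 ⟨norm_fst_le p, norm_prod_le_iff.2 ⟨?_, ?_⟩⟩
      · change ‖(t : ℝ) * p.2.1‖ ≤ _
        rw [norm_mul, Real.norm_of_nonneg t.2.1]
        exact (mul_le_of_le_one_left (norm_nonneg _) t.2.2).trans
          ((norm_fst_le p.2).trans (norm_snd_le p))
      · exact (norm_snd_le p.2).trans (norm_snd_le p)
    have h2 := (hkey _ _ hpn ((norm_slowDown_le t (Y p)).trans_lt
      (mem_ball_zero_iff.1 hp.2.2)) h1).2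
    change Y _ 1 = _
    rw [h2]
    change Y p (t * 1) = _
    rw [mul_one]
  -- Differentiate at t = 1 along t ↦ (x, t w, c). The formula is known only for t in [0, 1], so
  -- derivatives within this interval are compared; then the factor w ≠ 0 is cancelled.
  have hne : ∀ p ∈ S, p.2.1 ≠ 0 → fderiv ℝ P p (0, 1, 0) = F (p.1, p.2.1, P p) := by
    intro p hp hw
    let f : ℝ → ℝ := fun s => F (graphCurve (p, Y p) (Set.projIcc 0 1 zero_le_one s))
    have hf : Continuous f := by
      have : Continuous (Set.projIcc (0 : ℝ) 1 zero_le_one) := continuous_projIcc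
      fun_prop
    have hd1 : HasDerivAt (fun t : ℝ => p.2.2 + p.2.1 * ∫ s in (0 : ℝ)..t, f s)
        (p.2.1 * f 1) 1 :=
      ((hf.integral_hasStrictDerivAt 0 1).hasDerivAt.const_mul _).const_add _
    have hline : HasDerivAt (fun t : ℝ => ((p.1, t * p.2.1, p.2.2) : V3)) (0, p.2.1, 0) 1 :=
      (hasDerivAt_const _ _).prodMk
        ((by simpa using (hasDerivAt_id (1 : ℝ)).mul_const p.2.1 :
          HasDerivAt (fun t : ℝ => t * p.2.1) p.2.1 1).prodMk (hasDerivAt_const _ _))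
    have hPd : HasFDerivAt P (fderiv ℝ P p) (p.1, (1 : ℝ) * p.2.1, p.2.2) := by
      rw [one_mul]
      exact ((hPsm.contDiffAt (hSo.mem_nhds hp)).differentiableAt (by simp)).hasFDerivAt
    have hd2 : HasDerivAt (fun t : ℝ => P (p.1, t * p.2.1, p.2.2))
        (fderiv ℝ P p (0, p.2.1, 0)) 1 :=
      HasFDerivAt.comp_hasDerivAt (l := P) 1 hPd hline
    have heq : Set.EqOn (fun t : ℝ => P (p.1, t * p.2.1, p.2.2))
        (fun t : ℝ => p.2.2 + p.2.1 * ∫ s in (0 : ℝ)..t, f s) (Set.Icc 0 1) := by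
      intro t ht
      exact (hscale p hp ⟨t, ht⟩).trans
        (picardMap_eq_zero_iff.1 (hYeq p (hSD hp)).2 ⟨t, ht⟩)
    have h1mem : (1 : ℝ) ∈ Set.Icc (0 : ℝ) 1 := ⟨zero_le_one, le_rfl⟩
    have hu := (uniqueDiffOn_Icc (zero_lt_one' ℝ) 1 h1mem).eq_deriv _
      (hd2.hasDerivWithinAt) (hd1.hasDerivWithinAt.congr heq (heq h1mem))
    have hlin : fderiv ℝ P p (0, p.2.1, 0) = p.2.1 * fderiv ℝ P p (0, 1, 0) := by
      rw [← smul_eq_mul, ← map_smul]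
      simp
    rw [hlin] at hu
    have hf1 : f 1 = F (p.1, p.2.1, P p) := by
      simp only [f, Set.projIcc_right, graphCurve_apply]
      refine congrArg F (Prod.ext rfl (Prod.ext ?_ rfl))
      exact one_mul _
    rw [← hf1]
    exact mul_left_cancel₀ hw hu
  refine ⟨S, P, hSo, h0S, hPsm, ?_, ?_⟩
  · intro x c hp
    have h1 := picardMap_eq_zero_iff.1 (hYeq _ (hSD hp)).2 1
    simpa using h1
  · rintro ⟨x, w, c⟩ hp
    -- At w = 0 the equation follows by continuity from the nearby points with w ≠ 0.
    by_cases hw : w = 0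
    · subst hw
      have hc : ContinuousAt (fun w : ℝ => fderiv ℝ P (x, w, c) (0, 1, 0) - F (x, w, P (x, w, c)))
          0 := by
        have hline : Continuous (fun w : ℝ => ((x, w, c) : V3)) := by fun_prop
        have h1 : ContinuousAt (fun w : ℝ => fderiv ℝ P (x, w, c)) 0 :=
          ContinuousAt.comp (f := fun w : ℝ => ((x, w, c) : V3)) (g := fderiv ℝ P)
            ((hPsm.continuousOn_fderiv_of_isOpen hSo (by simp)).continuousAt (hSo.mem_nhds hp))
            hline.continuousAt
        have h2 : ContinuousAt (fun w : ℝ => P (x, w, c)) 0 :=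
          ContinuousAt.comp (f := fun w : ℝ => ((x, w, c) : V3)) (g := P)
            (hPsm.continuousOn.continuousAt (hSo.mem_nhds hp)) hline.continuousAt
        have h3 : ContinuousAt (fun w : ℝ => F (x, w, P (x, w, c))) 0 :=
          F.continuous.continuousAt.comp
            (continuousAt_const.prodMk (continuousAt_id.prodMk h2))
        exact (h1.clm_apply continuousAt_const).sub h3
      have hev : (fun w : ℝ => fderiv ℝ P (x, w, c) (0, 1, 0) - F (x, w, P (x, w, c)))
          =ᶠ[𝓝[≠] 0] fun _ => 0 := by
        have : ∀ᶠ w : ℝ in 𝓝 0, ((x, w, c) : V3) ∈ S :=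
          (by fun_prop : Continuous (fun w : ℝ => ((x, w, c) : V3))).continuousAt.eventually_mem
            (hSo.mem_nhds hp)
        filter_upwards [this.filter_mono nhdsWithin_le_nhds, self_mem_nhdsWithin] with w h1 h2
        rw [hne _ h1 h2, sub_self]
      have h1 := (hc.tendsto.mono_left (nhdsWithin_le_nhds (s := {0}ᶜ))).congr' hev
      exact sub_eq_zero.1 (tendsto_nhds_unique h1 tendsto_const_nhds)
    · exact hne _ hp hw

end ScalarODE

/-! ### Small compactly supported perturbations of open embeddings. -/

section Perturbation

theorem exists_equiv_of_injective {E : Type*} [NormedAddCommGroup E] [NormedSpace ℝ E]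
    [FiniteDimensional ℝ E] (L : E →L[ℝ] E) (hL : ∀ v, L v = 0 → v = 0) :
    ∃ A : E ≃L[ℝ] E, (A : E →L[ℝ] E) = L := by
  have hinj : Function.Injective L.toLinearMap := by
    rw [← LinearMap.ker_eq_bot, LinearMap.ker_eq_bot']
    exact hL
  exact ⟨(LinearEquiv.ofInjectiveEndo L.toLinearMap hinj).toContinuousLinearEquiv,
    ContinuousLinearMap.ext fun v => rfl⟩

/-- A property that is open in `(s, q)` and holds at `s = 0` along a compact set holds along the
compact set for all small `s`. -/
theorem exists_pos_forall_Ioo_of_isOpen {E : Type*} [TopologicalSpace E] {C : Set E}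
    (hC : IsCompact C) {O : Set (ℝ × E)} (hO : IsOpen O) (h0 : ∀ q ∈ C, ((0 : ℝ), q) ∈ O) :
    ∃ r > 0, ∀ s ∈ Set.Ioo (-r) r, ∀ q ∈ C, (s, q) ∈ O := by
  obtain ⟨u, v, hu, -, h0u, hCv, huv⟩ := generalized_tube_lemma (isCompact_singleton (x := (0 : ℝ)))
    hC hO (by rintro ⟨s, q⟩ ⟨hs, hq⟩; obtain rfl : s = 0 := hs; exact h0 q hq)
  obtain ⟨r, hr, hball⟩ := Metric.isOpen_iff.1 hu 0 (h0u rfl)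
  refine ⟨r, hr, fun s hs q hq => huv ⟨hball ?_, hCv hq⟩⟩
  rw [Real.ball_eq_Ioo]
  simpa using hs

variable {E : Type*} [NormedAddCommGroup E] [NormedSpace ℝ E] [FiniteDimensional ℝ E]
  [Nontrivial E]

/-- A smooth family of compactly supported maps starting at the identity consists of
diffeomorphisms for small times, and the inverses depend smoothly on time. -/
theorem exists_smooth_inverse_family {C : Set E} (hC : IsCompact C) {r₁ : ℝ} (hr₁ : 0 < r₁)
    (Θ : ℝ → E → E)
    (hΘ : ContDiffOn ℝ ∞ (fun q : ℝ × E => Θ q.1 q.2) (Set.Ioo (-r₁) r₁ ×ˢ Set.univ))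
    (hΘC : ∀ s ∈ Set.Ioo (-r₁) r₁, ∀ q ∉ C, Θ s q = q) (hΘ0 : ∀ q, Θ 0 q = q) :
    ∃ r > 0, r ≤ r₁ ∧ ∃ Θ' : ℝ → E → E,
      ContDiffOn ℝ ∞ (fun q : ℝ × E => Θ' q.1 q.2) (Set.Ioo (-r) r ×ˢ Set.univ) ∧
      ∀ s ∈ Set.Ioo (-r) r, (∀ q, Θ' s (Θ s q) = q) ∧ ∀ q, Θ s (Θ' s q) = q := by
  have : CompleteSpace E := FiniteDimensional.complete ℝ E
  set f : ℝ × E → E := fun q => Θ q.1 q.2 with hf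
  have hopen : IsOpen (Set.Ioo (-r₁) r₁ ×ˢ (Set.univ : Set E)) := isOpen_Ioo.prod isOpen_univ
  -- `D (s, q)` is the differential of `Θ s - id`. It vanishes at s = 0 and off `C`, so compactness
  -- of `C` gives norm at most 1/2 everywhere for small s: `Θ s` is the identity plus a contraction,
  -- hence bijective.
  let D : ℝ × E → E →L[ℝ] E := fun p =>
    (fderiv ℝ f p).comp (ContinuousLinearMap.inr ℝ ℝ E) - ContinuousLinearMap.id ℝ E
  have hDc : ContinuousOn D (Set.Ioo (-r₁) r₁ ×ˢ Set.univ) :=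
    ((hΘ.continuousOn_fderiv_of_isOpen hopen (by simp)).clm_comp continuousOn_const).sub
      continuousOn_const
  have hDderiv : ∀ s ∈ Set.Ioo (-r₁) r₁, ∀ q, HasFDerivAt (fun q => Θ s q - q) (D (s, q)) q := by
    intro s hs q
    have h1 : HasFDerivAt f (fderiv ℝ f (s, q)) (s, q) :=
      ((hΘ.contDiffAt (hopen.mem_nhds ⟨hs, trivial⟩)).differentiableAt (by simp)).hasFDerivAt
    exact (HasFDerivAt.comp (g := f) q h1 (hasFDerivAt_prodMk_right s q)).sub (hasFDerivAt_id q)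
  have hD0 : ∀ q, D (0, q) = 0 := by
    intro q
    have h1 := hDderiv 0 ⟨by linarith, hr₁⟩ q
    have h2 : (fun q => Θ 0 q - q) = fun _ => (0 : E) := by
      funext q; rw [hΘ0, sub_self]
    rw [h2] at h1
    exact h1.unique (hasFDerivAt_const _ _)
  have hDout : ∀ s ∈ Set.Ioo (-r₁) r₁, ∀ q ∉ C, D (s, q) = 0 := by
    intro s hs q hq
    have h1 := hDderiv s hs q
    have h2 : (fun q => Θ s q - q) =ᶠ[𝓝 q] fun _ => (0 : E) := by
      filter_upwards [hC.isClosed.isOpen_compl.mem_nhds hq] with p hp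
      rw [hΘC s hs p hp, sub_self]
    exact (h1.congr_of_eventuallyEq h2.symm).unique (hasFDerivAt_const _ _)
  obtain ⟨r, hr, hrC⟩ := exists_pos_forall_Ioo_of_isOpen hC
    (hDc.isOpen_inter_preimage hopen (Metric.isOpen_ball (x := (0 : E →L[ℝ] E)) (ε := 1 / 2)))
    (fun q _ => ⟨⟨⟨by simpa using hr₁, hr₁⟩, trivial⟩, by
      rw [Set.mem_preimage, hD0]; simp⟩)
  have hsub : Set.Ioo (-min r r₁) (min r r₁) ⊆ Set.Ioo (-r₁) r₁ :=
    Set.Ioo_subset_Ioo (neg_le_neg (min_le_right _ _)) (min_le_right _ _)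
  have hDlt : ∀ s ∈ Set.Ioo (-min r r₁) (min r r₁), ∀ q, ‖D (s, q)‖ ≤ 1 / 2 := by
    intro s hs q
    by_cases hq : q ∈ C
    · have := (hrC s (Set.Ioo_subset_Ioo (neg_le_neg (min_le_left _ _)) (min_le_left _ _) hs)
        q hq).2
      rw [Set.mem_preimage, mem_ball_zero_iff] at this
      exact this.le
    · rw [hDout s (hsub hs) q hq, norm_zero]; norm_num
  have hlip : ∀ s ∈ Set.Ioo (-min r r₁) (min r r₁), ∀ p q,
      ‖(Θ s p - p) - (Θ s q - q)‖ ≤ 1 / 2 * ‖p - q‖ := by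
    intro s hs p q
    exact Convex.norm_image_sub_le_of_norm_hasFDerivWithin_le (𝕜 := ℝ) (s := Set.univ)
      (f := fun q => Θ s q - q) (f' := fun q => D (s, q))
      (fun x _ => (hDderiv s (hsub hs) x).hasFDerivWithinAt) (fun x _ => hDlt s hs x)
      convex_univ (Set.mem_univ _) (Set.mem_univ _)
  have hsurj : ∀ s ∈ Set.Ioo (-min r r₁) (min r r₁), Function.Surjective (Θ s) := by
    intro s hs
    have happ : ApproximatesLinearOn (Θ s) ((ContinuousLinearEquiv.refl ℝ E : E ≃L[ℝ] E) :
        E →L[ℝ] E) Set.univ (1 / 2) := by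
      intro p _ q _
      have := hlip s hs p q
      rw [sub_sub_sub_comm] at this
      simpa using this
    refine (happ.toHomeomorph (Θ s) (Or.inr ?_)).surjective
    have : ‖((ContinuousLinearEquiv.refl ℝ E).symm : E →L[ℝ] E)‖₊ = 1 :=
      NNReal.eq ContinuousLinearMap.norm_id
    rw [this, inv_one, ← NNReal.coe_lt_coe]
    norm_num
  have hrpos : 0 < min r r₁ := lt_min hr hr₁
  have hopen' : IsOpen (Set.Ioo (-min r r₁) (min r r₁) ×ˢ (Set.univ : Set E)) :=
    isOpen_Ioo.prod isOpen_univ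
  have hsub' : Set.Ioo (-min r r₁) (min r r₁) ×ˢ (Set.univ : Set E) ⊆
    Set.Ioo (-r₁) r₁ ×ˢ Set.univ := Set.prod_mono hsub le_rfl
  -- Inverting (s, q) ↦ (s, Θ s q) makes the inverse smooth in both variables at once.
  obtain ⟨e, hes, hef, hsymm⟩ := exists_openPartialHomeomorph_of_injOn
    (f := fun q : ℝ × E => (q.1, f q)) hopen' (contDiffOn_fst.prodMk (hΘ.mono hsub'))
    (by
      rintro ⟨s, p⟩ ⟨hs, -⟩ ⟨s', q⟩ - hpq
      obtain ⟨rfl, h2⟩ := Prod.mk.inj hpq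
      have h3 := hlip s hs p q
      change Θ s p = Θ s q at h2
      rw [h2, sub_sub_sub_cancel_left, norm_sub_rev] at h3
      have : p - q = 0 := norm_eq_zero.1 (by linarith [norm_nonneg (p - q)])
      rw [sub_eq_zero.1 this])
    (by
      rintro ⟨s, p⟩ hsp
      have h1 : HasFDerivAt f (fderiv ℝ f (s, p)) (s, p) :=
        ((hΘ.contDiffAt (hopen.mem_nhds (hsub' hsp))).differentiableAt (by simp)).hasFDerivAt
      have h2 := (hasFDerivAt_fst (𝕜 := ℝ) (E := ℝ) (F := E) (p := (s, p))).prodMk h1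
      obtain ⟨A, hA⟩ := exists_equiv_of_injective ((ContinuousLinearMap.fst ℝ ℝ E).prod
        (fderiv ℝ f (s, p))) (by
          rintro ⟨a, v⟩ hv
          obtain ⟨rfl, h4⟩ := Prod.mk.inj hv
          have h5 := (D (s, p)).le_of_opNorm_le (hDlt s hsp.1 p) v
          have h6 : D (s, p) v = -v := by
            change fderiv ℝ f (s, p) (0, v) - v = -v
            have h7 : fderiv ℝ f (s, p) (0, v) = 0 := h4
            rw [h7, zero_sub]
          rw [h6, norm_neg] at h5
          have : v = 0 := norm_eq_zero.1 (by linarith [norm_nonneg v])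
          rw [this]; rfl)
      exact ⟨A, hA ▸ h2⟩)
  have htarget : Set.Ioo (-min r r₁) (min r r₁) ×ˢ (Set.univ : Set E) ⊆ e.target := by
    rintro ⟨s, q⟩ ⟨hs, -⟩
    obtain ⟨p, rfl⟩ := hsurj s hs q
    have := e.map_source (x := (s, p)) (by rw [hes]; exact ⟨hs, trivial⟩)
    rwa [hef] at this
  refine ⟨min r r₁, hrpos, min_le_right _ _, fun s q => (e.symm (s, q)).2,
    contDiff_snd.comp_contDiffOn (hsymm.mono htarget), fun s hs => ⟨fun q => ?_, fun q => ?_⟩⟩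
  · have := e.left_inv (x := (s, q)) (by rw [hes]; exact ⟨hs, trivial⟩)
    rw [hef] at this
    exact congrArg Prod.snd this
  · have h1 := e.right_inv (htarget (Set.mk_mem_prod hs (Set.mem_univ q)))
    rw [hef] at h1
    have h2 : (e.symm (s, q)).1 = s := congrArg Prod.fst h1
    have h3 : Θ (e.symm (s, q)).1 (e.symm (s, q)).2 = q := congrArg Prod.snd h1
    rwa [h2] at h3

/-- If `ρ s` is a smooth family of maps that agree off a compact set with an open embedding `ρ 0`,
then `ρ s = ρ 0 ∘ Θ s` for a smooth family of compactly supported diffeomorphisms `Θ s`. -/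
theorem exists_compactlySupported_factor {N C : Set E} (hN : IsOpen N) (hC : IsCompact C)
    (hCN : C ⊆ N) {r₀ : ℝ} (hr₀ : 0 < r₀) (ρ : ℝ → E → E)
    (hρ : ContDiffOn ℝ ∞ (fun q : ℝ × E => ρ q.1 q.2) (Set.Ioo (-r₀) r₀ ×ˢ N))
    (hfix : ∀ s ∈ Set.Ioo (-r₀) r₀, ∀ q ∈ N, q ∉ C → ρ s q = ρ 0 q)
    (e : OpenPartialHomeomorph E E) (hes : e.source = N) (he : ∀ q ∈ N, e q = ρ 0 q)
    (hsymm : ContDiffOn ℝ ∞ e.symm e.target) :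
    ∃ r > 0, r ≤ r₀ ∧ ∃ Θ Θ' : ℝ → E → E,
      ContDiffOn ℝ ∞ (fun q : ℝ × E => Θ q.1 q.2) (Set.Ioo (-r) r ×ˢ Set.univ) ∧
      ContDiffOn ℝ ∞ (fun q : ℝ × E => Θ' q.1 q.2) (Set.Ioo (-r) r ×ˢ Set.univ) ∧
      (∀ q, Θ 0 q = q) ∧
      ∀ s ∈ Set.Ioo (-r) r, (∀ q, Θ' s (Θ s q) = q) ∧ (∀ q, Θ s (Θ' s q) = q) ∧
        (∀ q ∉ C, Θ s q = q) ∧ ∀ q ∈ N, Θ s q ∈ N ∧ ρ 0 (Θ s q) = ρ s q := by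
  classical
  have hopen : IsOpen (Set.Ioo (-r₀) r₀ ×ˢ N) := isOpen_Ioo.prod hN
  have hmem0 : (0 : ℝ) ∈ Set.Ioo (-r₀) r₀ := ⟨by linarith, hr₀⟩
  obtain ⟨r, hr, hrC⟩ := exists_pos_forall_Ioo_of_isOpen hC
    (hρ.continuousOn.isOpen_inter_preimage hopen e.open_target)
    (fun q hq => ⟨⟨hmem0, hCN hq⟩, by
      change ρ 0 q ∈ e.target
      rw [← he q (hCN hq)]; exact e.map_source (hes ▸ hCN hq)⟩)
  have hsub : Set.Ioo (-min r r₀) (min r r₀) ⊆ Set.Ioo (-r₀) r₀ :=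
    Set.Ioo_subset_Ioo (neg_le_neg (min_le_right _ _)) (min_le_right _ _)
  have htgt : ∀ s ∈ Set.Ioo (-min r r₀) (min r r₀), ∀ q ∈ N, ρ s q ∈ e.target := by
    intro s hs q hq
    by_cases hqC : q ∈ C
    · exact (hrC s (Set.Ioo_subset_Ioo (neg_le_neg (min_le_left _ _)) (min_le_left _ _) hs)
        q hqC).2
    · rw [hfix s (hsub hs) q hq hqC, ← he q hq]
      exact e.map_source (hes ▸ hq)
  -- On `N` the factor must be the inverse of `ρ 0` applied to `ρ s`. This is the identity on `N`
  -- minus `C`, so it glues smoothly with the identity outside `N`.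
  let Θ : ℝ → E → E := fun s q => if q ∈ N then e.symm (ρ s q) else q
  have hΘN : ∀ s, ∀ q ∈ N, Θ s q = e.symm (ρ s q) := fun s q hq => if_pos hq
  have hΘC : ∀ s ∈ Set.Ioo (-min r r₀) (min r r₀), ∀ q ∉ C, Θ s q = q := by
    intro s hs q hq
    by_cases hqN : q ∈ N
    · rw [hΘN s q hqN, hfix s (hsub hs) q hqN hq, ← he q hqN, e.left_inv (hes ▸ hqN)]
    · exact if_neg hqN
  have hΘ0 : ∀ q, Θ 0 q = q := by
    intro q
    by_cases hqN : q ∈ N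
    · rw [hΘN 0 q hqN, ← he q hqN, e.left_inv (hes ▸ hqN)]
    · exact if_neg hqN
  have hΘs : ContDiffOn ℝ ∞ (fun q : ℝ × E => Θ q.1 q.2)
      (Set.Ioo (-min r r₀) (min r r₀) ×ˢ Set.univ) := by
    rintro ⟨s, q⟩ ⟨hs, -⟩
    refine ContDiffAt.contDiffWithinAt ?_
    by_cases hqC : q ∈ C
    · have hnhds : Set.Ioo (-min r r₀) (min r r₀) ×ˢ N ∈ 𝓝 (s, q) :=
        (isOpen_Ioo.prod hN).mem_nhds ⟨hs, hCN hqC⟩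
      have h1 : ContDiffAt ℝ ∞ (fun q : ℝ × E => e.symm (ρ q.1 q.2)) (s, q) :=
        ContDiffAt.comp (g := e.symm) (s, q)
          (hsymm.contDiffAt (e.open_target.mem_nhds (htgt s hs q (hCN hqC))))
          (hρ.contDiffAt (hopen.mem_nhds ⟨hsub hs, hCN hqC⟩))
      refine h1.congr_of_eventuallyEq ?_
      filter_upwards [hnhds] with p hp using hΘN _ _ hp.2
    · have hnhds : Set.Ioo (-min r r₀) (min r r₀) ×ˢ Cᶜ ∈ 𝓝 (s, q) :=
        (isOpen_Ioo.prod hC.isClosed.isOpen_compl).mem_nhds ⟨hs, hqC⟩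
      refine contDiffAt_snd.congr_of_eventuallyEq ?_
      filter_upwards [hnhds] with p hp using hΘC _ hp.1 _ hp.2
  obtain ⟨r', hr', hle, Θ', hΘ's, hinv⟩ := exists_smooth_inverse_family hC (lt_min hr hr₀) Θ hΘs
    hΘC hΘ0
  have hsub' : Set.Ioo (-r') r' ⊆ Set.Ioo (-min r r₀) (min r r₀) :=
    Set.Ioo_subset_Ioo (neg_le_neg hle) hle
  refine ⟨r', hr', hle.trans (min_le_right _ _), Θ, Θ', hΘs.mono (Set.prod_mono hsub' le_rfl),
    hΘ's, hΘ0, fun s hs => ⟨(hinv s hs).1, (hinv s hs).2, hΘC s (hsub' hs), fun q hq => ?_⟩⟩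
  have h1 := htgt s (hsub' hs) q hq
  have h2 : Θ s q ∈ N := by rw [hΘN s q hq]; exact hes ▸ e.map_target h1
  refine ⟨h2, ?_⟩
  rw [← he _ h2, hΘN s q hq, e.right_inv h1]

end Perturbation

/-! ### Generating functions of contact transformations. -/

section GeneratingFunctions

/-- The standard contact form `dz - y dx` on `ℝ³`. -/
def stdForm (q v : V3) : ℝ := v.2.2 - q.2.1 * v.1

/-- The partial derivative with respect to the first variable. -/
def partialX (W : V3 → ℝ) (q : V3) : ℝ := fderiv ℝ W q (1, 0, 0)

/-- The partial derivative with respect to the second variable. -/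
def partialY (W : V3 → ℝ) (q : V3) : ℝ := fderiv ℝ W q (0, 1, 0)

/-- The partial derivative with respect to the third variable. -/
def partialZ (W : V3 → ℝ) (q : V3) : ℝ := fderiv ℝ W q (0, 0, 1)

theorem fderiv_apply_eq_partial (W : V3 → ℝ) (q v : V3) :
    fderiv ℝ W q v = v.1 * partialX W q + v.2.1 * partialY W q + v.2.2 * partialZ W q := by
  have hv : v = v.1 • ((1, 0, 0) : V3) + v.2.1 • ((0, 1, 0) : V3) + v.2.2 • ((0, 0, 1) : V3) := by
    ext <;> simp
  conv_lhs => rw [hv]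
  simp only [map_add, map_smul, smul_eq_mul]
  rfl

/-- The source coordinates `(x, y, z)` of the contact transformation with generating function
`W (x, Y, z)`. -/
def genSource (W : V3 → ℝ) (q : V3) : V3 := (q.1, -(partialX W q / partialZ W q), q.2.2)

/-- The target coordinates `(X, Y, Z)` of the contact transformation with generating function
`W (x, Y, z)`. -/
def genTarget (W : V3 → ℝ) (q : V3) : V3 := (-partialY W q, q.2.1, W q - q.2.1 * partialY W q)

section Smoothness

variable {W : V3 → ℝ} {N : Set V3}

theorem contDiffOn_fderiv_apply (hN : IsOpen N) (hW : ContDiffOn ℝ ∞ W N) (v : V3) :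
    ContDiffOn ℝ ∞ (fun q => fderiv ℝ W q v) N :=
  ((contDiffOn_infty_iff_fderiv_of_isOpen hN).1 hW).2.clm_apply contDiffOn_const

theorem contDiffOn_partialX (hN : IsOpen N) (hW : ContDiffOn ℝ ∞ W N) :
    ContDiffOn ℝ ∞ (partialX W) N := contDiffOn_fderiv_apply hN hW _

theorem contDiffOn_partialY (hN : IsOpen N) (hW : ContDiffOn ℝ ∞ W N) :
    ContDiffOn ℝ ∞ (partialY W) N := contDiffOn_fderiv_apply hN hW _

theorem contDiffOn_partialZ (hN : IsOpen N) (hW : ContDiffOn ℝ ∞ W N) :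
    ContDiffOn ℝ ∞ (partialZ W) N := contDiffOn_fderiv_apply hN hW _

theorem contDiffOn_genSource (hN : IsOpen N) (hW : ContDiffOn ℝ ∞ W N)
    (hz : ∀ q ∈ N, partialZ W q ≠ 0) : ContDiffOn ℝ ∞ (genSource W) N :=
  contDiffOn_fst.prodMk (((contDiffOn_partialX hN hW).div (contDiffOn_partialZ hN hW) hz).neg.prodMk
    (contDiff_snd.snd.contDiffOn))

theorem contDiffOn_genTarget (hN : IsOpen N) (hW : ContDiffOn ℝ ∞ W N) :
    ContDiffOn ℝ ∞ (genTarget W) N := by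
  have h1 := contDiffOn_partialY hN hW
  have h2 : ContDiffOn ℝ ∞ (fun q : V3 => q.2.1) N := contDiff_snd.fst.contDiffOn
  exact h1.neg.prodMk (h2.prodMk (hW.sub (h2.mul h1)))

end Smoothness

/-- Both maps attached to a generating function pull the contact form back to proportional
forms. -/
theorem stdForm_genTarget {W : V3 → ℝ} {N : Set V3} (hN : IsOpen N) (hW : ContDiffOn ℝ ∞ W N)
    (hz : ∀ q ∈ N, partialZ W q ≠ 0) {q : V3} (hq : q ∈ N) (v : V3) :
    stdForm (genTarget W q) (fderiv ℝ (genTarget W) q v) =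
      partialZ W q * stdForm (genSource W q) (fderiv ℝ (genSource W) q v) := by
  have hnq := hN.mem_nhds hq
  have hWd : DifferentiableAt ℝ W q := (hW.contDiffAt hnq).differentiableAt (by simp)
  have hYd : DifferentiableAt ℝ (partialY W) q :=
    ((contDiffOn_partialY hN hW).contDiffAt hnq).differentiableAt (by simp)
  have hSd : DifferentiableAt ℝ (fun q => -(partialX W q / partialZ W q)) q :=
    (((contDiffOn_partialX hN hW).div (contDiffOn_partialZ hN hW) hz).neg.contDiffAt
      hnq).differentiableAt (by simp)
  have hy : HasFDerivAt (fun q : V3 => q.2.1)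
      ((ContinuousLinearMap.fst ℝ ℝ ℝ).comp (ContinuousLinearMap.snd ℝ ℝ (ℝ × ℝ))) q :=
    ((ContinuousLinearMap.fst ℝ ℝ ℝ).comp (ContinuousLinearMap.snd ℝ ℝ (ℝ × ℝ))).hasFDerivAt
  have hzz : HasFDerivAt (fun q : V3 => q.2.2)
      ((ContinuousLinearMap.snd ℝ ℝ ℝ).comp (ContinuousLinearMap.snd ℝ ℝ (ℝ × ℝ))) q :=
    ((ContinuousLinearMap.snd ℝ ℝ ℝ).comp (ContinuousLinearMap.snd ℝ ℝ (ℝ × ℝ))).hasFDerivAt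
  have h1 : HasFDerivAt (genTarget W) _ q :=
    hYd.hasFDerivAt.neg.prodMk (hy.prodMk (hWd.hasFDerivAt.sub (hy.mul hYd.hasFDerivAt)))
  have h2 : HasFDerivAt (genSource W) _ q :=
    (hasFDerivAt_fst (𝕜 := ℝ) (E := ℝ) (F := ℝ × ℝ) (p := q)).prodMk
      (hSd.hasFDerivAt.prodMk hzz)
  have hz0 := hz q hq
  rw [h1.fderiv, h2.fderiv]
  simp only [stdForm, genTarget, genSource, ContinuousLinearMap.prod_apply,
    neg_apply, sub_apply, add_apply,
    smul_apply, ContinuousLinearMap.comp_apply,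
    ContinuousLinearMap.coe_fst', ContinuousLinearMap.coe_snd', smul_eq_mul]
  -- Both sides equal W_x dx + W_z dz: in dZ - Y dX the terms Y d(W_Y) cancel and leave dW - W_Y dY.
  rw [fderiv_apply_eq_partial W q v]
  field_simp
  ring

/-- Symmetry of the mixed second partial derivatives. -/
theorem fderiv_partial_comm {W : V3 → ℝ} {N : Set V3} (hN : IsOpen N) (hW : ContDiffOn ℝ ∞ W N)
    {q : V3} (hq : q ∈ N) (u v : V3) :
    fderiv ℝ (fun p => fderiv ℝ W p u) q v = fderiv ℝ (fun p => fderiv ℝ W p v) q u := by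
  have hWq : ContDiffAt ℝ ∞ W q := hW.contDiffAt (hN.mem_nhds hq)
  have hd : DifferentiableAt ℝ (fderiv ℝ W) q :=
    (((contDiffOn_infty_iff_fderiv_of_isOpen hN).1 hW).2.contDiffAt
      (hN.mem_nhds hq)).differentiableAt (by simp)
  have hsymm : IsSymmSndFDerivAt ℝ W q :=
    hWq.isSymmSndFDerivAt (by
      rw [minSmoothness_of_isRCLikeNormedField]
      exact WithTop.coe_le_coe.2 (le_top (a := (2 : ℕ∞))))
  have h : ∀ w : V3, HasFDerivAt (fun p => fderiv ℝ W p w)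
      ((ContinuousLinearMap.apply ℝ ℝ w).comp (fderiv ℝ (fderiv ℝ W) q)) q := fun w =>
    (ContinuousLinearMap.apply ℝ ℝ w).hasFDerivAt.comp q hd.hasFDerivAt
  rw [(h u).fderiv, (h v).fderiv]
  exact hsymm v u

/-- A function whose contact transformation is orientation preserving and fixes the `x`-axis. -/
structure IsAxisGenerating (W : V3 → ℝ) (N : Set V3) : Prop where
  isOpen : IsOpen N
  smooth : ContDiffOn ℝ ∞ W N
  pos : ∀ q ∈ N, 0 < partialZ W q
  zero : ∀ x, (x, 0, 0) ∈ N → W (x, 0, 0) = 0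
  partialX_zero : ∀ x, (x, 0, 0) ∈ N → partialX W (x, 0, 0) = 0
  partialY_eq : ∀ x, (x, 0, 0) ∈ N → partialY W (x, 0, 0) = -x

namespace IsAxisGenerating

variable {W : V3 → ℝ} {N : Set V3}

theorem mono (h : IsAxisGenerating W N) {N' : Set V3} (hN' : IsOpen N') (hsub : N' ⊆ N) : IsAxisGenerating W N' :=
  ⟨hN', h.smooth.mono hsub, fun q hq => h.pos q (hsub hq), fun x hx => h.zero x (hsub hx),
    fun x hx => h.partialX_zero x (hsub hx), fun x hx => h.partialY_eq x (hsub hx)⟩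

theorem genSource_axis (h : IsAxisGenerating W N) {x : ℝ} (hx : (x, 0, 0) ∈ N) : genSource W (x, 0, 0) = (x, 0, 0) := by
  simp [genSource, h.partialX_zero x hx]

theorem genTarget_axis (h : IsAxisGenerating W N) {x : ℝ} (hx : (x, 0, 0) ∈ N) : genTarget W (x, 0, 0) = (x, 0, 0) := by
  simp [genTarget, h.partialY_eq x hx, h.zero x hx]

/-- Differentiate W_Y = -x along the axis. This mixed derivative is the nondegeneracy that makes
source and target maps local diffeomorphisms, so it need not be imposed separately. -/
theorem fderiv_partialY_axis (h : IsAxisGenerating W N) {x : ℝ} (hx : (x, 0, 0) ∈ N) :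
    fderiv ℝ (partialY W) (x, 0, 0) (1, 0, 0) = -1 := by
  have hline : HasDerivAt (fun t : ℝ => ((t, 0, 0) : V3)) (1, 0, 0) x :=
    (hasDerivAt_id x).prodMk (hasDerivAt_const x (0 : ℝ × ℝ))
  have hd : HasFDerivAt (partialY W) (fderiv ℝ (partialY W) (x, 0, 0)) (x, 0, 0) :=
    (((contDiffOn_partialY h.isOpen h.smooth).contDiffAt
      (h.isOpen.mem_nhds hx)).differentiableAt (by simp)).hasFDerivAt
  have h1 := HasFDerivAt.comp_hasDerivAt (l := partialY W) x hd hline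
  have hev : ∀ᶠ t in 𝓝 x, ((t, 0, 0) : V3) ∈ N :=
    hline.continuousAt.eventually_mem (h.isOpen.mem_nhds hx)
  have h2 : HasDerivAt (partialY W ∘ fun t : ℝ => ((t, 0, 0) : V3)) (-1) x := by
    refine (hasDerivAt_id x).neg.congr_of_eventuallyEq ?_
    filter_upwards [hev] with t ht using h.partialY_eq t ht
  exact h1.unique h2

theorem fderiv_partialX_axis (h : IsAxisGenerating W N) {x : ℝ} (hx : (x, 0, 0) ∈ N) :
    fderiv ℝ (partialX W) (x, 0, 0) (0, 1, 0) = -1 :=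
  (fderiv_partial_comm h.isOpen h.smooth hx _ _).trans (h.fderiv_partialY_axis hx)

/-- On the axis the differential is triangular: dY comes first, then dZ reduces to W_z dz because
W_x = 0 and Y = 0, and finally dX reduces to -W_xY dx = dx. -/
theorem fderiv_genTarget_axis_injective (h : IsAxisGenerating W N) {x : ℝ} (hx : (x, 0, 0) ∈ N) (v : V3)
    (hv : fderiv ℝ (genTarget W) (x, 0, 0) v = 0) : v = 0 := by
  have hnq := h.isOpen.mem_nhds hx
  have hWd : DifferentiableAt ℝ W (x, 0, 0) :=
    (h.smooth.contDiffAt hnq).differentiableAt (by simp)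
  have hYd : DifferentiableAt ℝ (partialY W) (x, 0, 0) :=
    ((contDiffOn_partialY h.isOpen h.smooth).contDiffAt hnq).differentiableAt (by simp)
  have hy : HasFDerivAt (fun q : V3 => q.2.1)
      ((ContinuousLinearMap.fst ℝ ℝ ℝ).comp (ContinuousLinearMap.snd ℝ ℝ (ℝ × ℝ))) (x, 0, 0) :=
    ((ContinuousLinearMap.fst ℝ ℝ ℝ).comp (ContinuousLinearMap.snd ℝ ℝ (ℝ × ℝ))).hasFDerivAt
  have h1 : HasFDerivAt (genTarget W) _ (x, 0, 0) :=
    hYd.hasFDerivAt.neg.prodMk (hy.prodMk (hWd.hasFDerivAt.sub (hy.mul hYd.hasFDerivAt)))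
  rw [h1.fderiv] at hv
  simp only [ContinuousLinearMap.prod_apply, Prod.mk_eq_zero,
    neg_apply, sub_apply, add_apply,
    smul_apply, ContinuousLinearMap.comp_apply,
    ContinuousLinearMap.coe_fst', ContinuousLinearMap.coe_snd', smul_eq_mul] at hv
  obtain ⟨hv1, hv2, hv3⟩ := hv
  rw [fderiv_apply_eq_partial W, h.partialX_zero x hx, hv2] at hv3
  have hv3' : v.2.2 = 0 := by
    have := (h.pos _ hx).ne'
    simpa [this] using hv3
  have hv4 : v = v.1 • ((1, 0, 0) : V3) := by
    ext <;> simp [hv2, hv3']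
  rw [hv4, map_smul, h.fderiv_partialY_axis hx] at hv1
  rw [hv4]
  have : v.1 = 0 := by simpa using hv1
  rw [this, zero_smul]

/-- The components x and z leave only the direction of Y. Since W_x = 0 on the axis, the derivative
of -W_x / W_z in that direction is -W_xY / W_z = 1 / W_z. -/
theorem fderiv_genSource_axis_injective (h : IsAxisGenerating W N) {x : ℝ} (hx : (x, 0, 0) ∈ N) (v : V3)
    (hv : fderiv ℝ (genSource W) (x, 0, 0) v = 0) : v = 0 := by
  have hnq := h.isOpen.mem_nhds hx
  have hz := (h.pos _ hx).ne'
  have hXd : DifferentiableAt ℝ (partialX W) (x, 0, 0) :=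
    ((contDiffOn_partialX h.isOpen h.smooth).contDiffAt hnq).differentiableAt (by simp)
  have hZd : DifferentiableAt ℝ (partialZ W) (x, 0, 0) :=
    ((contDiffOn_partialZ h.isOpen h.smooth).contDiffAt hnq).differentiableAt (by simp)
  have hzz : HasFDerivAt (fun q : V3 => q.2.2)
      ((ContinuousLinearMap.snd ℝ ℝ ℝ).comp (ContinuousLinearMap.snd ℝ ℝ (ℝ × ℝ))) (x, 0, 0) :=
    ((ContinuousLinearMap.snd ℝ ℝ ℝ).comp (ContinuousLinearMap.snd ℝ ℝ (ℝ × ℝ))).hasFDerivAt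
  have hi : HasFDerivAt (fun p => (partialZ W p)⁻¹) _ (x, 0, 0) :=
    (hasDerivAt_inv hz).comp_hasFDerivAt _ hZd.hasFDerivAt
  have hg : genSource W = fun q => (q.1, -(partialX W q * (partialZ W q)⁻¹), q.2.2) := by
    funext q
    simp [genSource, div_eq_mul_inv]
  have h2 : HasFDerivAt (genSource W) _ (x, 0, 0) := hg ▸
    (hasFDerivAt_fst (𝕜 := ℝ) (E := ℝ) (F := ℝ × ℝ)).prodMk
      ((hXd.hasFDerivAt.mul hi).neg.prodMk hzz)
  rw [h2.fderiv] at hv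
  simp only [ContinuousLinearMap.prod_apply, Prod.mk_eq_zero,
    neg_apply, ContinuousLinearMap.comp_apply, smul_apply,
    ContinuousLinearMap.coe_fst', ContinuousLinearMap.coe_snd', h.partialX_zero x hx, zero_smul,
    zero_add, smul_eq_mul] at hv
  obtain ⟨hv1, hv2, hv3⟩ := hv
  have hv4 : v = v.2.1 • ((0, 1, 0) : V3) := by
    ext <;> simp [hv1, hv3]
  rw [hv4, map_smul] at hv2
  rw [h.fderiv_partialX_axis hx] at hv2
  have h6 : v.2.1 = 0 := by
    simpa [hz] using hv2
  rw [hv4, h6, zero_smul]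

end IsAxisGenerating

end GeneratingFunctions

/-! ### Embeddings near the axis and affine changes of the generating function. -/

section GeneratingIsotopy

/-- A map that is injective on a compact set and locally injective at its points is injective on a
neighbourhood of the set; invertibility of the differential is an open condition. -/
theorem exists_isOpen_injOn_of_isCompact {f : V3 → V3} {N J : Set V3} (hN : IsOpen N)
    (hf : ContDiffOn ℝ ∞ f N) (hJ : IsCompact J) (hJN : J ⊆ N) (hinj : Set.InjOn f J)
    (hd : ∀ q ∈ J, ∀ v, fderiv ℝ f q v = 0 → v = 0) :
    ∃ N' ⊆ N, IsOpen N' ∧ J ⊆ N' ∧ Set.InjOn f N' ∧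
      ∀ q ∈ N', ∃ A : V3 ≃L[ℝ] V3, HasFDerivAt f (A : V3 →L[ℝ] V3) q := by
  have hdf : ∀ q ∈ N, HasFDerivAt f (fderiv ℝ f q) q := fun q hq =>
    ((hf.contDiffAt (hN.mem_nhds hq)).differentiableAt (by simp)).hasFDerivAt
  have hloc : ∀ q ∈ J, ∃ e : OpenPartialHomeomorph V3 V3, q ∈ e.source ∧ e.source ⊆ N ∧
      (∀ x, e x = f x) ∧ ContDiffOn ℝ ∞ e.symm e.target := by
    intro q hq
    obtain ⟨A, hA⟩ := exists_equiv_of_injective _ (hd q hq)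
    exact exists_openPartialHomeomorph_of_hasFDerivAt hN hf (hJN hq) (A := A)
      (hA ▸ hdf q (hJN hq))
  obtain ⟨t, ht, htinj⟩ := hinj.exists_mem_nhdsSet hJ
    (fun q hq => (hdf q (hJN hq)).continuousAt) (fun q hq => by
      obtain ⟨e, hqe, -, hef, -⟩ := hloc q hq
      refine ⟨e.source, e.open_source.mem_nhds hqe, ?_⟩
      have := e.injOn
      rwa [show (e : V3 → V3) = f from funext hef] at this)
  obtain ⟨T, hTo, hJT, hTt⟩ := mem_nhdsSet_iff_exists.1 ht
  let R : Set (V3 →L[ℝ] V3) := Set.range (ContinuousLinearEquiv.toContinuousLinearMap (M₁ := V3)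
    (M₂ := V3) (σ₁₂ := RingHom.id ℝ))
  have hRo : IsOpen R := ContinuousLinearEquiv.isOpen
  have hNR : IsOpen (N ∩ fderiv ℝ f ⁻¹' R) :=
    (hf.continuousOn_fderiv_of_isOpen hN (by simp)).isOpen_inter_preimage hN hRo
  refine ⟨T ∩ (N ∩ fderiv ℝ f ⁻¹' R), fun q hq => hq.2.1, hTo.inter hNR, fun q hq => ⟨hJT hq,
    hJN hq, ?_⟩, htinj.mono fun q hq => hTt hq.1, ?_⟩
  · exact exists_equiv_of_injective _ (hd q hq)
  · rintro q ⟨-, hqN, A, hA⟩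
    exact ⟨A, hA ▸ hdf q hqN⟩

/-- Both maps fix `J` pointwise with injective differentials there. For the last clause, the domain
is shrunk so that target images stay in the region of injectivity: if an image lies on the axis it
is itself fixed by the target map, so it equals the original point. -/
theorem IsAxisGenerating.exists_embedding {W : V3 → ℝ} {N J : Set V3}
    (h : IsAxisGenerating W N) (hJ : IsCompact J) (hJN : J ⊆ N) (hJ0 : ∀ q ∈ J, q.2 = 0) :
    ∃ N' ⊆ N, IsOpen N' ∧ J ⊆ N' ∧
      (∃ e : OpenPartialHomeomorph V3 V3, e.source = N' ∧ (∀ q, e q = genSource W q) ∧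
        ContDiffOn ℝ ∞ e.symm e.target) ∧
      (∃ e : OpenPartialHomeomorph V3 V3, e.source = N' ∧ (∀ q, e q = genTarget W q) ∧
        ContDiffOn ℝ ∞ e.symm e.target) ∧
      ∀ q ∈ N', (genTarget W q).2 = 0 → q.2 = 0 := by
  have hax : ∀ q ∈ J, q = (q.1, 0, 0) := fun q hq => Prod.ext rfl (hJ0 q hq)
  have hS := contDiffOn_genSource h.isOpen h.smooth (fun q hq => (h.pos q hq).ne')
  have hT := contDiffOn_genTarget h.isOpen h.smooth
  have hS0 : ∀ q ∈ J, genSource W q = q := fun q hq => by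
    have h1 := hax q hq
    rw [h1, h.genSource_axis (h1 ▸ hJN hq)]
  have hT0 : ∀ q ∈ J, genTarget W q = q := fun q hq => by
    have h1 := hax q hq
    rw [h1, h.genTarget_axis (h1 ▸ hJN hq)]
  obtain ⟨N₁, hN₁N, hN₁o, hJN₁, hinj₁, hA₁⟩ := exists_isOpen_injOn_of_isCompact h.isOpen hS hJ hJN
    (fun p hp q hq hpq => by rwa [hS0 p hp, hS0 q hq] at hpq)
    (fun q hq => by
      have h1 := hax q hq
      rw [h1]
      exact h.fderiv_genSource_axis_injective (h1 ▸ hJN hq))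
  obtain ⟨N₂, -, hN₂o, hJN₂, hinj₂, hA₂⟩ := exists_isOpen_injOn_of_isCompact h.isOpen hT hJ hJN
    (fun p hp q hq hpq => by rwa [hT0 p hp, hT0 q hq] at hpq)
    (fun q hq => by
      have h1 := hax q hq
      rw [h1]
      exact h.fderiv_genTarget_axis_injective (h1 ▸ hJN hq))
  have hsub : N₁ ∩ N₂ ⊆ N := fun q hq => hN₁N hq.1
  set N₃ := (N₁ ∩ N₂) ∩ genTarget W ⁻¹' (N₁ ∩ N₂) with hN₃
  have hN₃o : IsOpen N₃ := (hT.mono hsub).continuousOn.isOpen_inter_preimage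
    (hN₁o.inter hN₂o) (hN₁o.inter hN₂o)
  have hsub₃ : N₃ ⊆ N := fun q hq => hsub hq.1
  refine ⟨N₃, hsub₃, hN₃o, fun q hq => ⟨⟨hJN₁ hq, hJN₂ hq⟩, ?_⟩, ?_, ?_, ?_⟩
  · rw [Set.mem_preimage, hT0 q hq]
    exact ⟨hJN₁ hq, hJN₂ hq⟩
  · exact exists_openPartialHomeomorph_of_injOn hN₃o (hS.mono hsub₃)
      (hinj₁.mono fun q hq => hq.1.1) (fun q hq => hA₁ q hq.1.1)
  · exact exists_openPartialHomeomorph_of_injOn hN₃o (hT.mono hsub₃)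
      (hinj₂.mono fun q hq => hq.1.2) (fun q hq => hA₂ q hq.1.2)
  · intro q hq hq0
    have h1 : genTarget W q = ((genTarget W q).1, 0, 0) := Prod.ext rfl hq0
    have h2 : ((genTarget W q).1, 0, 0) ∈ N₁ ∩ N₂ := h1 ▸ hq.2
    have h3 := h.genTarget_axis (hsub h2)
    have h4 := hinj₂ h2.2 hq.1.2 (h3.trans h1.symm)
    rw [← h4]
    rfl

theorem fderiv_add_mul_apply {W Q : V3 → ℝ} {q : V3} (hW : DifferentiableAt ℝ W q) (hQ : DifferentiableAt ℝ Q q)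
    (s : ℝ) (v : V3) :
    fderiv ℝ (fun p => W p + s * Q p) q v = fderiv ℝ W q v + s * fderiv ℝ Q q v := by
  have h : HasFDerivAt (fun p => W p + s * Q p) _ q :=
    hW.hasFDerivAt.add (hQ.hasFDerivAt.const_mul s)
  rw [h.fderiv]
  rfl

theorem IsAxisGenerating.add_mul {W Q : V3 → ℝ} {N : Set V3} (h : IsAxisGenerating W N)
    (hQ : ContDiffOn ℝ ∞ Q N) (hQ0 : ∀ x, (x, 0, 0) ∈ N → Q (x, 0, 0) = 0)
    (hQX : ∀ x, (x, 0, 0) ∈ N → partialX Q (x, 0, 0) = 0)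
    (hQY : ∀ x, (x, 0, 0) ∈ N → partialY Q (x, 0, 0) = 0) {s : ℝ}
    (hpos : ∀ q ∈ N, 0 < partialZ W q + s * partialZ Q q) :
    IsAxisGenerating (fun q => W q + s * Q q) N := by
  have hWd : ∀ q ∈ N, DifferentiableAt ℝ W q := fun q hq =>
    (h.smooth.contDiffAt (h.isOpen.mem_nhds hq)).differentiableAt (by simp)
  have hQd : ∀ q ∈ N, DifferentiableAt ℝ Q q := fun q hq =>
    (hQ.contDiffAt (h.isOpen.mem_nhds hq)).differentiableAt (by simp)
  refine ⟨h.isOpen, h.smooth.add (contDiffOn_const.mul hQ), ?_, ?_, ?_, ?_⟩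
  · intro q hq
    have := hpos q hq
    rwa [partialZ, fderiv_add_mul_apply (hWd q hq) (hQd q hq)]
  · intro x hx
    simp [h.zero x hx, hQ0 x hx]
  · intro x hx
    have h1 := hQX x hx
    rw [partialX] at h1
    have h2 := h.partialX_zero x hx
    rw [partialX] at h2
    rw [partialX, fderiv_add_mul_apply (hWd _ hx) (hQd _ hx), h1, h2]
    simp
  · intro x hx
    have h1 := hQY x hx
    rw [partialY] at h1
    have h2 := h.partialY_eq x hx
    rw [partialY] at h2
    rw [partialY, fderiv_add_mul_apply (hWd _ hx) (hQd _ hx), h1, h2]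
    simp

end GeneratingIsotopy

/-! ### Realising a small change of generating function by compactly supported maps. -/

section GeneratingStep

/-- A smooth family `F s` of compactly supported diffeomorphisms of `ℝ³`, written in the
coordinates `genTarget W`, that moves the germ along `J` of the contact transformation generated
by `W` to the one generated by `W + s Q`. -/
structure GeneratingStep (W Q : V3 → ℝ) (J N : Set V3) where
  /-- the embedding `genTarget W` -/
  chart : OpenPartialHomeomorph V3 V3
  chart_source_subset : chart.source ⊆ N
  chart_apply : ∀ q, chart q = genTarget W q
  chart_axis : ∀ q ∈ chart.source, (genTarget W q).2 = 0 → q.2 = 0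
  contDiffOn_chart_symm : ContDiffOn ℝ ∞ chart.symm chart.target
  /-- a compact set containing the supports -/
  supp : Set V3
  isCompact_supp : IsCompact supp
  supp_subset : supp ⊆ chart.source
  /-- the length of the time interval -/
  r : ℝ
  r_pos : 0 < r
  /-- the family of diffeomorphisms -/
  F : ℝ → V3 → V3
  /-- the inverse family -/
  F' : ℝ → V3 → V3
  contDiffOn_F : ContDiffOn ℝ ∞ (fun q : ℝ × V3 => F q.1 q.2) (Set.Ioo (-r) r ×ˢ Set.univ)
  contDiffOn_F' : ContDiffOn ℝ ∞ (fun q : ℝ × V3 => F' q.1 q.2) (Set.Ioo (-r) r ×ˢ Set.univ)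
  F_zero : ∀ q, F 0 q = q
  left_inv : ∀ s ∈ Set.Ioo (-r) r, ∀ q, F' s (F s q) = q
  right_inv : ∀ s ∈ Set.Ioo (-r) r, ∀ q, F s (F' s q) = q
  F_off : ∀ s ∈ Set.Ioo (-r) r, ∀ q ∉ supp, F s q = q
  contact : ∀ s ∈ Set.Ioo (-r) r, ∀ q ∈ chart.source, ∃ c > 0, ∀ v,
    stdForm (genTarget W (F s q)) (fderiv ℝ (genTarget W) (F s q) (fderiv ℝ (F s) q v)) =
      c * stdForm (genTarget W q) (fderiv ℝ (genTarget W) q v)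
  F_axis : ∀ s ∈ Set.Ioo (-r) r, ∀ x, F s (x, 0, 0) = (x, 0, 0)
  F_id : ∀ s ∈ Set.Ioo (-r) r, ∀ p, (∀ᶠ q in 𝓝 p, Q q = 0) → ∀ᶠ q in 𝓝 p, F s q = q
  -- Write S, T for the source and target maps of `W`, and S_s, T_s for those of `W + s Q`. Then S_s
  -- = S θ and T_s = T F_s θ near `J`, which says T_s S_s⁻¹ = (T F_s T⁻¹)(T S⁻¹).
  germ : ∀ s ∈ Set.Ioo (-r) r, ∃ θ : V3 ≃ₜ V3, (∀ q ∈ J, θ q = q) ∧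
    ∀ᶠ q in 𝓝ˢ J, θ q ∈ chart.source ∧ F s (θ q) ∈ chart.source ∧
      genSource (fun p => W p + s * Q p) q = genSource W (θ q) ∧
      genTarget (fun p => W p + s * Q p) q = genTarget W (F s (θ q))

theorem contDiffOn_genSource_family {W Q : V3 → ℝ} {N : Set V3} (hN : IsOpen N)
    (hW : ContDiffOn ℝ ∞ W N) (hQ : ContDiffOn ℝ ∞ Q N) {I : Set ℝ}
    (hpos : ∀ s ∈ I, ∀ q ∈ N, 0 < partialZ W q + s * partialZ Q q) :
    ContDiffOn ℝ ∞ (fun p : ℝ × V3 => genSource (fun q => W q + p.1 * Q q) p.2) (I ×ˢ N) ∧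
    ContDiffOn ℝ ∞ (fun p : ℝ × V3 => genTarget (fun q => W q + p.1 * Q q) p.2) (I ×ˢ N) := by
  have hWd : ∀ q ∈ N, DifferentiableAt ℝ W q := fun q hq =>
    (hW.contDiffAt (hN.mem_nhds hq)).differentiableAt (by simp)
  have hQd : ∀ q ∈ N, DifferentiableAt ℝ Q q := fun q hq =>
    (hQ.contDiffAt (hN.mem_nhds hq)).differentiableAt (by simp)
  have hsnd : Set.MapsTo (fun p : ℝ × V3 => p.2) (I ×ˢ N) N := fun p hp => hp.2
  have hv : ∀ v : V3, ContDiffOn ℝ ∞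
      (fun p : ℝ × V3 => fderiv ℝ W p.2 v + p.1 * fderiv ℝ Q p.2 v) (I ×ˢ N) := fun v =>
    ((contDiffOn_fderiv_apply hN hW v).comp contDiffOn_snd hsnd).add
      (contDiffOn_fst.mul ((contDiffOn_fderiv_apply hN hQ v).comp contDiffOn_snd hsnd))
  have h0 : ContDiffOn ℝ ∞ (fun p : ℝ × V3 => W p.2 + p.1 * Q p.2) (I ×ˢ N) :=
    (hW.comp contDiffOn_snd hsnd).add (contDiffOn_fst.mul (hQ.comp contDiffOn_snd hsnd))
  have hY : ContDiffOn ℝ ∞ (fun p : ℝ × V3 => p.2.2.1) (I ×ˢ N) := by fun_prop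
  constructor
  · have h1 : ContDiffOn ℝ ∞ (fun p : ℝ × V3 => ((p.2.1,
        -((fderiv ℝ W p.2 (1, 0, 0) + p.1 * fderiv ℝ Q p.2 (1, 0, 0)) /
          (fderiv ℝ W p.2 (0, 0, 1) + p.1 * fderiv ℝ Q p.2 (0, 0, 1))), p.2.2.2) : V3))
        (I ×ˢ N) :=
      (by fun_prop : ContDiffOn ℝ ∞ (fun p : ℝ × V3 => p.2.1) (I ×ˢ N)).prodMk
        (((hv _).div (hv _) (fun p hp => (hpos p.1 hp.1 p.2 hp.2).ne')).neg.prodMk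
        (by fun_prop : ContDiffOn ℝ ∞ (fun p : ℝ × V3 => p.2.2.2) (I ×ˢ N)))
    refine h1.congr fun p hp => ?_
    simp only [genSource, partialX, partialZ,
      fderiv_add_mul_apply (hWd _ hp.2) (hQd _ hp.2)]
  · have h1 : ContDiffOn ℝ ∞ (fun p : ℝ × V3 =>
        ((-(fderiv ℝ W p.2 (0, 1, 0) + p.1 * fderiv ℝ Q p.2 (0, 1, 0)), p.2.2.1,
          W p.2 + p.1 * Q p.2 -
            p.2.2.1 * (fderiv ℝ W p.2 (0, 1, 0) + p.1 * fderiv ℝ Q p.2 (0, 1, 0))) : V3))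
        (I ×ˢ N) :=
      (hv _).neg.prodMk (hY.prodMk (h0.sub (hY.mul (hv _))))
    refine h1.congr fun p hp => ?_
    simp only [genTarget, partialY, fderiv_add_mul_apply (hWd _ hp.2) (hQd _ hp.2)]

theorem genSource_congr {W W' : V3 → ℝ} {q : V3} (h : W =ᶠ[𝓝 q] W') :
    genSource W q = genSource W' q := by
  simp only [genSource, partialX, partialZ, h.fderiv_eq]

theorem genTarget_congr {W W' : V3 → ℝ} {q : V3} (h : W =ᶠ[𝓝 q] W') :
    genTarget W q = genTarget W' q := by
  simp only [genTarget, partialY, h.fderiv_eq, h.eq_of_nhds]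

/-- The chain rule computation behind the contact property of a composition `Ω ∘ Θ⁻¹`. -/
theorem stdForm_comp_of_factor {W U : V3 → ℝ} {N : Set V3} (hW : IsAxisGenerating W N)
    (hU : IsAxisGenerating U N) {Θ Θ' Ω : V3 → V3} (hΘ : Differentiable ℝ Θ)
    (hΘ' : Differentiable ℝ Θ') (hΩ : Differentiable ℝ Ω) (hinv : ∀ q, Θ (Θ' q) = q)
    (hΘN : ∀ q ∈ N, Θ q ∈ N ∧ genSource W (Θ q) = genSource U q)
    (hΩN : ∀ q ∈ N, Ω q ∈ N ∧ genTarget W (Ω q) = genTarget U q) {q : V3} (hq : q ∈ N)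
    (hq' : Θ' q ∈ N) :
    ∃ c > 0, ∀ v, stdForm (genTarget W (Ω (Θ' q)))
        (fderiv ℝ (genTarget W) (Ω (Θ' q)) (fderiv ℝ (fun p => Ω (Θ' p)) q v)) =
      c * stdForm (genTarget W q) (fderiv ℝ (genTarget W) q v) := by
  have hWz : ∀ q ∈ N, partialZ W q ≠ 0 := fun q hq => (hW.pos q hq).ne'
  have hUz : ∀ q ∈ N, partialZ U q ≠ 0 := fun q hq => (hU.pos q hq).ne'
  have dT : ∀ q ∈ N, DifferentiableAt ℝ (genTarget W) q := fun q hq =>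
    ((contDiffOn_genTarget hW.isOpen hW.smooth).contDiffAt
      (hW.isOpen.mem_nhds hq)).differentiableAt (by simp)
  have dS : ∀ q ∈ N, DifferentiableAt ℝ (genSource W) q := fun q hq =>
    ((contDiffOn_genSource hW.isOpen hW.smooth hWz).contDiffAt
      (hW.isOpen.mem_nhds hq)).differentiableAt (by simp)
  -- The form pulled back by the target map of `U` is U_z times the one pulled back by its source
  -- map. The latter is transported by `Θ` to the source form of `W`, which is the target form of
  -- `W` divided by W_z.
  refine ⟨partialZ U (Θ' q) / partialZ W q, div_pos (hU.pos _ hq') (hW.pos _ hq), fun v => ?_⟩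
  set w := fderiv ℝ Θ' q v with hw
  have h1 : fderiv ℝ (fun p => Ω (Θ' p)) q v = fderiv ℝ Ω (Θ' q) w := by
    have := (hΩ (Θ' q)).hasFDerivAt.comp q (hΘ' q).hasFDerivAt
    rw [show (fun p => Ω (Θ' p)) = Ω ∘ Θ' from rfl, this.fderiv]
    rfl
  have h2 : fderiv ℝ Θ (Θ' q) w = v := by
    have := (hΘ (Θ' q)).hasFDerivAt.comp q (hΘ' q).hasFDerivAt
    have h3 : Θ ∘ Θ' = id := funext hinv
    rw [h3] at this
    exact (DFunLike.congr_fun (this.unique (hasFDerivAt_id q)) v :)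
  have h4 : fderiv ℝ (genTarget W) (Ω (Θ' q)) (fderiv ℝ Ω (Θ' q) w) =
      fderiv ℝ (genTarget U) (Θ' q) w := by
    have h5 := ((dT _ (hΩN _ hq').1).hasFDerivAt.comp (Θ' q) (hΩ (Θ' q)).hasFDerivAt)
    have h6 : genTarget U =ᶠ[𝓝 (Θ' q)] genTarget W ∘ Ω := by
      filter_upwards [hW.isOpen.mem_nhds hq'] with p hp using (hΩN p hp).2.symm
    rw [h6.fderiv_eq, h5.fderiv]
    rfl
  have h7 : fderiv ℝ (genSource W) q v = fderiv ℝ (genSource U) (Θ' q) w := by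
    have h5 := ((dS _ (hΘN _ hq').1).hasFDerivAt.comp (Θ' q) (hΘ (Θ' q)).hasFDerivAt)
    have h6 : genSource U =ᶠ[𝓝 (Θ' q)] genSource W ∘ Θ := by
      filter_upwards [hW.isOpen.mem_nhds hq'] with p hp using (hΘN p hp).2.symm
    rw [h6.fderiv_eq, h5.fderiv]
    change _ = fderiv ℝ (genSource W) (Θ (Θ' q)) (fderiv ℝ Θ (Θ' q) w)
    rw [h2, hinv]
  have h8 : genSource U (Θ' q) = genSource W q := by rw [← (hΘN _ hq').2, hinv]
  rw [h1, h4, (hΩN _ hq').2, stdForm_genTarget hU.isOpen hU.smooth hUz hq' w, h8, ← h7,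
    stdForm_genTarget hW.isOpen hW.smooth hWz hq v, ← mul_assoc,
    div_mul_cancel₀ _ (hWz q hq)]

theorem exists_bump {J N : Set V3} (hJ : IsCompact J) (hN : IsOpen N) (hJN : J ⊆ N) :
    ∃ (C : Set V3) (χ : V3 → ℝ), IsCompact C ∧ C ⊆ N ∧ ContDiff ℝ ∞ χ ∧
      (∀ᶠ q in 𝓝ˢ J, χ q = 1) ∧ ∀ q ∉ C, χ q = 0 := by
  obtain ⟨C, hC, hJC, hCN⟩ := exists_compact_between hJ hN hJN
  obtain ⟨f, hf1, hf0, -⟩ := exists_contMDiffMap_one_nhds_of_subset_interior (n := ⊤)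
    𝓘(ℝ, V3) hJ.isClosed hJC
  exact ⟨C, f, hC, hCN, f.contMDiff.contDiff, hf1, hf0⟩

theorem eventually_eq_zero_of_notMem {C : Set V3} (hC : IsCompact C) {Q : V3 → ℝ}
    (hQ : ∀ q ∉ C, Q q = 0) {q : V3} (hq : q ∉ C) : Q =ᶠ[𝓝 q] fun _ => 0 := by
  filter_upwards [hC.isClosed.isOpen_compl.mem_nhds hq] with p hp using hQ p hp

/-- With a bump function χ equal to 1 near `J`, the maps generated by `W + s χ Q` differ from those
of `W` only on a compact set. They factor as source ∘ Θ_s and target ∘ Ω_s. The step is F_s = Ω_s ∘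
Θ_s⁻¹, with θ = Θ_s in the germ identity, since χ Q = Q near `J`. -/
theorem IsAxisGenerating.nonempty_generatingStep {W Q : V3 → ℝ} {N J : Set V3}
    (h : IsAxisGenerating W N) (hJ : IsCompact J) (hJN : J ⊆ N) (hJ0 : ∀ q ∈ J, q.2 = 0)
    (hQ : ContDiffOn ℝ ∞ Q N) (hQ0 : ∀ x, (x, 0, 0) ∈ N → Q (x, 0, 0) = 0)
    (hQX : ∀ x, (x, 0, 0) ∈ N → partialX Q (x, 0, 0) = 0)
    (hQY : ∀ x, (x, 0, 0) ∈ N → partialY Q (x, 0, 0) = 0) :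
    Nonempty (GeneratingStep W Q J N) := by
  obtain ⟨N', hN'N, hN'o, hJN', ⟨eS, heSs, heS, heSsymm⟩,
    ⟨eT, heTs, heT, heTsymm⟩, haxis⟩ :=
    h.exists_embedding hJ hJN hJ0
  have h' : IsAxisGenerating W N' := h.mono hN'o hN'N
  obtain ⟨C, χ, hC, hCN', hχ, hχ1, hχ0⟩ := exists_bump hJ hN'o hJN'
  set R : V3 → ℝ := fun q => χ q * Q q with hR
  have hRs : ContDiffOn ℝ ∞ R N' := hχ.contDiffOn.mul (hQ.mono hN'N)
  have hRC : ∀ q ∉ C, R q = 0 := fun q hq => by simp [hR, hχ0 q hq]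
  -- As Q vanishes on the axis, the derivative of χ contributes nothing there, and the cut-off
  -- preserves the axis conditions.
  have hRfd : ∀ x, (x, 0, 0) ∈ N' → ∀ v, fderiv ℝ Q (x, 0, 0) v = 0 →
      fderiv ℝ R (x, 0, 0) v = 0 := by
    intro x hx v hv
    have hQd : DifferentiableAt ℝ Q (x, 0, 0) :=
      (hQ.contDiffAt (h.isOpen.mem_nhds (hN'N hx))).differentiableAt (by simp)
    have h1 : HasFDerivAt R _ (x, 0, 0) :=
      (hχ.differentiable (by simp) _).hasFDerivAt.mul hQd.hasFDerivAt
    rw [h1.fderiv, add_apply, smul_apply, smul_apply, hv, hQ0 x (hN'N hx)]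
    simp
  have hR0 : ∀ x, (x, 0, 0) ∈ N' → R (x, 0, 0) = 0 := fun x hx => by
    simp [hR, hQ0 x (hN'N hx)]
  have hRX : ∀ x, (x, 0, 0) ∈ N' → partialX R (x, 0, 0) = 0 := fun x hx =>
    hRfd x hx _ (hQX x (hN'N hx))
  have hRY : ∀ x, (x, 0, 0) ∈ N' → partialY R (x, 0, 0) = 0 := fun x hx =>
    hRfd x hx _ (hQY x (hN'N hx))
  have hRZ : ∀ q ∉ C, partialZ R q = 0 := by
    intro q hq
    rw [partialZ, (eventually_eq_zero_of_notMem hC hRC hq).fderiv_eq]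
    simp
  have hO : IsOpen ((Set.univ ×ˢ N') ∩
      (fun p : ℝ × V3 => partialZ W p.2 + p.1 * partialZ R p.2) ⁻¹' Set.Ioi 0) := by
    refine ContinuousOn.isOpen_inter_preimage ?_ (isOpen_univ.prod hN'o) isOpen_Ioi
    have hm : Set.MapsTo (fun p : ℝ × V3 => p.2) (Set.univ ×ˢ N') N' := fun p hp => hp.2
    exact ((contDiffOn_partialZ hN'o h'.smooth).continuousOn.comp continuousOn_snd hm).add
      (continuousOn_fst.mul
        ((contDiffOn_partialZ hN'o hRs).continuousOn.comp continuousOn_snd hm))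
  obtain ⟨r₀, hr₀, hr₀C⟩ := exists_pos_forall_Ioo_of_isOpen hC hO
    (fun q hq => ⟨⟨trivial, hCN' hq⟩, by simpa using h'.pos q (hCN' hq)⟩)
  have hpos : ∀ s ∈ Set.Ioo (-r₀) r₀, ∀ q ∈ N', 0 < partialZ W q + s * partialZ R q := by
    intro s hs q hq
    by_cases hqC : q ∈ C
    · exact (hr₀C s hs q hqC).2
    · rw [hRZ q hqC, mul_zero, add_zero]
      exact h'.pos q hq
  obtain ⟨hSfam, hTfam⟩ := contDiffOn_genSource_family hN'o h'.smooth hRs hpos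
  have hzero : (fun q => W q + 0 * R q) = W := by
    funext q; ring
  have hoff : ∀ s : ℝ, ∀ q ∉ C, (fun p => W p + s * R p) =ᶠ[𝓝 q] W := by
    intro s q hq
    filter_upwards [eventually_eq_zero_of_notMem hC hRC hq] with p hp
    rw [hp, mul_zero, add_zero]
  obtain ⟨r₁, hr₁, hr₁₀, Θ, Θ', hΘs, hΘ's, hΘ0, hΘ⟩ := exists_compactlySupported_factor hN'o hC
    hCN' hr₀ (fun s q => genSource (fun p => W p + s * R p) q) hSfam
    (fun s _ q _ hqC => by
      rw [genSource_congr (hoff s q hqC), genSource_congr (hoff 0 q hqC)])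
    eS heSs (fun q _ => by rw [hzero, heS]) heSsymm
  obtain ⟨r₂, hr₂, hr₂₀, Ω, Ω', hΩs, hΩ's, hΩ0, hΩ⟩ := exists_compactlySupported_factor hN'o hC
    hCN' hr₀ (fun s q => genTarget (fun p => W p + s * R p) q) hTfam
    (fun s _ q _ hqC => by
      rw [genTarget_congr (hoff s q hqC), genTarget_congr (hoff 0 q hqC)])
    eT heTs (fun q _ => by rw [hzero, heT]) heTsymm
  simp only [hzero] at hΘ hΩ
  set r := min r₁ r₂ with hr
  have hI₁ : Set.Ioo (-r) r ⊆ Set.Ioo (-r₁) r₁ :=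
    Set.Ioo_subset_Ioo (neg_le_neg (min_le_left _ _)) (min_le_left _ _)
  have hI₂ : Set.Ioo (-r) r ⊆ Set.Ioo (-r₂) r₂ :=
    Set.Ioo_subset_Ioo (neg_le_neg (min_le_right _ _)) (min_le_right _ _)
  have hI₀ : Set.Ioo (-r) r ⊆ Set.Ioo (-r₀) r₀ :=
    hI₁.trans (Set.Ioo_subset_Ioo (neg_le_neg hr₁₀) hr₁₀)
  have hcomp : ∀ A B : ℝ → V3 → V3,
      ContDiffOn ℝ ∞ (fun q : ℝ × V3 => A q.1 q.2) (Set.Ioo (-r) r ×ˢ Set.univ) →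
      ContDiffOn ℝ ∞ (fun q : ℝ × V3 => B q.1 q.2) (Set.Ioo (-r) r ×ˢ Set.univ) →
      ContDiffOn ℝ ∞ (fun q : ℝ × V3 => A q.1 (B q.1 q.2)) (Set.Ioo (-r) r ×ˢ Set.univ) :=
    fun A B hA hB => hA.comp (contDiffOn_fst.prodMk hB) (fun q hq => ⟨hq.1, trivial⟩)
  have hslice : ∀ A : ℝ → V3 → V3,
      ContDiffOn ℝ ∞ (fun q : ℝ × V3 => A q.1 q.2) (Set.Ioo (-r) r ×ˢ Set.univ) →
      ∀ s ∈ Set.Ioo (-r) r, ContDiff ℝ ∞ (A s) := fun A hA s hs => by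
    rw [← contDiffOn_univ]
    exact hA.comp (f := fun q : V3 => (s, q)) (by fun_prop) (fun q _ => ⟨hs, trivial⟩)
  have hΘs₁ := hΘs.mono (Set.prod_mono_left (t := Set.univ) hI₁)
  have hΘ's₁ := hΘ's.mono (Set.prod_mono_left (t := Set.univ) hI₁)
  have hΩs₁ := hΩs.mono (Set.prod_mono_left (t := Set.univ) hI₂)
  have hΩ's₁ := hΩ's.mono (Set.prod_mono_left (t := Set.univ) hI₂)
  have hΘ'C : ∀ s ∈ Set.Ioo (-r) r, ∀ q, Θ s q = q → Θ' s q = q := by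
    intro s hs q hq
    conv_lhs => rw [← hq]
    exact (hΘ s (hI₁ hs)).1 q
  have hΘ'N : ∀ s ∈ Set.Ioo (-r) r, ∀ q ∈ N', Θ' s q ∈ N' := by
    intro s hs q hq
    by_contra hcon
    have h1 := (hΘ s (hI₁ hs)).2.2.1 (Θ' s q) (fun hC' => hcon (hCN' hC'))
    rw [(hΘ s (hI₁ hs)).2.1 q] at h1
    exact hcon (h1 ▸ hq)
  have hU : ∀ s ∈ Set.Ioo (-r) r, IsAxisGenerating (fun q => W q + s * R q) N' := fun s hs =>
    h'.add_mul hRs hR0 hRX hRY (hpos s (hI₀ hs))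
  have hSinj : Set.InjOn (genSource W) N' := by
    have := eS.injOn
    rwa [heSs, show (eS : V3 → V3) = genSource W from funext heS] at this
  have hTinj : Set.InjOn (genTarget W) N' := by
    have := eT.injOn
    rwa [heTs, show (eT : V3 → V3) = genTarget W from funext heT] at this
  -- By injectivity of the source map of `W`, a point where the perturbed source map has the old
  -- value is fixed by `Θ s`; likewise below for `Ω s`. This gives both the fixing of the axis and
  -- the identity wherever Q vanishes locally.
  have hΘfix : ∀ s ∈ Set.Ioo (-r) r, ∀ q ∈ N',
      genSource (fun p => W p + s * R p) q = genSource W q → Θ s q = q := fun s hs q hq hqq =>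
    hSinj ((hΘ s (hI₁ hs)).2.2.2 q hq).1 hq (((hΘ s (hI₁ hs)).2.2.2 q hq).2.trans hqq)
  have hΩfix : ∀ s ∈ Set.Ioo (-r) r, ∀ q ∈ N',
      genTarget (fun p => W p + s * R p) q = genTarget W q → Ω s q = q := fun s hs q hq hqq =>
    hTinj ((hΩ s (hI₂ hs)).2.2.2 q hq).1 hq (((hΩ s (hI₂ hs)).2.2.2 q hq).2.trans hqq)
  have hΘaxis : ∀ s ∈ Set.Ioo (-r) r, ∀ x, Θ s (x, 0, 0) = (x, 0, 0) := by
    intro s hs x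
    by_cases hx : (x, 0, 0) ∈ N'
    · exact hΘfix s hs _ hx (by rw [(hU s hs).genSource_axis hx, h'.genSource_axis hx])
    · exact (hΘ s (hI₁ hs)).2.2.1 _ fun hC' => hx (hCN' hC')
  have hΩaxis : ∀ s ∈ Set.Ioo (-r) r, ∀ x, Ω s (x, 0, 0) = (x, 0, 0) := by
    intro s hs x
    by_cases hx : (x, 0, 0) ∈ N'
    · exact hΩfix s hs _ hx (by rw [(hU s hs).genTarget_axis hx, h'.genTarget_axis hx])
    · exact (hΩ s (hI₂ hs)).2.2.1 _ fun hC' => hx (hCN' hC')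
  have hFid : ∀ s ∈ Set.Ioo (-r) r, ∀ q, Θ s q = q → Ω s q = q → Ω s (Θ' s q) = q := by
    intro s hs q h1 h2
    rw [hΘ'C s hs q h1, h2]
  refine ⟨{
    chart := eT
    chart_source_subset := heTs ▸ hN'N
    chart_apply := heT
    chart_axis := heTs ▸ haxis
    contDiffOn_chart_symm := heTsymm
    supp := C
    isCompact_supp := hC
    supp_subset := heTs ▸ hCN'
    r := r
    r_pos := lt_min hr₁ hr₂
    F := fun s q => Ω s (Θ' s q)
    F' := fun s q => Θ s (Ω' s q)
    contDiffOn_F := hcomp Ω Θ' hΩs₁ hΘ's₁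
    contDiffOn_F' := hcomp Θ Ω' hΘs₁ hΩ's₁
    F_zero := fun q => hFid 0 ⟨neg_lt_zero.2 (lt_min hr₁ hr₂), lt_min hr₁ hr₂⟩ q (hΘ0 q) (hΩ0 q)
    left_inv := fun s hs q => by
      rw [(hΩ s (hI₂ hs)).1, (hΘ s (hI₁ hs)).2.1]
    right_inv := fun s hs q => by
      rw [(hΘ s (hI₁ hs)).1, (hΩ s (hI₂ hs)).2.1]
    F_off := fun s hs q hq => hFid s hs q ((hΘ s (hI₁ hs)).2.2.1 q hq)
      ((hΩ s (hI₂ hs)).2.2.1 q hq)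
    contact := fun s hs q hq => by
      rw [heTs] at hq
      exact stdForm_comp_of_factor h' (hU s hs)
        ((hslice Θ hΘs₁ s hs).differentiable (by simp))
        ((hslice Θ' hΘ's₁ s hs).differentiable (by simp))
        ((hslice Ω hΩs₁ s hs).differentiable (by simp)) (hΘ s (hI₁ hs)).2.1
        (hΘ s (hI₁ hs)).2.2.2 (hΩ s (hI₂ hs)).2.2.2 hq (hΘ'N s hs q hq)
    F_axis := fun s hs x => hFid s hs _ (hΘaxis s hs x) (hΩaxis s hs x)
    F_id := ?_
    germ := ?_ }⟩
  · intro s hs p hp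
    by_cases hpN : p ∈ N'
    · filter_upwards [hp.eventually_nhds, hN'o.mem_nhds hpN] with q hq hqN
      have hUW : (fun p => W p + s * R p) =ᶠ[𝓝 q] W := by
        filter_upwards [hq] with y hy
        simp [hR, hy]
      exact hFid s hs q (hΘfix s hs q hqN (genSource_congr hUW))
        (hΩfix s hs q hqN (genTarget_congr hUW))
    · filter_upwards [hC.isClosed.isOpen_compl.mem_nhds fun hpC => hpN (hCN' hpC)] with q hq
      exact hFid s hs q ((hΘ s (hI₁ hs)).2.2.1 q hq) ((hΩ s (hI₂ hs)).2.2.1 q hq)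
  · intro s hs
    let θ : V3 ≃ₜ V3 :=
      { toFun := Θ s
        invFun := Θ' s
        left_inv := (hΘ s (hI₁ hs)).1
        right_inv := (hΘ s (hI₁ hs)).2.1
        continuous_toFun := (hslice Θ hΘs₁ s hs).continuous
        continuous_invFun := (hslice Θ' hΘ's₁ s hs).continuous }
    refine ⟨θ, fun q hq => ?_, ?_⟩
    · rw [show q = (q.1, 0, 0) from Prod.ext rfl (hJ0 q hq)]
      exact hΘaxis s hs q.1
    · obtain ⟨B, hBo, hJB, hB1⟩ := mem_nhdsSet_iff_exists.1 hχ1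
      filter_upwards [hBo.mem_nhdsSet.2 hJB, hN'o.mem_nhdsSet.2 hJN'] with q hqB hqN
      have hUW : (fun p => W p + s * Q p) =ᶠ[𝓝 q] fun p => W p + s * R p := by
        filter_upwards [hBo.mem_nhds hqB] with y hy
        have : χ y = 1 := hB1 hy
        simp [hR, this]
      have h1 := (hΘ s (hI₁ hs)).2.2.2 q hqN
      have h2 := (hΩ s (hI₂ hs)).2.2.2 q hqN
      have h3 : Ω s (Θ' s (θ q)) = Ω s q := congrArg (Ω s) ((hΘ s (hI₁ hs)).1 q)
      rw [heTs]
      refine ⟨h1.1, ?_, ?_, ?_⟩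
      · rw [h3]; exact h2.1
      · rw [genSource_congr hUW]; exact h1.2.symm
      · rw [genTarget_congr hUW, h3]; exact h2.2.symm

end GeneratingStep

/-! ### Existence of generating functions. -/

section ExistenceOfGeneratingFunction

/-- A local contact transformation of `ℝ³` that fixes the `x`-axis. -/
structure IsAxisContact (G : V3 → V3) (D : Set V3) : Prop where
  isOpen : IsOpen D
  smooth : ContDiffOn ℝ ∞ G D
  axis : ∀ x, (x, 0, 0) ∈ D → G (x, 0, 0) = (x, 0, 0)
  contact : ∀ q ∈ D, ∃ c > 0, ∀ v, stdForm (G q) (fderiv ℝ G q v) = c * stdForm q v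

namespace IsAxisContact

variable {G : V3 → V3} {D : Set V3}

theorem contDiffOn_components (h : IsAxisContact G D) :
    ContDiffOn ℝ ∞ (fun q => (G q).1) D ∧ ContDiffOn ℝ ∞ (fun q => (G q).2.1) D ∧
      ContDiffOn ℝ ∞ (fun q => (G q).2.2) D :=
  ⟨contDiff_fst.comp_contDiffOn h.smooth, contDiff_snd.fst.comp_contDiffOn h.smooth,
    contDiff_snd.snd.comp_contDiffOn h.smooth⟩

theorem fderiv_components (h : IsAxisContact G D) {q : V3} (hq : q ∈ D) (v : V3) :
    fderiv ℝ G q v = (fderiv ℝ (fun q => (G q).1) q v, fderiv ℝ (fun q => (G q).2.1) q v,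
      fderiv ℝ (fun q => (G q).2.2) q v) := by
  have hn := h.isOpen.mem_nhds hq
  obtain ⟨h1, h2, h3⟩ := h.contDiffOn_components
  have h4 : HasFDerivAt G _ q :=
    ((h1.contDiffAt hn).differentiableAt (by simp)).hasFDerivAt.prodMk
      (((h2.contDiffAt hn).differentiableAt (by simp)).hasFDerivAt.prodMk
        ((h3.contDiffAt hn).differentiableAt (by simp)).hasFDerivAt)
  rw [h4.fderiv]
  rfl

/-- The conformal factor of a contact transformation. -/
def factor (G : V3 → V3) (q : V3) : ℝ :=
  partialZ (fun q => (G q).2.2) q - (G q).2.1 * partialZ (fun q => (G q).1) q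

theorem factor_pos (h : IsAxisContact G D) {q : V3} (hq : q ∈ D) : 0 < factor G q := by
  obtain ⟨c, hc, hcv⟩ := h.contact q hq
  have := hcv (0, 0, 1)
  rw [h.fderiv_components hq] at this
  simp only [stdForm, mul_zero, sub_zero, mul_one] at this
  rw [factor, partialZ, partialZ, this]
  exact hc

theorem stdForm_eq (h : IsAxisContact G D) {q : V3} (hq : q ∈ D) (v : V3) :
    fderiv ℝ (fun q => (G q).2.2) q v - (G q).2.1 * fderiv ℝ (fun q => (G q).1) q v =
      factor G q * (v.2.2 - q.2.1 * v.1) := by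
  obtain ⟨c, hc, hcv⟩ := h.contact q hq
  have h1 := hcv (0, 0, 1)
  have h2 := hcv v
  rw [h.fderiv_components hq] at h1 h2
  simp only [stdForm, mul_zero, sub_zero, mul_one] at h1 h2
  rw [h2, factor, partialZ, partialZ, h1]

theorem contDiffOn_factor (h : IsAxisContact G D) : ContDiffOn ℝ ∞ (factor G) D := by
  obtain ⟨h1, h2, h3⟩ := h.contDiffOn_components
  exact (contDiffOn_partialZ h.isOpen h3).sub (h2.mul (contDiffOn_partialZ h.isOpen h1))

theorem fderiv_axis (h : IsAxisContact G D) {x : ℝ} (hx : (x, 0, 0) ∈ D) :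
    fderiv ℝ G (x, 0, 0) (1, 0, 0) = (1, 0, 0) := by
  have hline : HasDerivAt (fun t : ℝ => ((t, 0, 0) : V3)) (1, 0, 0) x :=
    (hasDerivAt_id x).prodMk (hasDerivAt_const x (0 : ℝ × ℝ))
  have hd : HasFDerivAt G (fderiv ℝ G (x, 0, 0)) (x, 0, 0) :=
    ((h.smooth.contDiffAt (h.isOpen.mem_nhds hx)).differentiableAt (by simp)).hasFDerivAt
  have h1 := HasFDerivAt.comp_hasDerivAt (l := G) x hd hline
  refine h1.unique (hline.congr_of_eventuallyEq ?_)
  filter_upwards [hline.continuousAt.eventually_mem (h.isOpen.mem_nhds hx)] with t ht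
    using h.axis t ht

/-- Along the axis, the second component grows in the second direction at the rate of the
conformal factor. -/
theorem partialY_axis (h : IsAxisContact G D) {x : ℝ} (hx : (x, 0, 0) ∈ D) :
    partialY (fun q => (G q).2.1) (x, 0, 0) = factor G (x, 0, 0) := by
  have hn := h.isOpen.mem_nhds hx
  obtain ⟨h1, h2, h3⟩ := h.contDiffOn_components
  have hd : ∀ {u : V3 → ℝ}, ContDiffOn ℝ ∞ u D →
      HasFDerivAt u (fderiv ℝ u (x, 0, 0)) (x, 0, 0) := fun hu =>
    ((hu.contDiffAt hn).differentiableAt (by simp)).hasFDerivAt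
  have hy : HasFDerivAt (fun q : V3 => q.2.1)
      ((ContinuousLinearMap.fst ℝ ℝ ℝ).comp (ContinuousLinearMap.snd ℝ ℝ (ℝ × ℝ))) (x, 0, 0) :=
    ((ContinuousLinearMap.fst ℝ ℝ ℝ).comp (ContinuousLinearMap.snd ℝ ℝ (ℝ × ℝ))).hasFDerivAt
  have hE : ∀ v : V3, HasFDerivAt (fun q => fderiv ℝ (fun q => (G q).2.2) q v -
      (G q).2.1 * fderiv ℝ (fun q => (G q).1) q v) _ (x, 0, 0) := fun v =>
    (hd (contDiffOn_fderiv_apply h.isOpen h3 v)).sub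
      ((hd h2).mul (hd (contDiffOn_fderiv_apply h.isOpen h1 v)))
  have hR : ∀ v : V3, HasFDerivAt (fun q : V3 => factor G q * (v.2.2 - q.2.1 * v.1)) _
      (x, 0, 0) := fun v =>
    (hd h.contDiffOn_factor).mul ((hasFDerivAt_const v.2.2 _).sub (hy.mul_const v.1))
  have hER : ∀ v, (fun q => fderiv ℝ (fun q => (G q).2.2) q v -
      (G q).2.1 * fderiv ℝ (fun q => (G q).1) q v) =ᶠ[𝓝 (x, 0, 0)]
      fun q : V3 => factor G q * (v.2.2 - q.2.1 * v.1) := fun v => by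
    filter_upwards [hn] with q hq using h.stdForm_eq hq v
  have hEq : ∀ v w, _ := fun v w =>
    DFunLike.congr_fun ((hE v).unique ((hR v).congr_of_eventuallyEq (hER v))) w
  -- Compare the dx ∧ dy coefficients of the exterior derivatives of dZ - Y dX = f (dz - y dx). On
  -- the axis X_x = 1 and Y = Y_x = 0, so the two equations read Z_xy - Y_y = -f and Z_yx = 0.
  have e1 := hEq (1, 0, 0) (0, 1, 0)
  have e2 := hEq (0, 1, 0) (1, 0, 0)
  have hax := h.fderiv_axis hx
  rw [h.fderiv_components hx, Prod.mk.injEq, Prod.mk.injEq] at hax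
  obtain ⟨a1, a2, -⟩ := hax
  simp only [sub_apply, smul_apply, neg_apply, smul_eq_mul, h.axis x hx, zero_add, mul_one,
    zero_sub, sub_zero, mul_zero, add_zero, a1, a2, one_smul, zero_smul] at e1 e2
  have hy1 : ((ContinuousLinearMap.fst ℝ ℝ ℝ).comp (ContinuousLinearMap.snd ℝ ℝ (ℝ × ℝ)))
    (0, 1, 0) = 1 := rfl
  have hy2 : (0 : V3 →L[ℝ] ℝ) (1, 0, 0) = 0 := rfl
  rw [hy1] at e1
  rw [hy2, mul_zero] at e2
  rw [fderiv_partial_comm h.isOpen h3 hx (1, 0, 0) (0, 1, 0)] at e1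
  rw [partialY]
  linarith

/-- A contact transformation fixing the axis has a generating function near compact subsets of
the axis. -/
theorem exists_generating (h : IsAxisContact G D) {J : Set V3} (hJ : IsCompact J) (hJD : J ⊆ D)
    (hJ0 : ∀ q ∈ J, q.2 = 0) :
    ∃ (W : V3 → ℝ) (N : Set V3), IsAxisGenerating W N ∧ J ⊆ N ∧
      (∀ q ∈ N, genSource W q ∈ D ∧ G (genSource W q) = genTarget W q) ∧
      ∀ p ∈ N, (∀ᶠ q in 𝓝 p, G q = q) → ∀ᶠ q in 𝓝 p, W q = q.2.2 - q.1 * q.2.1 := by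
  obtain ⟨h1, h2, h3⟩ := h.contDiffOn_components
  have hd : ∀ {u : V3 → ℝ}, ContDiffOn ℝ ∞ u D → ∀ q ∈ D,
      HasFDerivAt u (fderiv ℝ u q) q := fun hu q hq =>
    ((hu.contDiffAt (h.isOpen.mem_nhds hq)).differentiableAt (by simp)).hasFDerivAt
  -- `S` passes from (x, y, z) to (x, Y, z). On the axis it is the identity, and its differential is
  -- invertible because ∂Y/∂y is the positive conformal factor.
  let S : V3 → V3 := fun q => (q.1, (G q).2.1, q.2.2)
  have hSs : ContDiffOn ℝ ∞ S D := contDiffOn_fst.prodMk (h2.prodMk (by fun_prop))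
  have hSd : ∀ q ∈ D, ∀ v, fderiv ℝ S q v =
      (v.1, fderiv ℝ (fun q => (G q).2.1) q v, v.2.2) := by
    intro q hq v
    have hzz : HasFDerivAt (fun q : V3 => q.2.2)
        ((ContinuousLinearMap.snd ℝ ℝ ℝ).comp (ContinuousLinearMap.snd ℝ ℝ (ℝ × ℝ))) q :=
      ((ContinuousLinearMap.snd ℝ ℝ ℝ).comp (ContinuousLinearMap.snd ℝ ℝ (ℝ × ℝ))).hasFDerivAt
    have h4 : HasFDerivAt S _ q :=
      (hasFDerivAt_fst (𝕜 := ℝ) (E := ℝ) (F := ℝ × ℝ)).prodMk ((hd h2 q hq).prodMk hzz)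
    rw [h4.fderiv]
    rfl
  have hSax : ∀ x, (x, 0, 0) ∈ D → S (x, 0, 0) = (x, 0, 0) := fun x hx => by
    simp [S, h.axis x hx]
  have hax : ∀ q ∈ J, q = (q.1, 0, 0) := fun q hq => Prod.ext rfl (hJ0 q hq)
  have hSJ : ∀ q ∈ J, S q = q := fun q hq => by
    have := hax q hq
    rw [this]; exact hSax _ (this ▸ hJD hq)
  obtain ⟨N₀, hN₀D, hN₀o, hJN₀, hinj, hA⟩ := exists_isOpen_injOn_of_isCompact h.isOpen hSs hJ hJD
    (fun p hp q hq hpq => by rwa [hSJ p hp, hSJ q hq] at hpq) (by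
      intro q hq v hv
      have hqD := hJD hq
      rw [hSd q hqD, Prod.mk_eq_zero, Prod.mk_eq_zero] at hv
      obtain ⟨hv1, hv2, hv3⟩ := hv
      rw [hax q hq] at hqD hv2
      rw [fderiv_apply_eq_partial, h.partialY_axis hqD, hv1, hv3] at hv2
      have h5 : v.2.1 = 0 := by
        simpa [(h.factor_pos hqD).ne'] using hv2
      exact Prod.ext hv1 (Prod.ext h5 hv3))
  obtain ⟨e, hes, heS, hesymm⟩ := exists_openPartialHomeomorph_of_injOn hN₀o (hSs.mono hN₀D) hinj hA
  -- The generating function Z - XY, still in the variables (x, y, z). Its differential f (dz - y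
  -- dx) - X dY, read in (x, Y, z), gives all three partial derivatives of `W`.
  let k : V3 → ℝ := fun q => (G q).2.2 - (G q).1 * (G q).2.1
  let W : V3 → ℝ := fun q => k (e.symm q)
  have hks : ContDiffOn ℝ ∞ k D := h3.sub (h1.mul h2)
  have hsymmN₀ : ∀ q ∈ e.target, e.symm q ∈ N₀ := fun q hq => hes ▸ e.map_target hq
  have hSe : ∀ q ∈ e.target, S (e.symm q) = q := fun q hq => by rw [← heS, e.right_inv hq]
  have hWs : ContDiffOn ℝ ∞ W e.target :=
    hks.comp hesymm (fun q hq => hN₀D (hsymmN₀ q hq))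
  have hfd : ∀ q ∈ e.target, ∀ u : V3, fderiv ℝ W q u =
      factor G (e.symm q) * (u.2.2 - (e.symm q).2.1 * u.1) - (G (e.symm q)).1 * u.2.1 := by
    intro q hq u
    have hpD : e.symm q ∈ D := hN₀D (hsymmN₀ q hq)
    have hed : HasFDerivAt e.symm (fderiv ℝ e.symm q) q :=
      ((hesymm.contDiffAt (e.open_target.mem_nhds hq)).differentiableAt (by simp)).hasFDerivAt
    have hSdiff : HasFDerivAt S (fderiv ℝ S (e.symm q)) (e.symm q) :=
      ((hSs.contDiffAt (h.isOpen.mem_nhds hpD)).differentiableAt (by simp)).hasFDerivAt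
    have hSu : fderiv ℝ S (e.symm q) (fderiv ℝ e.symm q u) = u := by
      have h4 := hSdiff.comp q hed
      have h5 : S ∘ e.symm =ᶠ[𝓝 q] id := by
        filter_upwards [e.open_target.mem_nhds hq] with y hy using hSe y hy
      exact (DFunLike.congr_fun (h4.unique ((hasFDerivAt_id q).congr_of_eventuallyEq h5)) u :)
    set v := fderiv ℝ e.symm q u with hv
    rw [hSd _ hpD] at hSu
    have hkd : HasFDerivAt k _ (e.symm q) :=
      (hd h3 _ hpD).sub ((hd h1 _ hpD).mul (hd h2 _ hpD))
    have hWd : HasFDerivAt W _ q := hkd.comp q hed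
    have hst := h.stdForm_eq hpD v
    rw [hWd.fderiv]
    simp only [ContinuousLinearMap.comp_apply, sub_apply, add_apply, smul_apply, smul_eq_mul]
    rw [← hv, ← hSu]
    dsimp only
    linarith
  have hX : ∀ q ∈ e.target, partialX W q = -(factor G (e.symm q) * (e.symm q).2.1) := by
    intro q hq
    rw [partialX, hfd q hq]; simp
  have hY : ∀ q ∈ e.target, partialY W q = -(G (e.symm q)).1 := by
    intro q hq
    rw [partialY, hfd q hq]; simp
  have hZ : ∀ q ∈ e.target, partialZ W q = factor G (e.symm q) := by
    intro q hq
    rw [partialZ, hfd q hq]; simp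
  have hfixed : ∀ q ∈ N₀, S q = q → e.symm q = q := by
    intro q hq hqq
    have h4 := e.left_inv (x := q) (hes ▸ hq)
    rwa [heS, hqq] at h4
  have hmemT : ∀ q ∈ N₀, S q ∈ e.target := fun q hq => by
    rw [← heS]; exact e.map_source (hes ▸ hq)
  have hsymmax : ∀ x, (x, 0, 0) ∈ e.target ∩ N₀ → e.symm (x, 0, 0) = (x, 0, 0) :=
    fun x hx => hfixed _ hx.2 (hSax x (hN₀D hx.2))
  refine ⟨W, e.target ∩ N₀, ⟨e.open_target.inter hN₀o, hWs.mono Set.inter_subset_left, ?_, ?_, ?_,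
    ?_⟩, ?_, ?_, ?_⟩
  · intro q hq
    rw [hZ q hq.1]
    exact h.factor_pos (hN₀D (hsymmN₀ q hq.1))
  · intro x hx
    simp only [W, hsymmax x hx, k, h.axis x (hN₀D hx.2)]
    simp
  · intro x hx
    rw [hX _ hx.1, hsymmax x hx]; simp
  · intro x hx
    rw [hY _ hx.1, hsymmax x hx, h.axis x (hN₀D hx.2)]
  · intro q hq
    have := hmemT q (hJN₀ hq)
    rw [hSJ q hq] at this
    exact ⟨this, hJN₀ hq⟩
  · intro q hq
    have hpD := hN₀D (hsymmN₀ q hq.1)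
    have hf := (h.factor_pos hpD).ne'
    have hS' := hSe q hq.1
    have h4 : genSource W q = e.symm q := by
      rw [genSource, hX q hq.1, hZ q hq.1]
      refine Prod.ext (congrArg Prod.fst hS').symm (Prod.ext ?_
        (congrArg (fun v : V3 => v.2.2) hS').symm)
      change -(-(factor G (e.symm q) * (e.symm q).2.1) / factor G (e.symm q)) = _
      field_simp
    rw [h4]
    refine ⟨hpD, ?_⟩
    have h5 : q.2.1 = (G (e.symm q)).2.1 := (congrArg (fun v : V3 => v.2.1) hS').symm
    rw [genTarget, hY q hq.1, h5]
    refine Prod.ext (neg_neg _).symm (Prod.ext rfl ?_)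
    change (G (e.symm q)).2.2 = k (e.symm q) - _
    simp only [k]
    ring
  -- Where G is the identity, so is `S`, and Z - XY becomes z - xY.
  · intro p hp hG
    filter_upwards [hG, hN₀o.mem_nhds hp.2] with q hq hqN
    have h4 : e.symm q = q := hfixed q hqN (by simp only [S, hq])
    change k (e.symm q) = _
    simp only [h4, k, hq]

end IsAxisContact

end ExistenceOfGeneratingFunction

/-! ### Differentials of diffeomorphisms. -/

section Diffeomorphisms

variable {M : Type*} [TopologicalSpace M] [ChartedSpace E3 M]

theorem mdifferentiable_diffeo (g : M ≃ₘ^∞⟮𝓡 3, 𝓡 3⟯ M) (x : M) :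
    MDifferentiableAt (𝓡 3) (𝓡 3) g x := g.contMDiff.mdifferentiable (by simp) x

theorem mfderiv_symm_apply (g : M ≃ₘ^∞⟮𝓡 3, 𝓡 3⟯ M) (x : M) (v : E3) :
    (mfderiv (𝓡 3) (𝓡 3) g.symm (g x) : E3 →L[ℝ] E3)
      ((mfderiv (𝓡 3) (𝓡 3) g x : E3 →L[ℝ] E3) v) = v := by
  have h := mfderiv_comp x (mdifferentiable_diffeo g.symm (g x)) (mdifferentiable_diffeo g x)
  have h2 : (g.symm : M → M) ∘ g = id := by
    funext y; simp
  rw [h2, mfderiv_id] at h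
  exact (DFunLike.congr_fun h v).symm

theorem mfderiv_apply_symm (g : M ≃ₘ^∞⟮𝓡 3, 𝓡 3⟯ M) (x : M) (v : E3) :
    (mfderiv (𝓡 3) (𝓡 3) g x : E3 →L[ℝ] E3)
      ((mfderiv (𝓡 3) (𝓡 3) g.symm (g x) : E3 →L[ℝ] E3) v) = v := by
  have h := mfderiv_symm_apply g.symm (g x) v
  have h2 : g.symm.symm = g := rfl
  have h3 : ∀ y, y = x → (mfderiv (𝓡 3) (𝓡 3) g y : E3 →L[ℝ] E3) = mfderiv (𝓡 3) (𝓡 3) g x := by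
    rintro y rfl; rfl
  rw [h2, h3 _ (g.symm_apply_apply x)] at h
  exact h

end Diffeomorphisms

/-! ### Contactomorphisms and operations on contact isotopies. -/

section Contactomorphisms

variable {M : Type*} [TopologicalSpace M] [ChartedSpace E3 M] [IsManifold (𝓡 3) ∞ M]

namespace CoorientedContactStructure

variable (ξ : CoorientedContactStructure M)

/-- A linear map between tangent spaces respects the contact planes and their coorientations. -/
def PreservesAt (x y : M) (L : E3 →L[ℝ] E3) : Prop :=
  ∀ v : E3, ((L v : TangentSpace (𝓡 3) y) ∈ ξ.plane y ↔ (v : TangentSpace (𝓡 3) x) ∈ ξ.plane x) ∧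
    ((L v : TangentSpace (𝓡 3) y) ∈ ξ.pos y ↔ (v : TangentSpace (𝓡 3) x) ∈ ξ.pos x)

variable {ξ}

theorem PreservesAt.comp {x y z : M} {L L' : E3 →L[ℝ] E3} (hL : ξ.PreservesAt x y L)
    (hL' : ξ.PreservesAt y z L') : ξ.PreservesAt x z (L'.comp L) := fun v =>
  ⟨(hL' (L v)).1.trans (hL v).1, (hL' (L v)).2.trans (hL v).2⟩

theorem PreservesAt.symm {x y : M} {L L' : E3 →L[ℝ] E3} (hL : ξ.PreservesAt x y L)
    (hLL' : ∀ v, L (L' v) = v) : ξ.PreservesAt y x L' := fun v => by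
  have := hL (L' v)
  rw [hLL'] at this
  exact ⟨this.1.symm, this.2.symm⟩

theorem preservesAt_id (x : M) : ξ.PreservesAt x x (ContinuousLinearMap.id ℝ E3) :=
  fun _ => ⟨Iff.rfl, Iff.rfl⟩

/-- Invertibility of the differential turns equality of images into a pointwise equivalence, for
which composition and inversion are formal. -/
theorem isContactomorphism_iff (g : M ≃ₘ^∞⟮𝓡 3, 𝓡 3⟯ M) :
    ξ.IsContactomorphism g ↔ ∀ x, ξ.PreservesAt x (g x) (mfderiv (𝓡 3) (𝓡 3) g x) := by
  refine forall_congr' fun x => ⟨fun h v => ⟨⟨fun hv => ?_, fun hv => ?_⟩, fun hv => ?_,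
    fun hv => ?_⟩, fun h => ⟨?_, ?_⟩⟩
  · rw [← h.1] at hv
    obtain ⟨w, hw, hwv⟩ := hv
    have h1 := congrArg (mfderiv (𝓡 3) (𝓡 3) g.symm (g x) : E3 →L[ℝ] E3) hwv
    have h2 : w = v := (mfderiv_symm_apply g x w).symm.trans (h1.trans (mfderiv_symm_apply g x v))
    exact h2 ▸ hw
  · rw [← h.1]
    exact ⟨v, hv, rfl⟩
  · rw [← h.2] at hv
    obtain ⟨w, hw, hwv⟩ := hv
    have h1 := congrArg (mfderiv (𝓡 3) (𝓡 3) g.symm (g x) : E3 →L[ℝ] E3) hwv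
    have h2 : w = v := (mfderiv_symm_apply g x w).symm.trans (h1.trans (mfderiv_symm_apply g x v))
    exact h2 ▸ hw
  · rw [← h.2]
    exact ⟨v, hv, rfl⟩
  · ext w
    refine ⟨?_, fun hw => ?_⟩
    · rintro ⟨v, hv, rfl⟩
      exact (h v).1.2 hv
    · have h1 := mfderiv_apply_symm g x w
      have h2 : ∀ u : E3, u = (w : E3) → (u : TangentSpace (𝓡 3) (g x)) ∈ ξ.plane (g x) := by
        rintro u rfl; exact hw
      exact ⟨(mfderiv (𝓡 3) (𝓡 3) g.symm (g x) : E3 →L[ℝ] E3) w, (h _).1.1 (h2 _ h1), h1⟩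
  · ext w
    refine ⟨?_, fun hw => ?_⟩
    · rintro ⟨v, hv, rfl⟩
      exact (h v).2.2 hv
    · have h1 := mfderiv_apply_symm g x w
      have h2 : ∀ u : E3, u = (w : E3) → (u : TangentSpace (𝓡 3) (g x)) ∈ ξ.pos (g x) := by
        rintro u rfl; exact hw
      exact ⟨(mfderiv (𝓡 3) (𝓡 3) g.symm (g x) : E3 →L[ℝ] E3) w, (h _).2.1 (h2 _ h1), h1⟩

theorem IsContactomorphism.trans {g h : M ≃ₘ^∞⟮𝓡 3, 𝓡 3⟯ M} (hg : ξ.IsContactomorphism g)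
    (hh : ξ.IsContactomorphism h) : ξ.IsContactomorphism (g.trans h) := by
  rw [isContactomorphism_iff] at *
  intro x
  have h1 : mfderiv (𝓡 3) (𝓡 3) (g.trans h) x = _ :=
    mfderiv_comp (g := h) (f := g) x (mdifferentiable_diffeo h (g x)) (mdifferentiable_diffeo g x)
  rw [h1]
  exact (hg x).comp (hh (g x))

theorem IsContactomorphism.symm {g : M ≃ₘ^∞⟮𝓡 3, 𝓡 3⟯ M} (hg : ξ.IsContactomorphism g) :
    ξ.IsContactomorphism g.symm := by
  rw [isContactomorphism_iff] at *
  intro x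
  obtain ⟨y, rfl⟩ := g.surjective x
  have h1 : ∀ z, z = y →
      ξ.PreservesAt (g y) z (mfderiv (𝓡 3) (𝓡 3) g.symm (g y) : E3 →L[ℝ] E3) := by
    rintro z rfl
    exact (hg z).symm (mfderiv_apply_symm g z)
  exact h1 _ (g.symm_apply_apply y)

theorem ContactIsotopic.refl {g : M ≃ₘ^∞⟮𝓡 3, 𝓡 3⟯ M} (hg : ξ.IsContactomorphism g) :
    ξ.ContactIsotopic g g :=
  ⟨fun _ => g, (g.contMDiff.comp contMDiff_snd).contMDiffOn, fun _ _ => hg, rfl, rfl⟩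

/-- Contact isotopies can be composed. -/
theorem ContactIsotopic.trans_refl {g h φ : M ≃ₘ^∞⟮𝓡 3, 𝓡 3⟯ M} (hgh : ξ.ContactIsotopic g h)
    (hφ : ξ.ContactIsotopic (Diffeomorph.refl (𝓡 3) M ∞) φ) :
    ξ.ContactIsotopic g (h.trans φ) := by
  obtain ⟨a, ha, hac, ha0, ha1⟩ := hgh
  obtain ⟨b, hb, hbc, hb0, hb1⟩ := hφ
  -- The two isotopies run simultaneously. Concatenating them in time would break smoothness at the
  -- junction.
  refine ⟨fun t => (a t).trans (b t), ?_, fun t ht => (hac t ht).trans (hbc t ht), ?_, ?_⟩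
  · exact hb.comp (contMDiffOn_fst.prodMk ha) (fun p hp => ⟨hp.1, trivial⟩)
  · dsimp only
    rw [ha0, hb0]; rfl
  · dsimp only
    rw [ha1, hb1]

/-- The inverse of a contactomorphism isotopic to the identity is isotopic to the identity. -/
theorem ContactIsotopic.refl_symm {φ : M ≃ₘ^∞⟮𝓡 3, 𝓡 3⟯ M}
    (hφ : ξ.ContactIsotopic (Diffeomorph.refl (𝓡 3) M ∞) φ) :
    ξ.ContactIsotopic (Diffeomorph.refl (𝓡 3) M ∞) φ.symm := by
  obtain ⟨b, hb, hbc, hb0, hb1⟩ := hφ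
  have hmem : ∀ t ∈ Set.Icc (0 : ℝ) 1, 1 - t ∈ Set.Icc (0 : ℝ) 1 := fun t ht =>
    ⟨by linarith [ht.2], by linarith [ht.1]⟩
  have hφc : ξ.IsContactomorphism φ := hb1 ▸ hbc 1 ⟨zero_le_one, le_rfl⟩
  -- Running b backwards after `φ.symm` avoids the question whether the inverses of `b t` depend
  -- smoothly on `t`.
  refine ⟨fun t => φ.symm.trans (b (1 - t)), ?_, fun t ht => hφc.symm.trans (hbc _ (hmem t ht)),
    ?_, ?_⟩
  · have h1 : ContMDiff (𝓘(ℝ, ℝ).prod (𝓡 3)) 𝓘(ℝ, ℝ) ∞ (fun p : ℝ × M => 1 - p.1) :=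
      (contMDiff_iff_contDiff.2 (by fun_prop : ContDiff ℝ ∞ fun t : ℝ => 1 - t)).comp contMDiff_fst
    exact hb.comp (h1.prodMk (φ.symm.contMDiff.comp contMDiff_snd)).contMDiffOn
      (fun p hp => ⟨hmem _ hp.1, trivial⟩)
  · dsimp only
    rw [sub_zero, hb1]
    ext x
    simp
  · dsimp only
    rw [sub_self, hb0]
    rfl

end CoorientedContactStructure

end Contactomorphisms

/-! ### Extending compactly supported maps from a chart to M. -/

section Extension

variable {M : Type*} [TopologicalSpace M]

/-- A local coordinate system with values in `ℝ × ℝ × ℝ` that is smooth in both directions. -/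
structure IsSmoothChart [ChartedSpace E3 M] (κ : OpenPartialHomeomorph M V3) : Prop where
  smooth : ContMDiffOn (𝓡 3) 𝓘(ℝ, V3) ∞ κ κ.source
  smooth_symm : ContMDiffOn 𝓘(ℝ, V3) (𝓡 3) ∞ κ.symm κ.target

open Classical in
/-- Extend a self-map of `ℝ³`, read in a chart, by the identity. -/
def extendByChart (κ : OpenPartialHomeomorph M V3) (f : V3 → V3) (x : M) : M :=
  if x ∈ κ.source then κ.symm (f (κ x)) else x

variable {κ : OpenPartialHomeomorph M V3} {f f' : V3 → V3} {C : Set V3}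

theorem extendByChart_of_mem {x : M} (hx : x ∈ κ.source) :
    extendByChart κ f x = κ.symm (f (κ x)) := if_pos hx

theorem extendByChart_of_notMem {x : M} (hx : x ∉ κ.source) : extendByChart κ f x = x := if_neg hx

theorem extendByChart_eq_self {x : M} (hx : x ∈ κ.source) (hf : f (κ x) = κ x) :
    extendByChart κ f x = x := by
  rw [extendByChart_of_mem hx, hf, κ.left_inv hx]

/-- If f q left the target, it would lie off `C` and be fixed by f; injectivity would then give f q
= q, which is in the target. -/
theorem mapsTo_of_injective (hC : C ⊆ κ.target) (hinj : Function.Injective f)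
    (hf : ∀ q ∉ C, f q = q) : Set.MapsTo f κ.target κ.target := by
  intro q hq
  by_contra h
  have h1 : f (f q) = f q := hf _ fun hfC => h (hC hfC)
  exact h (by rwa [hinj h1])

/-- The image of `C` in M is compact, hence closed because M is Hausdorff. This is what makes the
extension by the identity smooth at the frontier of the chart. -/
theorem eventually_extendByChart_eq [T2Space M] (hC : IsCompact C) (hCt : C ⊆ κ.target) {x : M}
    (hx : x ∉ κ.source) : ∀ᶠ y in 𝓝 x, y ∉ κ.symm '' C := by
  have h1 : IsCompact (κ.symm '' C) := hC.image_of_continuousOn (κ.continuousOn_symm.mono hCt)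
  refine h1.isClosed.isOpen_compl.mem_nhds ?_
  rintro ⟨q, hq, rfl⟩
  exact hx (κ.map_target (hCt hq))

theorem extendByChart_of_notMem_image (hf : ∀ q ∉ C, f q = q) {y : M}
    (hy : y ∉ κ.symm '' C) : extendByChart κ f y = y := by
  by_cases hys : y ∈ κ.source
  · exact extendByChart_eq_self hys (hf _ fun h => hy ⟨κ y, h, κ.left_inv hys⟩)
  · exact extendByChart_of_notMem hys

theorem contMDiffOn_extendByChart [T2Space M] [ChartedSpace E3 M] (hκ : IsSmoothChart κ) (hC : IsCompact C)
    (hCt : C ⊆ κ.target) {I : Set ℝ} (hI : IsOpen I) {F : ℝ → V3 → V3}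
    (hF : ContDiffOn ℝ ∞ (fun q : ℝ × V3 => F q.1 q.2) (I ×ˢ Set.univ))
    (hinj : ∀ s ∈ I, Function.Injective (F s)) (hFC : ∀ s ∈ I, ∀ q ∉ C, F s q = q) :
    ContMDiffOn (𝓘(ℝ, ℝ).prod (𝓡 3)) (𝓡 3) ∞ (fun p : ℝ × M => extendByChart κ (F p.1) p.2)
      (I ×ˢ Set.univ) := by
  rintro ⟨s, x⟩ ⟨hs, -⟩
  refine ContMDiffAt.contMDiffWithinAt ?_
  have hsI : ∀ᶠ p : ℝ × M in 𝓝 (s, x), p.1 ∈ I :=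
    continuousAt_fst.eventually_mem (hI.mem_nhds hs)
  by_cases hx : x ∈ κ.source
  · have h1 : ContMDiffAt (𝓘(ℝ, ℝ).prod (𝓡 3)) 𝓘(ℝ, ℝ × V3) ∞
        (fun p : ℝ × M => (p.1, κ p.2)) (s, x) := by
      refine contMDiffAt_fst.prodMk_space ?_
      exact ContMDiffAt.comp (g := κ) (s, x) (hκ.smooth.contMDiffAt (κ.open_source.mem_nhds hx))
        contMDiffAt_snd
    have h2 : ContMDiffAt 𝓘(ℝ, ℝ × V3) 𝓘(ℝ, V3) ∞ (fun q : ℝ × V3 => F q.1 q.2) (s, κ x) :=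
      (hF.contDiffAt ((hI.prod isOpen_univ).mem_nhds ⟨hs, trivial⟩)).contMDiffAt
    have h3 : ContMDiffAt 𝓘(ℝ, V3) (𝓡 3) ∞ κ.symm (F s (κ x)) :=
      hκ.smooth_symm.contMDiffAt (κ.open_target.mem_nhds
        (mapsTo_of_injective hCt (hinj s hs) (hFC s hs) (κ.map_source hx)))
    have h4 : ContMDiffAt (𝓘(ℝ, ℝ).prod (𝓡 3)) (𝓡 3) ∞
        (fun p : ℝ × M => κ.symm (F p.1 (κ p.2))) (s, x) :=
      ContMDiffAt.comp (g := κ.symm) (f := fun p : ℝ × M => F p.1 (κ p.2)) (s, x) h3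
        (ContMDiffAt.comp (g := fun q : ℝ × V3 => F q.1 q.2)
          (f := fun p : ℝ × M => (p.1, κ p.2)) (s, x) h2 h1)
    refine h4.congr_of_eventuallyEq ?_
    filter_upwards [continuousAt_snd.eventually_mem (κ.open_source.mem_nhds hx)] with p hp
    exact extendByChart_of_mem hp
  · refine contMDiffAt_snd.congr_of_eventuallyEq ?_
    filter_upwards [hsI, continuousAt_snd.eventually (eventually_extendByChart_eq hC hCt hx)]
      with p hp1 hp2
    exact extendByChart_of_notMem_image (hFC _ hp1) hp2

theorem extendByChart_leftInverse (hC : C ⊆ κ.target) (hf : ∀ q ∉ C, f q = q)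
    (hinv : ∀ q, f' (f q) = q) (x : M) : extendByChart κ f' (extendByChart κ f x) = x := by
  by_cases hx : x ∈ κ.source
  · have h1 := mapsTo_of_injective hC (Function.LeftInverse.injective hinv) hf (κ.map_source hx)
    rw [extendByChart_of_mem hx, extendByChart_of_mem (κ.map_target h1), κ.right_inv h1, hinv,
      κ.left_inv hx]
  · rw [extendByChart_of_notMem hx, extendByChart_of_notMem hx]

/-- A family of compactly supported diffeomorphisms of `ℝ³` gives a family of diffeomorphisms of
`M`. -/
theorem exists_diffeo_family [T2Space M] [ChartedSpace E3 M] (hκ : IsSmoothChart κ) (hC : IsCompact C)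
    (hCt : C ⊆ κ.target) {I : Set ℝ} (hI : IsOpen I) {F F' : ℝ → V3 → V3}
    (hF : ContDiffOn ℝ ∞ (fun q : ℝ × V3 => F q.1 q.2) (I ×ˢ Set.univ))
    (hF' : ContDiffOn ℝ ∞ (fun q : ℝ × V3 => F' q.1 q.2) (I ×ˢ Set.univ))
    (hl : ∀ s ∈ I, ∀ q, F' s (F s q) = q) (hr : ∀ s ∈ I, ∀ q, F s (F' s q) = q)
    (hFC : ∀ s ∈ I, ∀ q ∉ C, F s q = q) :
    ∃ Φ : ℝ → (M ≃ₘ^∞⟮𝓡 3, 𝓡 3⟯ M), (∀ s ∈ I, ∀ x, Φ s x = extendByChart κ (F s) x) ∧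
      ContMDiffOn (𝓘(ℝ, ℝ).prod (𝓡 3)) (𝓡 3) ∞ (fun p : ℝ × M => Φ p.1 p.2)
        (I ×ˢ Set.univ) := by
  classical
  have hFC' : ∀ s ∈ I, ∀ q ∉ C, F' s q = q := fun s hs q hq => by
    conv_lhs => rw [← hFC s hs q hq]
    exact hl s hs q
  have hsm := contMDiffOn_extendByChart hκ hC hCt hI hF
    (fun s hs => Function.LeftInverse.injective (hl s hs)) hFC
  have hsm' := contMDiffOn_extendByChart hκ hC hCt hI hF'
    (fun s hs => Function.LeftInverse.injective (hr s hs)) hFC'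
  have hslice : ∀ {A : ℝ → V3 → V3}, ContMDiffOn (𝓘(ℝ, ℝ).prod (𝓡 3)) (𝓡 3) ∞
      (fun p : ℝ × M => extendByChart κ (A p.1) p.2) (I ×ˢ Set.univ) → ∀ s ∈ I,
      ContMDiff (𝓡 3) (𝓡 3) ∞ (extendByChart κ (A s)) := fun hA s hs => by
    rw [← contMDiffOn_univ]
    exact hA.comp (f := fun x : M => (s, x)) (contMDiff_const.prodMk contMDiff_id).contMDiffOn
      (fun x _ => ⟨hs, trivial⟩)
  let Φ : ℝ → (M ≃ₘ^∞⟮𝓡 3, 𝓡 3⟯ M) := fun s =>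
    if hs : s ∈ I then
      { toFun := extendByChart κ (F s)
        invFun := extendByChart κ (F' s)
        left_inv := extendByChart_leftInverse hCt (hFC s hs) (hl s hs)
        right_inv := extendByChart_leftInverse hCt (hFC' s hs) (hr s hs)
        contMDiff_toFun := hslice hsm s hs
        contMDiff_invFun := hslice hsm' s hs }
    else Diffeomorph.refl (𝓡 3) M ∞
  have hΦ : ∀ s ∈ I, ∀ x, Φ s x = extendByChart κ (F s) x := fun s hs x => by
    simp only [Φ, dif_pos hs]
    rfl
  exact ⟨Φ, hΦ, hsm.congr fun p hp => hΦ p.1 hp.1 p.2⟩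

end Extension

/-! ### Extending contact transformations. -/

section ContactExtension

variable {M : Type*} [TopologicalSpace M] [ChartedSpace E3 M] [IsManifold (𝓡 3) ∞ M]

/-- The contact structure is read in the chart `κ` as the kernel of `μ`, with its positive side. -/
def CoorientedContactStructure.IsChartForm (ξ : CoorientedContactStructure M)
    (κ : OpenPartialHomeomorph M V3) (μ : V3 → V3 → ℝ) : Prop :=
  ∀ x ∈ κ.source, ∀ v : TangentSpace (𝓡 3) x,
    (v ∈ ξ.plane x ↔ μ (κ x) (mfderiv (𝓡 3) 𝓘(ℝ, V3) κ x v) = 0) ∧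
    (v ∈ ξ.pos x ↔ 0 < μ (κ x) (mfderiv (𝓡 3) 𝓘(ℝ, V3) κ x v))

theorem CoorientedContactStructure.IsChartForm.preservesAt {ξ : CoorientedContactStructure M}
    {κ : OpenPartialHomeomorph M V3} {μ : V3 → V3 → ℝ} (hμ : ξ.IsChartForm κ μ)
    {x y : M} (hx : x ∈ κ.source) (hy : y ∈ κ.source) {L : E3 →L[ℝ] E3} {c : ℝ} (hc : 0 < c)
    (h : ∀ v : E3, μ (κ y) ((mfderiv (𝓡 3) 𝓘(ℝ, V3) κ y : E3 →L[ℝ] V3) (L v)) =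
      c * μ (κ x) ((mfderiv (𝓡 3) 𝓘(ℝ, V3) κ x : E3 →L[ℝ] V3) v)) :
    ξ.PreservesAt x y L := by
  intro v
  have h1 := hμ x hx v
  have h2 := hμ y hy (L v)
  have h3 := h v
  refine ⟨h2.1.trans (Iff.trans ?_ h1.1.symm), h2.2.trans (Iff.trans ?_ h1.2.symm)⟩
  · refine (Iff.of_eq (congrArg (· = 0) h3)).trans ?_
    simp [hc.ne']
  · refine (Iff.of_eq (congrArg (0 < ·) h3)).trans ?_
    exact mul_pos_iff_of_pos_left hc

/-- If a diffeomorphism is, near `x`, the extension of a map that is conformal for the contact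
form, then it respects the contact structure at `x`. -/
theorem CoorientedContactStructure.IsChartForm.preservesAt_mfderiv
    {ξ : CoorientedContactStructure M} {κ : OpenPartialHomeomorph M V3} (hκ : IsSmoothChart κ)
    {μ : V3 → V3 → ℝ} (hμ : ξ.IsChartForm κ μ) (φ : M ≃ₘ^∞⟮𝓡 3, 𝓡 3⟯ M) {f : V3 → V3}
    {x : M} (hx : x ∈ κ.source) (hf : DifferentiableAt ℝ f (κ x)) (hfx : φ x ∈ κ.source)
    (hφ : ∀ᶠ y in 𝓝 x, κ (φ y) = f (κ y)) {c : ℝ} (hc : 0 < c)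
    (h : ∀ v, μ (f (κ x)) (fderiv ℝ f (κ x) v) = c * μ (κ x) v) :
    ξ.PreservesAt x (φ x) (mfderiv (𝓡 3) (𝓡 3) φ x) := by
  have hdκ : ∀ y ∈ κ.source, MDifferentiableAt (𝓡 3) 𝓘(ℝ, V3) κ y := fun y hy =>
    (hκ.smooth.contMDiffAt (κ.open_source.mem_nhds hy)).mdifferentiableAt (by simp)
  have hdφ : MDifferentiableAt (𝓡 3) (𝓡 3) φ x :=
    mdifferentiable_diffeo φ x
  refine hμ.preservesAt hx hfx hc fun v => ?_
  have h1 := mfderiv_comp (g := κ) (f := φ) x (hdκ _ hfx) hdφ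
  have h2 := mfderiv_comp (g := f) (f := κ) x hf.mdifferentiableAt (hdκ x hx)
  have h3 : (κ : M → V3) ∘ φ =ᶠ[𝓝 x] f ∘ κ := hφ
  rw [h3.mfderiv_eq, h2, mfderiv_eq_fderiv] at h1
  have h4 : fderiv ℝ f (κ x) ((mfderiv (𝓡 3) 𝓘(ℝ, V3) κ x : E3 →L[ℝ] V3) v) =
    (mfderiv (𝓡 3) 𝓘(ℝ, V3) κ (φ x) : E3 →L[ℝ] V3)
      ((mfderiv (𝓡 3) (𝓡 3) φ x : E3 →L[ℝ] E3) v) := DFunLike.congr_fun h1 v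
  have h5 : κ (φ x) = f (κ x) := hφ.self_of_nhds
  exact (congrArg₂ μ h5 h4.symm).trans (h _)

/-- The extension of a compactly supported contact transformation is a contactomorphism. -/
theorem isContactomorphism_of_extendByChart [T2Space M] {ξ : CoorientedContactStructure M}
    {κ : OpenPartialHomeomorph M V3} (hκ : IsSmoothChart κ) {μ : V3 → V3 → ℝ}
    (hμ : ξ.IsChartForm κ μ) {C : Set V3} (hC : IsCompact C) (hCt : C ⊆ κ.target)
    (φ : M ≃ₘ^∞⟮𝓡 3, 𝓡 3⟯ M) {f : V3 → V3} (hφ : ∀ x, φ x = extendByChart κ f x)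
    (hf : Differentiable ℝ f) (hinj : Function.Injective f) (hfC : ∀ q ∉ C, f q = q)
    (h : ∀ q ∈ κ.target, ∃ c > 0, ∀ v, μ (f q) (fderiv ℝ f q v) = c * μ q v) :
    ξ.IsContactomorphism φ := by
  rw [CoorientedContactStructure.isContactomorphism_iff]
  intro x
  have hmaps := mapsTo_of_injective hCt hinj hfC
  by_cases hx : x ∈ κ.source
  · have hφy : ∀ y ∈ κ.source, φ y ∈ κ.source ∧ κ (φ y) = f (κ y) := fun y hy => by
      rw [hφ, extendByChart_of_mem hy]
      exact ⟨κ.map_target (hmaps (κ.map_source hy)), κ.right_inv (hmaps (κ.map_source hy))⟩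
    obtain ⟨c, hc, hcv⟩ := h (κ x) (κ.map_source hx)
    refine hμ.preservesAt_mfderiv hκ φ hx (hf _) (hφy x hx).1 ?_ hc hcv
    filter_upwards [κ.open_source.mem_nhds hx] with y hy using (hφy y hy).2
  · have h1 : (φ : M → M) =ᶠ[𝓝 x] id := by
      filter_upwards [eventually_extendByChart_eq hC hCt hx] with y hy
      rw [hφ]
      exact extendByChart_of_notMem_image hfC hy
    have h2 : (mfderiv (𝓡 3) (𝓡 3) φ x : E3 →L[ℝ] E3) = ContinuousLinearMap.id ℝ E3 :=
      h1.mfderiv_eq.trans mfderiv_id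
    have h3 : φ x = x := h1.eq_of_nhds
    have h4 : ∀ y, y = x → ξ.PreservesAt x y (ContinuousLinearMap.id ℝ E3) := by
      rintro y rfl
      exact CoorientedContactStructure.preservesAt_id _
    exact h2 ▸ h4 _ h3

end ContactExtension

/-! ### Contact isotopies of M from small changes of the generating function. -/

section LocalModification

variable {M : Type*} [TopologicalSpace M] [ChartedSpace E3 M] [IsManifold (𝓡 3) ∞ M]

/-- A chart in which `ξ` is the standard contact structure and `K` is the axis. -/
structure IsDarbouxChart (ξ : CoorientedContactStructure M) (K : Set M)
    (e : OpenPartialHomeomorph M V3) : Prop where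
  smooth : IsSmoothChart e
  form : ξ.IsChartForm e stdForm
  axis : ∀ x ∈ e.source, x ∈ K ↔ (e x).2 = 0

theorem eq_of_snd_eq_zero {q : V3} (hq : q.2 = 0) : q = (q.1, 0, 0) := Prod.ext rfl hq

theorem IsAxisGenerating.genTarget_eq_self {W : V3 → ℝ} {N : Set V3} (h : IsAxisGenerating W N)
    {q : V3} (hq : q ∈ N) (hq0 : q.2 = 0) : genTarget W q = q := by
  rw [eq_of_snd_eq_zero hq0] at hq ⊢
  exact h.genTarget_axis hq

variable {ξ : CoorientedContactStructure M}

theorem IsSmoothChart.trans_symm {M : Type*} [TopologicalSpace M] [ChartedSpace E3 M]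
    {e : OpenPartialHomeomorph M V3} (he : IsSmoothChart e)
    {c : OpenPartialHomeomorph V3 V3} (hc : ContDiffOn ℝ ∞ c c.source)
    (hc' : ContDiffOn ℝ ∞ c.symm c.target) : IsSmoothChart (e.trans c.symm) := by
  constructor
  · rw [OpenPartialHomeomorph.coe_trans]
    refine hc'.contMDiffOn.comp (he.smooth.mono ?_) ?_
    · intro x hx; exact hx.1
    · intro x hx; exact hx.2
  · rw [OpenPartialHomeomorph.coe_trans_symm]
    refine he.smooth_symm.comp (hc.contMDiffOn.mono ?_) ?_
    · intro x hx; exact hx.1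
    · intro x hx; exact hx.2

/-- Changing coordinates by a diffeomorphism pulls back the contact form. -/
theorem CoorientedContactStructure.IsChartForm.trans_symm {e : OpenPartialHomeomorph M V3}
    (he : IsSmoothChart e) {μ : V3 → V3 → ℝ} (hμ : ξ.IsChartForm e μ)
    {c : OpenPartialHomeomorph V3 V3} (hc : ContDiffOn ℝ ∞ c c.source)
    (hc' : ContDiffOn ℝ ∞ c.symm c.target) :
    IsSmoothChart (e.trans c.symm) ∧
      ξ.IsChartForm (e.trans c.symm) (fun q v => μ (c q) (fderiv ℝ c q v)) := by
  have hs := he.trans_symm hc hc'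
  refine ⟨hs, fun x hx v => ?_⟩
  have hx1 : x ∈ e.source := hx.1
  have hx2 : e x ∈ c.target := hx.2
  set κ := e.trans c.symm with hκdef
  have hκx : κ x = c.symm (e x) := rfl
  have hcκ : c (κ x) = e x := c.right_inv hx2
  have hdκ : MDifferentiableAt (𝓡 3) 𝓘(ℝ, V3) κ x :=
    (hs.smooth.contMDiffAt (κ.open_source.mem_nhds hx)).mdifferentiableAt (by simp)
  have hdc : DifferentiableAt ℝ c (κ x) :=
    (hc.contDiffAt (c.open_source.mem_nhds (c.map_target hx2))).differentiableAt (by simp)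
  have h2 := mfderiv_comp (g := c) (f := κ) x hdc.mdifferentiableAt hdκ
  have h3 : (e : M → V3) =ᶠ[𝓝 x] c ∘ κ := by
    filter_upwards [κ.open_source.mem_nhds hx] with y hy
    exact (c.right_inv (by exact hy.2)).symm
  rw [← h3.mfderiv_eq, mfderiv_eq_fderiv] at h2
  have h4 : (mfderiv (𝓡 3) 𝓘(ℝ, V3) e x : E3 →L[ℝ] V3) v =
    fderiv ℝ c (κ x) ((mfderiv (𝓡 3) 𝓘(ℝ, V3) κ x : E3 →L[ℝ] V3) v) := DFunLike.congr_fun h2 v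
  have h5 : μ (e x) ((mfderiv (𝓡 3) 𝓘(ℝ, V3) e x : E3 →L[ℝ] V3) v) =
    μ (c (κ x)) (fderiv ℝ c (κ x) ((mfderiv (𝓡 3) 𝓘(ℝ, V3) κ x : E3 →L[ℝ] V3) v)) :=
    congrArg₂ μ hcκ.symm h4
  have h6 := hμ x hx1 v
  exact ⟨h6.1.trans (Iff.of_eq (congrArg (· = 0) h5)),
    h6.2.trans (Iff.of_eq (congrArg (0 < ·) h5))⟩

/-- A small change of the generating function is realised by a contact isotopy of `M`. -/
theorem IsDarbouxChart.exists_contactIsotopic_step [T2Space M] {K : Set M}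
    {e : OpenPartialHomeomorph M V3} (he : IsDarbouxChart ξ K e) {W Q : V3 → ℝ} {N J : Set V3}
    (h : IsAxisGenerating W N) (hJ : IsCompact J) (hJN : J ⊆ N) (hJ0 : ∀ q ∈ J, q.2 = 0)
    (hJe : J ⊆ e.target)
    (hQ : ContDiffOn ℝ ∞ Q N) (hQ0 : ∀ x, (x, 0, 0) ∈ N → Q (x, 0, 0) = 0)
    (hQX : ∀ x, (x, 0, 0) ∈ N → partialX Q (x, 0, 0) = 0)
    (hQY : ∀ x, (x, 0, 0) ∈ N → partialY Q (x, 0, 0) = 0) :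
    ∃ r > 0, ∀ s ∈ Set.Ioo (-r) r, ∃ φ : M ≃ₘ^∞⟮𝓡 3, 𝓡 3⟯ M,
      ξ.IsContactomorphism φ ∧ ξ.ContactIsotopic (Diffeomorph.refl (𝓡 3) M ∞) φ ∧
      (∀ x ∈ K, φ x = x) ∧
      (∀ a ∈ K, (a ∈ e.source → e a ∈ N → ∀ᶠ q in 𝓝 (e a), Q q = 0) →
        ∀ᶠ x in 𝓝 a, φ x = x) ∧
      ∃ θ : V3 ≃ₜ V3, (∀ q ∈ J, θ q = q) ∧ ∀ᶠ q in 𝓝ˢ J,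
        genSource (fun p => W p + s * Q p) q = genSource W (θ q) ∧
        φ (e.symm (genTarget W (θ q))) = e.symm (genTarget (fun p => W p + s * Q p) q) := by
  have hTs := contDiffOn_genTarget h.isOpen h.smooth
  -- Restricting to points whose target image lies in the Darboux chart makes the target of the
  -- chart `κ` below all of `st.chart.source`.
  set N' := N ∩ genTarget W ⁻¹' e.target with hN'
  have hN'o : IsOpen N' := hTs.continuousOn.isOpen_inter_preimage h.isOpen e.open_target
  have hN'N : N' ⊆ N := Set.inter_subset_left
  have hJN' : J ⊆ N' := fun q hq => ⟨hJN hq, by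
    rw [Set.mem_preimage, h.genTarget_eq_self (hJN hq) (hJ0 q hq)]; exact hJe hq⟩
  have h' := h.mono hN'o hN'N
  obtain ⟨st⟩ := h'.nonempty_generatingStep hJ hJN' hJ0 (hQ.mono hN'N)
    (fun x hx => hQ0 x (hN'N hx)) (fun x hx => hQX x (hN'N hx)) (fun x hx => hQY x (hN'N hx))
  have hcfun : (st.chart : V3 → V3) = genTarget W := funext st.chart_apply
  have hcs : ContDiffOn ℝ ∞ st.chart st.chart.source := by
    rw [hcfun]
    exact hTs.mono (st.chart_source_subset.trans hN'N)
  obtain ⟨hκ, hμ⟩ := he.form.trans_symm he.smooth hcs st.contDiffOn_chart_symm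
  -- In `κ` the contact form is the pullback of the standard form by the target map of `W`, the form
  -- that `st.F` preserves up to a positive factor.
  set κ := e.trans st.chart.symm with hκdef
  have hκt : κ.target = st.chart.source := by
    ext q
    rw [hκdef, OpenPartialHomeomorph.trans_target]
    refine ⟨fun hq => hq.1, fun hq => ⟨hq, ?_⟩⟩
    have := (st.chart_source_subset hq).2
    rw [Set.mem_preimage, ← st.chart_apply] at this
    exact this
  have hκsymm : ∀ q, κ.symm q = e.symm (genTarget W q) := fun q => by
    rw [← st.chart_apply]; rfl
  have hCt : st.supp ⊆ κ.target := hκt ▸ st.supp_subset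
  obtain ⟨Φ, hΦ, hΦs⟩ := exists_diffeo_family hκ st.isCompact_supp hCt isOpen_Ioo st.contDiffOn_F
    st.contDiffOn_F' st.left_inv st.right_inv st.F_off
  have hFs : ∀ s ∈ Set.Ioo (-st.r) st.r, Differentiable ℝ (st.F s) := fun s hs q => by
    have h1 : ContDiffAt ℝ ∞ (fun q : ℝ × V3 => st.F q.1 q.2) (s, q) :=
      st.contDiffOn_F.contDiffAt ((isOpen_Ioo.prod isOpen_univ).mem_nhds ⟨hs, trivial⟩)
    have h2 : ContDiffAt ℝ ∞ (fun q : V3 => (s, q)) q := by fun_prop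
    exact (h1.comp q h2).differentiableAt (by simp)
  have hΦc : ∀ s ∈ Set.Ioo (-st.r) st.r, ξ.IsContactomorphism (Φ s) := fun s hs => by
    refine isContactomorphism_of_extendByChart hκ hμ st.isCompact_supp hCt (Φ s) (hΦ s hs)
      (hFs s hs) (Function.LeftInverse.injective (st.left_inv s hs)) (st.F_off s hs) ?_
    rw [hκt, hcfun]
    exact st.contact s hs
  -- On K the charts `κ` and `e` agree: the target map fixes the axis, and by `chart_axis` only axis
  -- points are sent to the axis.
  have haxis : ∀ a ∈ K, a ∈ κ.source → κ a = e a ∧ (e a).2 = 0 ∧ e a ∈ N := fun a ha hak => by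
    have h0 : (e a).2 = 0 := (he.axis a hak.1).1 ha
    have h1 : κ a ∈ st.chart.source := hκt ▸ κ.map_source hak
    have h2 : genTarget W (κ a) = e a := by
      rw [← st.chart_apply]
      exact st.chart.right_inv hak.2
    have h3 : (κ a).2 = 0 := st.chart_axis _ h1 (by rw [h2]; exact h0)
    have h4 := h'.genTarget_eq_self (st.chart_source_subset h1) h3
    have h5 : κ a = e a := h4.symm.trans h2
    exact ⟨h5, h0, h5 ▸ (st.chart_source_subset h1).1⟩
  refine ⟨st.r, st.r_pos, fun s hs => ⟨Φ s, hΦc s hs, ?_, ?_, ?_, ?_⟩⟩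
  · have hts : ∀ t ∈ Set.Icc (0 : ℝ) 1, t * s ∈ Set.Ioo (-st.r) st.r := fun t ht => by
      have h1 : |t * s| < st.r := by
        rw [abs_mul, abs_of_nonneg ht.1]
        exact (mul_le_of_le_one_left (abs_nonneg s) ht.2).trans_lt (abs_lt.2 hs)
      exact abs_lt.1 h1
    -- The family is run from time 0 to time s, rescaled to [0, 1].
    refine ⟨fun t => Φ (t * s), ?_, fun t ht => hΦc _ (hts t ht), ?_, ?_⟩
    · have h1 : ContMDiff (𝓘(ℝ, ℝ).prod (𝓡 3)) 𝓘(ℝ, ℝ) ∞ (fun p : ℝ × M => p.1 * s) :=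
        (contMDiff_iff_contDiff.2 (by fun_prop : ContDiff ℝ ∞ fun t : ℝ => t * s)).comp
          contMDiff_fst
      exact hΦs.comp (h1.prodMk contMDiff_snd).contMDiffOn (fun p hp => ⟨hts _ hp.1, trivial⟩)
    · ext x
      dsimp only
      rw [zero_mul, hΦ 0 ⟨by linarith [st.r_pos], st.r_pos⟩]
      by_cases hx : x ∈ κ.source
      · exact extendByChart_eq_self hx (st.F_zero _)
      · exact extendByChart_of_notMem hx
    · dsimp only
      rw [one_mul]
  · intro x hx
    rw [hΦ s hs]
    by_cases hxκ : x ∈ κ.source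
    · obtain ⟨h1, h2, -⟩ := haxis x hx hxκ
      refine extendByChart_eq_self hxκ ?_
      rw [h1, eq_of_snd_eq_zero h2]
      exact st.F_axis s hs _
    · exact extendByChart_of_notMem hxκ
  · intro a ha haQ
    by_cases haκ : a ∈ κ.source
    · obtain ⟨h1, h2, h3⟩ := haxis a ha haκ
      have h4 := st.F_id s hs (e a) (haQ haκ.1 h3)
      rw [← h1] at h4
      filter_upwards [(κ.continuousAt haκ).eventually h4, κ.open_source.mem_nhds haκ] with x hx hxκ
      rw [hΦ s hs]
      exact extendByChart_eq_self hxκ hx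
    · filter_upwards [eventually_extendByChart_eq st.isCompact_supp hCt haκ] with x hx
      rw [hΦ s hs]
      exact extendByChart_of_notMem_image (st.F_off s hs) hx
  · obtain ⟨θ, hθJ, hθ⟩ := st.germ s hs
    refine ⟨θ, hθJ, ?_⟩
    filter_upwards [hθ] with q hq
    obtain ⟨h1, h2, h3, h4⟩ := hq
    refine ⟨h3, ?_⟩
    have h5 : θ q ∈ κ.target := hκt ▸ h1
    rw [h4, ← hκsymm, ← hκsymm, hΦ s hs, extendByChart_of_mem (κ.map_target h5), κ.right_inv h5]

end LocalModification

/-! ### Deforming a contactomorphism to the identity near a compact piece of K. -/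

section LocalIsotopy

variable {M : Type*} [TopologicalSpace M] [ChartedSpace E3 M] [IsManifold (𝓡 3) ∞ M]

/-- Two linear forms with nested kernels are proportional. Since the standard form is 1 on ∂_z, the
ratio is the value on the image of ∂_z, which is positive by the coorientation. -/
theorem exists_pos_forall_stdForm_eq {q p : V3} (L : V3 →L[ℝ] V3)
    (h0 : ∀ v, stdForm q v = 0 → stdForm p (L v) = 0)
    (hpos : ∀ v, 0 < stdForm q v → 0 < stdForm p (L v)) :
    ∃ c > 0, ∀ v, stdForm p (L v) = c * stdForm q v := by
  refine ⟨stdForm p (L (0, 0, 1)), hpos _ (by simp [stdForm]), fun v => ?_⟩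
  have h1 := h0 (v - stdForm q v • (0, 0, 1)) (by simp [stdForm])
  rw [map_sub, map_smul] at h1
  simp only [stdForm, Prod.snd_sub, Prod.fst_sub, Prod.smul_fst, Prod.smul_snd, smul_eq_mul]
    at h1 ⊢
  linear_combination h1

variable {ξ : CoorientedContactStructure M} {K : Set M} {e : OpenPartialHomeomorph M V3}

theorem IsSmoothChart.exists_mfderiv_eq {M : Type*} [TopologicalSpace M] [ChartedSpace E3 M]
    {e : OpenPartialHomeomorph M V3} (he : IsSmoothChart e) {q : V3} (hq : q ∈ e.target)
    (u : V3) : ∃ v : E3, (mfderiv (𝓡 3) 𝓘(ℝ, V3) e (e.symm q) : E3 →L[ℝ] V3) v = u := by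
  have h1 : MDifferentiableAt 𝓘(ℝ, V3) (𝓡 3) e.symm q :=
    (he.smooth_symm.contMDiffAt (e.open_target.mem_nhds hq)).mdifferentiableAt (by simp)
  have h2 : MDifferentiableAt (𝓡 3) 𝓘(ℝ, V3) e (e.symm q) :=
    (he.smooth.contMDiffAt (e.open_source.mem_nhds (e.map_target hq))).mdifferentiableAt (by simp)
  have h3 := mfderiv_comp (g := e) (f := e.symm) q h2 h1
  have h4 : (e : M → V3) ∘ e.symm =ᶠ[𝓝 q] id := by
    filter_upwards [e.open_target.mem_nhds hq] with p hp using e.right_inv hp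
  rw [h4.mfderiv_eq, mfderiv_id] at h3
  exact ⟨(mfderiv 𝓘(ℝ, V3) (𝓡 3) e.symm q : V3 →L[ℝ] E3) u, (DFunLike.congr_fun h3 u).symm⟩

/-- A contactomorphism fixing `K`, read in a Darboux chart. -/
theorem IsDarbouxChart.isAxisContact (he : IsDarbouxChart ξ K e) {g : M ≃ₘ^∞⟮𝓡 3, 𝓡 3⟯ M}
    (hg : ξ.IsContactomorphism g) (hgK : ∀ x ∈ K, g x = x) :
    IsAxisContact (fun q => e (g (e.symm q))) (e.target ∩ e.symm ⁻¹' (g ⁻¹' e.source)) := by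
  have hD : IsOpen (e.target ∩ e.symm ⁻¹' (g ⁻¹' e.source)) :=
    e.isOpen_inter_preimage_symm (e.open_source.preimage g.continuous)
  have hs : ContDiffOn ℝ ∞ (fun q => e (g (e.symm q)))
      (e.target ∩ e.symm ⁻¹' (g ⁻¹' e.source)) := by
    rw [← contMDiffOn_iff_contDiffOn]
    exact he.smooth.smooth.comp (g.contMDiff.comp_contMDiffOn
      (he.smooth.smooth_symm.mono Set.inter_subset_left)) (fun q hq => hq.2)
  refine ⟨hD, hs, fun x hx => ?_, fun q hq => ?_⟩
  · have h1 : e.symm (x, 0, 0) ∈ K := by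
      rw [he.axis _ (e.map_target hx.1), e.right_inv hx.1]; rfl
    rw [hgK _ h1, e.right_inv hx.1]
  · set x := e.symm q with hxq
    have hx : x ∈ e.source := e.map_target hq.1
    have hex : e x = q := e.right_inv hq.1
    have hgx : g x ∈ e.source := hq.2
    have hdG : DifferentiableAt ℝ (fun q => e (g (e.symm q))) (e x) := by
      rw [hex]; exact (hs.contDiffAt (hD.mem_nhds hq)).differentiableAt (by simp)
    have hde : ∀ y ∈ e.source, MDifferentiableAt (𝓡 3) 𝓘(ℝ, V3) e y := fun y hy =>
      (he.smooth.smooth.contMDiffAt (e.open_source.mem_nhds hy)).mdifferentiableAt (by simp)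
    have h1 := mfderiv_comp (g := e) (f := g) x (hde _ hgx) (mdifferentiable_diffeo g x)
    have h2 := mfderiv_comp (g := fun q => e (g (e.symm q))) (f := e) x hdG.mdifferentiableAt
      (hde x hx)
    have h3 : (e : M → V3) ∘ g =ᶠ[𝓝 x] (fun q => e (g (e.symm q))) ∘ e := by
      filter_upwards [e.open_source.mem_nhds hx] with y hy
      simp [e.left_inv hy]
    rw [h3.mfderiv_eq, h2, mfderiv_eq_fderiv] at h1
    have h4 : ∀ v : E3, fderiv ℝ (fun q => e (g (e.symm q))) (e x)
        ((mfderiv (𝓡 3) 𝓘(ℝ, V3) e x : E3 →L[ℝ] V3) v) =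
        (mfderiv (𝓡 3) 𝓘(ℝ, V3) e (g x) : E3 →L[ℝ] V3)
          ((mfderiv (𝓡 3) (𝓡 3) g x : E3 →L[ℝ] E3) v) := fun v => DFunLike.congr_fun h1 v
    rw [hex] at h4
    have hP := (CoorientedContactStructure.isContactomorphism_iff g).1 hg x
    refine exists_pos_forall_stdForm_eq _ (fun u hu => ?_) (fun u hu => ?_)
    · obtain ⟨v, rfl⟩ := he.smooth.exists_mfderiv_eq hq.1 u
      rw [← hxq, ← hex] at hu
      have h5 := (he.form x hx v).1.2 hu
      have h6 := (he.form (g x) hgx _).1.1 ((hP v).1.2 h5)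
      exact (congrArg (stdForm (e (g x))) (h4 v)).trans h6
    · obtain ⟨v, rfl⟩ := he.smooth.exists_mfderiv_eq hq.1 u
      rw [← hxq, ← hex] at hu
      have h5 := (he.form x hx v).2.2 hu
      have h6 := (he.form (g x) hgx _).2.1 ((hP v).2.2 h5)
      exact h6.trans_eq (congrArg (stdForm (e (g x))) (h4 v)).symm

theorem fderiv_sub_apply {W : V3 → ℝ} {p : V3} (hW : DifferentiableAt ℝ W p) (v : V3) :
    fderiv ℝ (fun q : V3 => q.2.2 - q.1 * q.2.1 - W q) p v =
      v.2.2 - (p.1 * v.2.1 + p.2.1 * v.1) - fderiv ℝ W p v := by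
  have h1 : HasFDerivAt (fun q : V3 => q.1) (ContinuousLinearMap.fst ℝ ℝ (ℝ × ℝ)) p :=
    hasFDerivAt_fst
  have h2 : HasFDerivAt (fun q : V3 => q.2) (ContinuousLinearMap.snd ℝ ℝ (ℝ × ℝ)) p :=
    hasFDerivAt_snd
  have h3 := (h2.snd.sub (h1.mul h2.fst)).sub hW.hasFDerivAt
  rw [show (fun q : V3 => q.2.2 - q.1 * q.2.1 - W q) = _ from rfl]
  exact (DFunLike.congr_fun h3.fderiv v).trans (by simp)

theorem genSource_identity (q : V3) :
    genSource (fun p : V3 => p.2.2 - p.1 * p.2.1) q = q := by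
  have h := fun v => fderiv_sub_apply (W := fun _ => 0) (p := q) (differentiableAt_const 0) v
  simp only [sub_zero] at h
  simp [genSource, partialX, partialZ, h]

theorem genTarget_identity (q : V3) :
    genTarget (fun p : V3 => p.2.2 - p.1 * p.2.1) q = q := by
  have h := fun v => fderiv_sub_apply (W := fun _ => 0) (p := q) (differentiableAt_const 0) v
  simp only [sub_zero] at h
  ext <;> simp [genTarget, partialY, h]
  ring

/-- The affine path of generating functions from `W` to the one of the identity. -/
theorem IsAxisGenerating.affinePath {W : V3 → ℝ} {N : Set V3} (h : IsAxisGenerating W N) :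
    ContDiffOn ℝ ∞ (fun q => q.2.2 - q.1 * q.2.1 - W q) N ∧
    (∀ x, (x, 0, 0) ∈ N → (fun q : V3 => q.2.2 - q.1 * q.2.1 - W q) (x, 0, 0) = 0) ∧
    (∀ x, (x, 0, 0) ∈ N → partialX (fun q => q.2.2 - q.1 * q.2.1 - W q) (x, 0, 0) = 0) ∧
    (∀ x, (x, 0, 0) ∈ N → partialY (fun q => q.2.2 - q.1 * q.2.1 - W q) (x, 0, 0) = 0) ∧
    ∀ t ∈ Set.Icc (0 : ℝ) 1,
      IsAxisGenerating (fun q => W q + t * (q.2.2 - q.1 * q.2.1 - W q)) N := by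
  have hWd : ∀ q ∈ N, DifferentiableAt ℝ W q := fun q hq =>
    (h.smooth.contDiffAt (h.isOpen.mem_nhds hq)).differentiableAt (by simp)
  have h1 : ContDiffOn ℝ ∞ (fun q => q.2.2 - q.1 * q.2.1 - W q) N :=
    ContDiffOn.sub (by fun_prop) h.smooth
  have h2 : ∀ x, (x, 0, 0) ∈ N → (fun q : V3 => q.2.2 - q.1 * q.2.1 - W q) (x, 0, 0) = 0 :=
    fun x hx => by simp [h.zero x hx]
  have h3 : ∀ x, (x, 0, 0) ∈ N →
      partialX (fun q => q.2.2 - q.1 * q.2.1 - W q) (x, 0, 0) = 0 := fun x hx => by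
    rw [partialX, fderiv_sub_apply (hWd _ hx)]
    have := h.partialX_zero x hx
    rw [partialX] at this
    simp [this]
  have h4 : ∀ x, (x, 0, 0) ∈ N →
      partialY (fun q => q.2.2 - q.1 * q.2.1 - W q) (x, 0, 0) = 0 := fun x hx => by
    rw [partialY, fderiv_sub_apply (hWd _ hx)]
    have := h.partialY_eq x hx
    rw [partialY] at this
    simp [this]
  refine ⟨h1, h2, h3, h4, fun t ht => h.add_mul h1 h2 h3 h4 fun q hq => ?_⟩
  -- The z-derivative along the path is (1 - t) W_z + t, positive for t in [0, 1].
  have h5 : partialZ (fun q => q.2.2 - q.1 * q.2.1 - W q) q = 1 - partialZ W q := by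
    rw [partialZ, fderiv_sub_apply (hWd _ hq), partialZ]
    simp
  rw [h5]
  have h6 := h.pos q hq
  rcases eq_or_lt_of_le ht.1 with h7 | h7
  · rw [← h7]; simpa using h6
  · nlinarith [mul_nonneg (sub_nonneg.2 ht.2) h6.le]

/-- Near a compact part `J` of `K` inside a Darboux chart, a contactomorphism fixing `K` can be
isotoped to the identity, without spoiling the points of `K` near which it is the identity. -/
theorem IsDarbouxChart.exists_contactIsotopic_eq_self [T2Space M] (he : IsDarbouxChart ξ K e)
    {g : M ≃ₘ^∞⟮𝓡 3, 𝓡 3⟯ M} (hg : ξ.IsContactomorphism g) (hgK : ∀ x ∈ K, g x = x)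
    {A J : Set M} (hA : A ⊆ K) (hgA : ∀ a ∈ A, ∀ᶠ x in 𝓝 a, g x = x) (hJ : IsCompact J)
    (hJK : J ⊆ K) (hJe : J ⊆ e.source) :
    ∃ h : M ≃ₘ^∞⟮𝓡 3, 𝓡 3⟯ M, ξ.IsContactomorphism h ∧ ξ.ContactIsotopic g h ∧
      (∀ x ∈ K, h x = x) ∧ ∀ a ∈ A ∪ J, ∀ᶠ x in 𝓝 a, h x = x := by
  have hJc : IsCompact (e '' J) := hJ.image_of_continuousOn (e.continuousOn.mono hJe)
  have hJ0 : ∀ q ∈ e '' J, q.2 = 0 := by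
    rintro _ ⟨x, hx, rfl⟩
    exact (he.axis x (hJe hx)).1 (hJK hx)
  have hJt : e '' J ⊆ e.target := by
    rintro _ ⟨x, hx, rfl⟩
    exact e.map_source (hJe hx)
  have hJD : e '' J ⊆ e.target ∩ e.symm ⁻¹' (g ⁻¹' e.source) := by
    rintro _ ⟨x, hx, rfl⟩
    refine ⟨e.map_source (hJe hx), ?_⟩
    rw [Set.mem_preimage, Set.mem_preimage, e.left_inv (hJe hx), hgK x (hJK hx)]
    exact hJe hx
  obtain ⟨W, N, hW, hJN, hWG, hWid⟩ := (he.isAxisContact hg hgK).exists_generating hJc hJD hJ0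
  obtain ⟨hQ, hQ0, hQX, hQY, hWt⟩ := hW.affinePath
  have hQA : ∀ a ∈ A, a ∈ e.source → e a ∈ N →
      ∀ᶠ q in 𝓝 (e a), q.2.2 - q.1 * q.2.1 - W q = 0 := fun a ha hae haN => by
    have h1 : ∀ᶠ q in 𝓝 (e a), g (e.symm q) = e.symm q := by
      have := e.continuousAt_symm (e.map_source hae)
      rw [ContinuousAt, e.left_inv hae] at this
      exact this.eventually (hgA a ha)
    filter_upwards [hWid (e a) haN (by
      filter_upwards [h1, e.open_target.mem_nhds (e.map_source hae)] with q hq hqt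
      rw [hq, e.right_inv hqt])] with q hq
    rw [hq, sub_self]
  -- `T t` says that g is isotopic, respecting K and the earlier set `A`, to a contactomorphism
  -- whose germ along `J` is generated by W_t. For t = 0 this is g, and for t = 1 the germ is the
  -- identity.
  let T : ℝ → Prop := fun t => ∃ h : M ≃ₘ^∞⟮𝓡 3, 𝓡 3⟯ M, ξ.IsContactomorphism h ∧
    ξ.ContactIsotopic g h ∧ (∀ x ∈ K, h x = x) ∧ (∀ a ∈ A, ∀ᶠ x in 𝓝 a, h x = x) ∧
    ∀ᶠ q in 𝓝ˢ (e '' J),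
      h (e.symm (genSource (fun q => W q + t * (q.2.2 - q.1 * q.2.1 - W q)) q)) =
        e.symm (genTarget (fun q => W q + t * (q.2.2 - q.1 * q.2.1 - W q)) q)
  have hT0 : T 0 := by
    refine ⟨g, hg, .refl hg, hgK, hgA, ?_⟩
    simp only [zero_mul, add_zero]
    filter_upwards [hW.isOpen.mem_nhdsSet.2 hJN] with q hq
    obtain ⟨h1, h2⟩ := hWG q hq
    rw [← h2, e.left_inv h1.2]
  -- The step length r depends on t and no uniform lower bound is established. Proving an
  -- equivalence, with φ for one direction and φ⁻¹ for the other, makes `T` locally constant, so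
  -- connectedness suffices.
  have hstep : ∀ t ∈ Set.Icc (0 : ℝ) 1, ∃ r > 0, ∀ s ∈ Set.Ioo (-r) r, (T t ↔ T (t + s)) := by
    intro t ht
    obtain ⟨r, hr, hrs⟩ := he.exists_contactIsotopic_step (hWt t ht) hJc hJN hJ0 hJt hQ hQ0 hQX hQY
    refine ⟨r, hr, fun s hs => ?_⟩
    obtain ⟨φ, hφc, hφi, hφK, hφA, θ, hθJ, hθ⟩ := hrs s hs
    have hts : (fun p : V3 => W p + t * (p.2.2 - p.1 * p.2.1 - W p) +
        s * (p.2.2 - p.1 * p.2.1 - W p)) =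
        fun p => W p + (t + s) * (p.2.2 - p.1 * p.2.1 - W p) := by
      funext p; ring
    rw [hts] at hθ
    -- The homeomorphism θ fixes `J` pointwise, so statements near `J` can be read at θ q or at its
    -- preimage.
    have hθt : Filter.Tendsto θ (𝓝ˢ (e '' J)) (𝓝ˢ (e '' J)) :=
      θ.continuous.tendsto_nhdsSet fun q hq => by rw [hθJ q hq]; exact hq
    have hθt' : Filter.Tendsto θ.symm (𝓝ˢ (e '' J)) (𝓝ˢ (e '' J)) :=
      θ.symm.continuous.tendsto_nhdsSet fun q hq => by
        rw [← hθJ q hq, θ.symm_apply_apply]; exact hq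
    constructor
    · rintro ⟨h, hc, hi, hK, hhA, hhJ⟩
      refine ⟨h.trans φ, hc.trans hφc, hi.trans_refl hφi, fun x hx => ?_, fun a ha => ?_, ?_⟩
      · change φ (h x) = x
        rw [hK x hx, hφK x hx]
      · filter_upwards [hhA a ha, hφA a (hA ha) (hQA a ha)] with x h1 h2
        change φ (h x) = x
        rw [h1, h2]
      · filter_upwards [hθ, hθt.eventually hhJ] with q h1 h2
        change φ (h _) = _
        rw [h1.1, h2, h1.2]
    · rintro ⟨h, hc, hi, hK, hhA, hhJ⟩
      have hφs : ∀ x, φ x = x → φ.symm x = x := fun x hx => by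
        conv_lhs => rw [← hx]
        exact φ.symm_apply_apply x
      refine ⟨h.trans φ.symm, hc.trans hφc.symm, hi.trans_refl hφi.refl_symm, fun x hx => ?_,
        fun a ha => ?_, ?_⟩
      · change φ.symm (h x) = x
        rw [hK x hx, hφs x (hφK x hx)]
      · filter_upwards [hhA a ha, hφA a (hA ha) (hQA a ha)] with x h1 h2
        change φ.symm (h x) = x
        rw [h1, hφs x h2]
      · filter_upwards [hθt'.eventually hθ, hθt'.eventually hhJ] with q h1 h2
        change φ.symm (h _) = _
        rw [θ.apply_symm_apply] at h1
        rw [← h1.1, h2, ← h1.2]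
        exact φ.symm_apply_apply _
  have hT1 : T 1 := by
    refine ((isPreconnected_Icc (a := (0 : ℝ)) (b := 1)).induction₂ (fun a b => T a ↔ T b)
      (fun t ht => ?_) (fun _ _ _ _ _ _ h1 h2 => h1.trans h2) (fun _ _ _ _ h => h.symm)
      (x := 0) (y := 1) (by simp) (by simp)).1 hT0
    obtain ⟨r, hr, hrs⟩ := hstep t ht
    refine nhdsWithin_le_nhds ?_
    filter_upwards [Ioo_mem_nhds (by linarith : t - r < t) (by linarith : t < t + r)] with s hs
    have := hrs (s - t) ⟨by linarith [hs.1], by linarith [hs.2]⟩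
    rwa [add_sub_cancel] at this
  obtain ⟨h, hc, hi, hK, hhA, hhJ⟩ := hT1
  refine ⟨h, hc, hi, hK, ?_⟩
  rintro a (ha | ha)
  · exact hhA a ha
  · have h1 : (fun p : V3 => W p + 1 * (p.2.2 - p.1 * p.2.1 - W p)) =
        fun p => p.2.2 - p.1 * p.2.1 := by
      funext p; ring
    simp only [h1, genSource_identity, genTarget_identity] at hhJ
    have h2 := (e.continuousAt (hJe ha)).eventually
      (hhJ.filter_mono (nhds_le_nhdsSet (Set.mem_image_of_mem e ha)))
    filter_upwards [h2, e.open_source.mem_nhds (hJe ha)] with x hx hxs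
    rwa [e.left_inv hxs] at hx

end LocalIsotopy

/-! ### Globalisation over the compact set K. -/

section Globalization

variable {M : Type*} [TopologicalSpace M] [ChartedSpace E3 M] [IsManifold (𝓡 3) ∞ M]
  {ξ : CoorientedContactStructure M}

/-- Contact isotopy is transitive. -/
theorem CoorientedContactStructure.ContactIsotopic.trans {g h k : M ≃ₘ^∞⟮𝓡 3, 𝓡 3⟯ M}
    (hgh : ξ.ContactIsotopic g h) (hhk : ξ.ContactIsotopic h k) : ξ.ContactIsotopic g k := by
  -- Precomposing the second isotopy with `h.symm` makes it start at the identity, so it can run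
  -- simultaneously with the first and no smoothing in time is needed.
  have h1 : ξ.ContactIsotopic (Diffeomorph.refl (𝓡 3) M ∞) (h.symm.trans k) := by
    obtain ⟨b, hb, hbc, hb0, hb1⟩ := hhk
    have hh : ξ.IsContactomorphism h := hb0 ▸ hbc 0 ⟨le_rfl, zero_le_one⟩
    refine ⟨fun t => h.symm.trans (b t), ?_, fun t ht => hh.symm.trans (hbc t ht), ?_, ?_⟩
    · exact hb.comp (contMDiff_fst.prodMk (h.symm.contMDiff.comp contMDiff_snd)).contMDiffOn
        (fun p hp => ⟨hp.1, trivial⟩)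
    · ext x
      simp [hb0]
    · dsimp only
      rw [hb1]
  have h2 := hgh.trans_refl h1
  have h3 : h.trans (h.symm.trans k) = k := by
    ext x
    exact congrArg k (h.symm_apply_apply x)
  rwa [h3] at h2

/-- If a compact set `K` is covered by Darboux charts, then every contactomorphism fixing `K` is
contact isotopic to one that is the identity near `K`. -/
theorem exists_contactIsotopic_eq_self_near [T2Space M] {K : Set M} (hK : IsCompact K)
    (hD : ∀ x ∈ K, ∃ e : OpenPartialHomeomorph M V3, IsDarbouxChart ξ K e ∧ x ∈ e.source)
    {g : M ≃ₘ^∞⟮𝓡 3, 𝓡 3⟯ M} (hg : ξ.IsContactomorphism g) (hgK : ∀ x ∈ K, g x = x) :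
    ∃ h : M ≃ₘ^∞⟮𝓡 3, 𝓡 3⟯ M, ξ.IsContactomorphism h ∧ ξ.ContactIsotopic g h ∧
      ∀ a ∈ K, ∀ᶠ x in 𝓝 a, h x = x := by
  have : LocallyCompactSpace M := ChartedSpace.locallyCompactSpace E3 M
  -- The statement is strengthened for induction: it is quantified over all g and over the part `A`
  -- of K already treated, so that two pieces can be handled one after the other.
  let P : Set M → Prop := fun S => ∀ g : M ≃ₘ^∞⟮𝓡 3, 𝓡 3⟯ M, ξ.IsContactomorphism g →
    (∀ x ∈ K, g x = x) → ∀ A ⊆ K, (∀ a ∈ A, ∀ᶠ x in 𝓝 a, g x = x) →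
    ∃ h : M ≃ₘ^∞⟮𝓡 3, 𝓡 3⟯ M, ξ.IsContactomorphism h ∧ ξ.ContactIsotopic g h ∧
      (∀ x ∈ K, h x = x) ∧ ∀ a ∈ A ∪ (S ∩ K), ∀ᶠ x in 𝓝 a, h x = x
  have hP : P K := by
    refine hK.induction_on (p := P) ?_ ?_ ?_ ?_
    · intro g hg hgK A _ hgA
      exact ⟨g, hg, .refl hg, hgK, by simpa using hgA⟩
    · intro s t hst ht g hg hgK A hA hgA
      obtain ⟨h, h1, h2, h3, h4⟩ := ht g hg hgK A hA hgA
      exact ⟨h, h1, h2, h3, fun a ha => h4 a (ha.imp id fun h => ⟨hst h.1, h.2⟩)⟩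
    · intro s t hs ht g hg hgK A hA hgA
      obtain ⟨h, h1, h2, h3, h4⟩ := hs g hg hgK A hA hgA
      obtain ⟨k, k1, k2, k3, k4⟩ := ht h h1 h3 _
        (Set.union_subset hA Set.inter_subset_right) h4
      refine ⟨k, k1, h2.trans k2, k3, fun a ha => k4 a ?_⟩
      rcases ha with ha | ⟨ha | ha, haK⟩
      · exact .inl (.inl ha)
      · exact .inl (.inr ⟨ha, haK⟩)
      · exact .inr ⟨ha, haK⟩
    · intro x hx
      obtain ⟨e, he, hxe⟩ := hD x hx
      obtain ⟨C, hC, hCe, hCc⟩ := local_compact_nhds (e.open_source.mem_nhds hxe)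
      refine ⟨C, mem_nhdsWithin_of_mem_nhds hC, fun g hg hgK A hA hgA => ?_⟩
      exact he.exists_contactIsotopic_eq_self hg hgK hA hgA (hCc.inter_right hK.isClosed)
        Set.inter_subset_right (Set.inter_subset_left.trans hCe)
  obtain ⟨h, h1, h2, -, h4⟩ := hP g hg hgK ∅ (Set.empty_subset _) (by simp)
  exact ⟨h, h1, h2, fun a ha => h4 a (.inr ⟨ha, ha⟩)⟩

end Globalization

/-! ### Pullback and exterior derivative of 1-forms in charts. -/

section Pullback

variable {M : Type*} [TopologicalSpace M] [ChartedSpace E3 M] [IsManifold (𝓡 3) ∞ M]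
  {V : Type*} [NormedAddCommGroup V] [NormedSpace ℝ V]

/-- The pullback of a `1`-form on `M` by a map from a normed space. -/
def OneForm.pullback (α : OneForm M) (f : V → M) (q : V) : V →L[ℝ] ℝ :=
  (α (f q) : E3 →L[ℝ] ℝ).comp (mfderiv 𝓘(ℝ, V) (𝓡 3) f q : V →L[ℝ] E3)

theorem OneForm.inChart_eq_pullback (α : OneForm M) (x : M) :
    α.inChart x = α.pullback (extChartAt (𝓡 3) x).symm := rfl

/-- In finite dimension it is enough to evaluate on constant vectors v. The value is the bundle
pairing of the section along f with the tangent map of f at (q, v), and both are smooth. -/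
theorem OneForm.contDiffOn_pullback [FiniteDimensional ℝ V] (α : OneForm M) {f : V → M}
    {S : Set V} (hS : IsOpen S)
    (hf : ContMDiffOn 𝓘(ℝ, V) (𝓡 3) ∞ f S) : ContDiffOn ℝ ∞ (α.pullback f) S := by
  rw [contDiffOn_clm_apply]
  intro v
  have h1 := hf.contMDiffOn_tangentMapWithin (m := ∞) (by simp) hS.uniqueMDiffOn
  have h2 : ContMDiffOn 𝓘(ℝ, V) 𝓘(ℝ, V).tangent ∞
      (fun q : V => (⟨q, v⟩ : TangentBundle 𝓘(ℝ, V) V)) S :=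
    contMDiffOn_vectorSpace_iff_contDiffOn.2 contDiffOn_const
  have h3 := h1.comp h2 (fun q hq => hq)
  have h4 : ContMDiffOn 𝓘(ℝ, V) (𝓡 3).tangent ∞
      (fun q : V => (⟨f q, (mfderiv 𝓘(ℝ, V) (𝓡 3) f q : V →L[ℝ] E3) v⟩ :
        TangentBundle (𝓡 3) M)) S := by
    refine h3.congr fun q hq => ?_
    simp only [Function.comp, tangentMapWithin]
    rw [mfderivWithin_of_isOpen hS hq]
  have h5 := (α.contMDiff.comp_contMDiffOn hf).clm_bundle_apply h4
  intro q hq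
  have h6 := h5 q hq
  rw [Bundle.contMDiffWithinAt_totalSpace] at h6
  exact h6.2.contDiffWithinAt

theorem OneForm.pullback_comp {V' : Type*} [NormedAddCommGroup V'] [NormedSpace ℝ V']
    (α : OneForm M) {f : V → M} {c : V' → V} {q : V'}
    (hf : MDifferentiableAt 𝓘(ℝ, V) (𝓡 3) f (c q)) (hc : DifferentiableAt ℝ c q) :
    α.pullback (fun p => f (c p)) q = (α.pullback f (c q)).comp (fderiv ℝ c q) := by
  have h1 := mfderiv_comp (g := f) (f := c) q hf hc.mdifferentiableAt
  rw [mfderiv_eq_fderiv] at h1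
  ext v
  exact congrArg (α (f (c q)) : E3 →L[ℝ] ℝ) (DFunLike.congr_fun h1 v)

/-- The exterior derivative of a `1`-form on a normed space, as an antisymmetric function. -/
def extForm (β : V → V →L[ℝ] ℝ) (q v w : V) : ℝ := fderiv ℝ β q v w - fderiv ℝ β q w v

theorem extDeriv_ofSubsingleton {β : V → V →L[ℝ] ℝ} {q : V} (hβ : DifferentiableAt ℝ β q)
    (v : Fin 2 → V) :
    extDeriv (fun y => ContinuousAlternatingMap.ofSubsingleton ℝ V ℝ (0 : Fin 1) (β y)) q v =
      extForm β q (v 0) (v 1) := by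
  have h1 : DifferentiableAt ℝ
      (fun y => ContinuousAlternatingMap.ofSubsingleton ℝ V ℝ (0 : Fin 1) (β y)) q :=
    (ContinuousAlternatingMap.ofSubsingletonLIE (𝕜 := ℝ) (E := V) (F := ℝ)
      (0 : Fin 1)).toContinuousLinearEquiv.differentiableAt.comp q hβ
  rw [extDeriv_apply h1, Fin.sum_univ_two, extForm]
  have h2 : ∀ u x : V, fderiv ℝ (fun y => β y u) q x = fderiv ℝ β q x u := fun u x => by
    rw [fderiv_clm_apply hβ (differentiableAt_const u)]
    simp
  have h3 : Fin.tail v 0 = v 1 := rfl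
  simp [Fin.removeNth, h2, h3]
  ring

/-- Naturality of the exterior derivative: the terms with the second derivative of ψ cancel under
antisymmetrisation by its symmetry. -/
theorem extForm_comp {V' : Type*} [NormedAddCommGroup V'] [NormedSpace ℝ V']
    {η : V' → V' →L[ℝ] ℝ} {ψ : V → V'} {q : V} (hη : DifferentiableAt ℝ η (ψ q))
    (hψ : ContDiffAt ℝ ∞ ψ q) (v w : V) :
    extForm (fun p => (η (ψ p)).comp (fderiv ℝ ψ p)) q v w =
      extForm η (ψ q) (fderiv ℝ ψ q v) (fderiv ℝ ψ q w) := by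
  have hψd : DifferentiableAt ℝ ψ q := hψ.differentiableAt (by simp)
  have hψd2 : DifferentiableAt ℝ (fderiv ℝ ψ) q :=
    (hψ.fderiv_right (m := 1) (by norm_cast)).differentiableAt (by simp)
  have h1 : DifferentiableAt ℝ (fun p => η (ψ p)) q := hη.comp q hψd
  have h2 : ∀ v w, fderiv ℝ (fun p => (η (ψ p)).comp (fderiv ℝ ψ p)) q v w =
      η (ψ q) (fderiv ℝ (fderiv ℝ ψ) q v w) +
        fderiv ℝ η (ψ q) (fderiv ℝ ψ q v) (fderiv ℝ ψ q w) := fun v w => by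
    have h3 : fderiv ℝ (fun p => η (ψ p)) q = (fderiv ℝ η (ψ q)).comp (fderiv ℝ ψ q) :=
      fderiv_comp q hη hψd
    rw [fderiv_clm_comp h1 hψd2, h3]
    simp
  have hsymm : IsSymmSndFDerivAt ℝ ψ q := hψ.isSymmSndFDerivAt (by
    rw [minSmoothness_of_isRCLikeNormedField]
    exact WithTop.coe_le_coe.2 (le_top (a := (2 : ℕ∞))))
  rw [extForm, h2, h2, hsymm.eq v w, extForm]
  ring

theorem extForm_congr {β β' : V → V →L[ℝ] ℝ} {q : V} (h : β =ᶠ[𝓝 q] β') (v w : V) :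
    extForm β q v w = extForm β' q v w := by
  rw [extForm, extForm, h.fderiv_eq]

theorem IsSmoothChart.pullback_apply {e : OpenPartialHomeomorph M V3} (he : IsSmoothChart e)
    (α : OneForm M) {x : M} (hx : x ∈ e.source) (v : E3) :
    α.pullback e.symm (e x) ((mfderiv (𝓡 3) 𝓘(ℝ, V3) e x : E3 →L[ℝ] V3) v) =
      (α x : E3 →L[ℝ] ℝ) v := by
  have h1 : MDifferentiableAt 𝓘(ℝ, V3) (𝓡 3) e.symm (e x) :=
    (he.smooth_symm.contMDiffAt (e.open_target.mem_nhds (e.map_source hx))).mdifferentiableAt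
      (by simp)
  have h2 : MDifferentiableAt (𝓡 3) 𝓘(ℝ, V3) e x :=
    (he.smooth.contMDiffAt (e.open_source.mem_nhds hx)).mdifferentiableAt (by simp)
  have h3 := mfderiv_comp (g := e.symm) (f := e) x h1 h2
  have h4 : (e.symm : V3 → M) ∘ e =ᶠ[𝓝 x] id := by
    filter_upwards [e.open_source.mem_nhds hx] with p hp using e.left_inv hp
  rw [h4.mfderiv_eq, mfderiv_id] at h3
  have h5 : (mfderiv 𝓘(ℝ, V3) (𝓡 3) e.symm (e x) : V3 →L[ℝ] E3)
      ((mfderiv (𝓡 3) 𝓘(ℝ, V3) e x : E3 →L[ℝ] V3) v) = v := (DFunLike.congr_fun h3 v).symm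
  have h6 : ∀ y, y = x → (α y : E3 →L[ℝ] ℝ) = (α x : E3 →L[ℝ] ℝ) := by rintro y rfl; rfl
  exact (congrArg _ h5).trans (DFunLike.congr_fun (h6 (e.symm (e x)) (e.left_inv hx)) v)

/-- The contact condition, read in an arbitrary smooth chart. -/
theorem IsSmoothChart.exists_wedge_ne_zero {e : OpenPartialHomeomorph M V3}
    (he : IsSmoothChart e) {α : OneForm M} (hα : α.IsContact) {x : M} (hx : x ∈ e.source) :
    ∃ u v w : V3, α.pullback e.symm (e x) u * extForm (α.pullback e.symm) (e x) v w +
      α.pullback e.symm (e x) v * extForm (α.pullback e.symm) (e x) w u +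
      α.pullback e.symm (e x) w * extForm (α.pullback e.symm) (e x) u v ≠ 0 := by
  obtain ⟨u, v, w, h⟩ : ∃ u v w : E3, α.wedgeD x u v w ≠ 0 := hα x
  set D : E3 →L[ℝ] V3 := mfderiv (𝓡 3) 𝓘(ℝ, V3) e x with hD
  refine ⟨D u, D v, D w, ?_⟩
  set ι := extChartAt (𝓡 3) x with hι
  have hιs : IsOpen ι.target := isOpen_extChartAt_target x
  have hιsm : ContMDiffOn 𝓘(ℝ, E3) (𝓡 3) ∞ ι.symm ι.target := contMDiffOn_extChartAt_symm x
  have hηs : ContDiffOn ℝ ∞ (α.inChart x) ι.target := by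
    rw [OneForm.inChart_eq_pullback]
    exact α.contDiffOn_pullback hιs hιsm
  have hηd : DifferentiableAt ℝ (α.inChart x) (ι x) :=
    (hηs.contDiffAt (hιs.mem_nhds (mem_extChartAt_target x))).differentiableAt (by simp)
  have hιx : ∀ y ∈ ι.source, ContMDiffAt (𝓡 3) 𝓘(ℝ, E3) ∞ ι y := fun y hy =>
    contMDiffAt_extChartAt' (by rwa [hι, extChartAt_source] at hy)
  have hsrc : IsOpen ι.source := isOpen_extChartAt_source x
  have hxι : x ∈ ι.source := mem_extChartAt_source x
  have hex : e.symm (e x) = x := e.left_inv hx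
  -- The transition map to the preferred chart, in which the contact condition is defined; the
  -- exterior derivatives are compared by naturality under ψ.
  let ψ : V3 → E3 := fun q => ι (e.symm q)
  have hψx : ψ (e x) = ι x := congrArg ι hex
  have hO : IsOpen (e.target ∩ e.symm ⁻¹' ι.source) := e.isOpen_inter_preimage_symm hsrc
  have hexO : e x ∈ e.target ∩ e.symm ⁻¹' ι.source :=
    ⟨e.map_source hx, by rw [Set.mem_preimage, hex]; exact hxι⟩
  have hesm : ∀ q ∈ e.target, ContMDiffAt 𝓘(ℝ, V3) (𝓡 3) ∞ e.symm q := fun q hq =>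
    he.smooth_symm.contMDiffAt (e.open_target.mem_nhds hq)
  have hψ : ∀ q ∈ e.target ∩ e.symm ⁻¹' ι.source, ContDiffAt ℝ ∞ ψ q := fun q hq =>
    ((hιx _ hq.2).comp q (hesm q hq.1)).contDiffAt
  have hpull : α.pullback e.symm =ᶠ[𝓝 (e x)]
      fun q => (α.inChart x (ψ q)).comp (fderiv ℝ ψ q) := by
    filter_upwards [hO.mem_nhds hexO] with q hq
    have hψq : ψ q ∈ ι.target := ι.map_source hq.2
    have h1 := α.pullback_comp (f := ι.symm) (c := ψ) (q := q)
      ((hιsm.contMDiffAt (hιs.mem_nhds hψq)).mdifferentiableAt (by simp))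
      ((hψ q hq).differentiableAt (by simp))
    rw [← OneForm.inChart_eq_pullback] at h1
    rw [← h1]
    have h2 : (e.symm : V3 → M) =ᶠ[𝓝 q] fun p => ι.symm (ψ p) := by
      filter_upwards [hO.mem_nhds hq] with p hp
      exact (ι.left_inv hp.2).symm
    have h3 : (mfderiv 𝓘(ℝ, V3) (𝓡 3) e.symm q : V3 →L[ℝ] E3) =
      mfderiv 𝓘(ℝ, V3) (𝓡 3) (fun p => ι.symm (ψ p)) q := h2.mfderiv_eq
    have h4 : ∀ y, y = e.symm q → (α y : E3 →L[ℝ] ℝ) = (α (e.symm q) : E3 →L[ℝ] ℝ) := by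
      rintro y rfl; rfl
    exact congrArg₂ ContinuousLinearMap.comp (h4 _ h2.eq_of_nhds.symm).symm h3
  have hDψ : ∀ u : E3, fderiv ℝ ψ (e x) (D u) =
      (mfderiv (𝓡 3) 𝓘(ℝ, E3) ι x : E3 →L[ℝ] E3) u := fun u => by
    have h1 := mfderiv_comp (g := ψ) (f := e) x
      ((hψ _ hexO).differentiableAt (by simp)).mdifferentiableAt
      ((he.smooth.contMDiffAt (e.open_source.mem_nhds hx)).mdifferentiableAt (by simp))
    have h2 : ψ ∘ e =ᶠ[𝓝 x] ι := by
      filter_upwards [e.open_source.mem_nhds hx] with y hy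
      exact congrArg ι (e.left_inv hy)
    rw [h2.mfderiv_eq, mfderiv_eq_fderiv] at h1
    exact (DFunLike.congr_fun h1 u).symm
  have hext : ∀ v w : E3, extForm (α.pullback e.symm) (e x) (D v) (D w) = α.d x ![v, w] :=
    fun v w => by
    have hηd' : DifferentiableAt ℝ (α.inChart x) (ψ (e x)) := by rw [hψx]; exact hηd
    rw [extForm_congr hpull, extForm_comp hηd' (hψ _ hexO), hDψ, hDψ, hψx]
    exact (extDeriv_ofSubsingleton hηd
      (fun i => (mfderiv (𝓡 3) 𝓘(ℝ, E3) ι x : E3 →L[ℝ] E3) (![v, w] i))).symm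
  have hval : ∀ v : E3, α.pullback e.symm (e x) (D v) = (α x : E3 →L[ℝ] ℝ) v :=
    fun v => he.pullback_apply α hx v
  rw [hval, hval, hval, hext, hext, hext]
  exact h

end Pullback

/-! ### Darboux charts along a Legendrian curve. -/

section Darboux

variable {M : Type*} [TopologicalSpace M] [ChartedSpace E3 M] [IsManifold (𝓡 3) ∞ M]

/-- A chart centred at `p` in which the Legendrian `K` is the axis. -/
structure IsLegendrianChart (α : OneForm M) (K : Set M) (e : OpenPartialHomeomorph M V3)
    (p : M) : Prop where
  smooth : IsSmoothChart e
  mem : p ∈ e.source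
  zero : e p = 0
  axis : ∀ x ∈ e.source, x ∈ K ↔ (e x).2 = 0
  tangent : ∀ t, (t, 0, 0) ∈ e.target → α.pullback e.symm (t, 0, 0) (1, 0, 0) = 0

/-- A linear form on `ℝ³` in coordinates. -/
theorem clm_apply_eq (L : V3 →L[ℝ] ℝ) (v : V3) :
    L v = v.1 * L (1, 0, 0) + v.2.1 * L (0, 1, 0) + v.2.2 * L (0, 0, 1) := by
  have hv : v = v.1 • ((1, 0, 0) : V3) + v.2.1 • ((0, 1, 0) : V3) + v.2.2 • ((0, 0, 1) : V3) := by
    ext <;> simp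
  conv_lhs => rw [hv]
  simp only [map_add, map_smul, smul_eq_mul]

variable {α : OneForm M} {K : Set M} {e : OpenPartialHomeomorph M V3} {p : M}

/-- Change of coordinates in a Legendrian chart. -/
theorem IsLegendrianChart.trans_symm (he : IsLegendrianChart α K e p)
    {c : OpenPartialHomeomorph V3 V3} (hc : ContDiffOn ℝ ∞ c c.source)
    (hc' : ContDiffOn ℝ ∞ c.symm c.target) (hc0 : (0 : V3) ∈ c.source)
    (hcx : ∀ t, (t, 0, 0) ∈ c.source → c (t, 0, 0) = (t, 0, 0))
    (hcaxis : ∀ q ∈ c.source, (c q).2 = 0 → q.2 = 0) :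
    IsLegendrianChart α K (e.trans c.symm) p ∧ ∀ q ∈ (e.trans c.symm).target,
      q ∈ c.source ∧ c q ∈ e.target ∧
      α.pullback (e.trans c.symm).symm q = (α.pullback e.symm (c q)).comp (fderiv ℝ c q) := by
  have hc00 : c 0 = 0 := hcx 0 hc0
  have hs := he.smooth.trans_symm hc hc'
  have hpull : ∀ q ∈ (e.trans c.symm).target, q ∈ c.source ∧ c q ∈ e.target ∧
      α.pullback (e.trans c.symm).symm q = (α.pullback e.symm (c q)).comp (fderiv ℝ c q) := by
    intro q hq
    have hq1 : q ∈ c.source := hq.1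
    have hq2 : c q ∈ e.target := hq.2
    exact ⟨hq1, hq2, α.pullback_comp (f := e.symm) (c := c)
      ((he.smooth.smooth_symm.contMDiffAt (e.open_target.mem_nhds hq2)).mdifferentiableAt (by simp))
      ((hc.contDiffAt (c.open_source.mem_nhds hq1)).differentiableAt (by simp))⟩
  refine ⟨⟨hs, ⟨he.mem, ?_⟩, ?_, fun x hx => ?_, fun t ht => ?_⟩, hpull⟩
  · change e p ∈ c.target
    rw [he.zero, ← hc00]
    exact c.map_source hc0
  · change c.symm (e p) = 0
    rw [he.zero]
    conv_lhs => rw [← hc00]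
    exact c.left_inv hc0
  · rw [he.axis x hx.1]
    have hq : c.symm (e x) ∈ c.source := c.map_target hx.2
    have hcq : c (c.symm (e x)) = e x := c.right_inv hx.2
    change _ ↔ (c.symm (e x)).2 = 0
    refine ⟨fun h => hcaxis _ hq (by rw [hcq]; exact h), fun h => ?_⟩
    rw [← hcq, eq_of_snd_eq_zero h, hcx _ (by rw [← eq_of_snd_eq_zero h]; exact hq)]
    rfl
  · obtain ⟨h1, h2, h3⟩ := hpull _ ht
    have hline : HasDerivAt (fun t : ℝ => ((t, 0, 0) : V3)) (1, 0, 0) t :=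
      (hasDerivAt_id t).prodMk (hasDerivAt_const t (0 : ℝ × ℝ))
    have hd : HasFDerivAt c (fderiv ℝ c (t, 0, 0)) (t, 0, 0) :=
      ((hc.contDiffAt (c.open_source.mem_nhds h1)).differentiableAt (by simp)).hasFDerivAt
    have h4 := HasFDerivAt.comp_hasDerivAt (l := c) t hd hline
    have h5 : fderiv ℝ c (t, 0, 0) (1, 0, 0) = (1, 0, 0) := by
      refine h4.unique (hline.congr_of_eventuallyEq ?_)
      filter_upwards [hline.continuousAt.eventually_mem (c.open_source.mem_nhds h1)] with s hs
        using hcx s hs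
    rw [h3, ContinuousLinearMap.comp_apply, h5, hcx t h1]
    rw [hcx t h1] at h2
    exact he.tangent t h2

/-- L is nonzero on ∂_y or ∂_z. A swap and a sign in the last two coordinates make it positive on
∂_z without moving the x-axis. -/
theorem exists_linear_pos (L : V3 →L[ℝ] ℝ) (hL : L ≠ 0) (hL1 : L (1, 0, 0) = 0) :
    ∃ R : (ℝ × ℝ) ≃L[ℝ] (ℝ × ℝ), 0 < L (0, R (0, 1)) := by
  rcases lt_trichotomy (L (0, 0, 1)) 0 with h | h | h
  · refine ⟨ContinuousLinearEquiv.neg ℝ, ?_⟩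
    have h1 : ((0, (ContinuousLinearEquiv.neg ℝ : (ℝ × ℝ) ≃L[ℝ] (ℝ × ℝ)) (0, 1)) : V3) =
      -(0, 0, 1) := by ext <;> simp
    rw [h1, map_neg]
    linarith
  · rcases lt_trichotomy (L (0, 1, 0)) 0 with h' | h' | h'
    · refine ⟨(ContinuousLinearEquiv.prodComm ℝ ℝ ℝ).trans (ContinuousLinearEquiv.neg ℝ), ?_⟩
      have h1 : ((0, ((ContinuousLinearEquiv.prodComm ℝ ℝ ℝ).trans
        (ContinuousLinearEquiv.neg ℝ)) (0, 1)) : V3) = -(0, 1, 0) := by ext <;> simp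
      rw [h1, map_neg]
      linarith
    · refine absurd ?_ hL
      refine ContinuousLinearMap.ext fun v => ?_
      rw [clm_apply_eq, hL1, h, h']
      simp
    · exact ⟨ContinuousLinearEquiv.prodComm ℝ ℝ ℝ, h'⟩
  · exact ⟨ContinuousLinearEquiv.refl ℝ _, h⟩

/-- A contact form does not vanish at p, since α ∧ dα would vanish with it, while tangency of K
kills the first component. -/
theorem IsLegendrianChart.exists_pos (he : IsLegendrianChart α K e p) (hα : α.IsContact) :
    ∃ e', IsLegendrianChart α K e' p ∧ 0 < α.pullback e'.symm 0 (0, 0, 1) := by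
  have h0 : (0 : V3) ∈ e.target := he.zero ▸ e.map_source he.mem
  obtain ⟨R, hR⟩ := exists_linear_pos (α.pullback e.symm 0) (by
    intro h
    obtain ⟨u, v, w, huvw⟩ := he.smooth.exists_wedge_ne_zero hα he.mem
    rw [he.zero, h] at huvw
    simp at huvw) (he.tangent 0 h0)
  let R' : V3 ≃L[ℝ] V3 := (ContinuousLinearEquiv.refl ℝ ℝ).prodCongr R
  have hR' : ∀ q, R' q = (q.1, R q.2) := fun q => rfl
  obtain ⟨h1, h2⟩ := he.trans_symm (c := R'.toHomeomorph.toOpenPartialHomeomorph)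
    R'.contDiff.contDiffOn R'.symm.contDiff.contDiffOn (Set.mem_univ _)
    (fun t _ => (hR' (t, 0, 0)).trans (Prod.ext rfl (map_zero R)))
    (fun q _ hq => R.map_eq_zero_iff.1 hq)
  refine ⟨_, h1, ?_⟩
  obtain ⟨-, -, h3⟩ := h2 0 (h1.zero ▸ OpenPartialHomeomorph.map_source _ h1.mem)
  rw [h3, ContinuousLinearMap.comp_apply]
  have h4 : fderiv ℝ (R'.toHomeomorph.toOpenPartialHomeomorph : V3 → V3) 0 = R' :=
    R'.hasFDerivAt.fderiv
  have h5 : (R'.toHomeomorph.toOpenPartialHomeomorph : V3 → V3) 0 = 0 := map_zero R'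
  rw [h4, h5]
  exact hR

/-- The coordinates can be chosen so that the contact form has no component along the second
coordinate. -/
theorem IsLegendrianChart.exists_normalized (he : IsLegendrianChart α K e p)
    (hpos : 0 < α.pullback e.symm 0 (0, 0, 1)) :
    ∃ e', IsLegendrianChart α K e' p ∧ ∀ q ∈ e'.target,
      α.pullback e'.symm q (0, 1, 0) = 0 ∧ 0 < α.pullback e'.symm q (0, 0, 1) := by
  have h0 : (0 : V3) ∈ e.target := he.zero ▸ e.map_source he.mem
  set β := α.pullback e.symm with hβ
  have hβs : ContDiffOn ℝ ∞ β e.target := α.contDiffOn_pullback e.open_target he.smooth.smooth_symm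
  have hβv : ∀ v, ContDiffOn ℝ ∞ (fun q => β q v) e.target := fun v =>
    hβs.clm_apply contDiffOn_const
  set T := e.target ∩ (fun q => β q (0, 0, 1)) ⁻¹' Set.Ioi 0 with hT
  have hTo : IsOpen T := (hβv _).continuousOn.isOpen_inter_preimage e.open_target isOpen_Ioi
  have h0T : (0 : V3) ∈ T := ⟨h0, hpos⟩
  obtain ⟨C, χ, hC, hCT, hχ, hχ1, hχ0⟩ := exists_bump (isCompact_singleton (x := (0 : V3))) hTo
    (Set.singleton_subset_iff.2 h0T)
  -- The slope for which β (0, 1, F) = 0, cut off so as to be smooth on all of ℝ³ as the ODE lemma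
  -- requires; only the region with χ = 1 is used.
  let F : V3 → ℝ := fun q => χ q * (-(β q (0, 1, 0)) / β q (0, 0, 1))
  have hF : ContDiff ℝ ∞ F := by
    rw [contDiff_iff_contDiffAt]
    intro q
    by_cases hq : q ∈ C
    · have hqT := hTo.mem_nhds (hCT hq)
      have h1 : ContDiffOn ℝ ∞ F T := hχ.contDiffOn.mul
        (((hβv _).mono Set.inter_subset_left).neg.div ((hβv _).mono Set.inter_subset_left)
          (fun q hq => (ne_of_gt hq.2)))
      exact h1.contDiffAt hqT
    · refine (contDiffAt_const (c := (0 : ℝ))).congr_of_eventuallyEq ?_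
      filter_upwards [hC.isClosed.isOpen_compl.mem_nhds hq] with y hy
      simp [F, hχ0 y hy]
  obtain ⟨S, P, hS, h0S, hP, hP0, hPF⟩ := exists_smooth_ode_solution ⟨F, hF.continuous⟩ hF
  have hPd : ∀ q ∈ S, HasFDerivAt P (fderiv ℝ P q) q := fun q hq =>
    ((hP.contDiffAt (hS.mem_nhds hq)).differentiableAt (by simp)).hasFDerivAt
  -- The new second coordinate curves are the solution curves issuing from (x, 0, c), on which β
  -- vanishes. The axis is fixed because the slice where the second coordinate is 0 is pointwise
  -- fixed.
  let Ψ : V3 → V3 := fun q => (q.1, q.2.1, P q)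
  have hΨs : ContDiffOn ℝ ∞ Ψ S :=
    contDiffOn_fst.prodMk ((by fun_prop : ContDiffOn ℝ ∞ (fun q : V3 => q.2.1) S).prodMk hP)
  have hΨd : ∀ q ∈ S, HasFDerivAt Ψ ((ContinuousLinearMap.fst ℝ ℝ (ℝ × ℝ)).prod
      (((ContinuousLinearMap.fst ℝ ℝ ℝ).comp (ContinuousLinearMap.snd ℝ ℝ (ℝ × ℝ))).prod
        (fderiv ℝ P q))) q := fun q hq =>
    hasFDerivAt_fst.prodMk (((ContinuousLinearMap.fst ℝ ℝ ℝ).comp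
      (ContinuousLinearMap.snd ℝ ℝ (ℝ × ℝ))).hasFDerivAt.prodMk (hPd q hq))
  have hΨ0 : Ψ 0 = 0 := Prod.ext rfl (Prod.ext rfl (hP0 0 0 h0S))
  have hPc : fderiv ℝ P 0 (0, 0, 1) = 1 := by
    have hline : HasDerivAt (fun t : ℝ => ((0, 0, t) : V3)) (0, 0, 1) 0 :=
      (hasDerivAt_const 0 (0 : ℝ)).prodMk ((hasDerivAt_const 0 (0 : ℝ)).prodMk (hasDerivAt_id 0))
    have h1 := HasFDerivAt.comp_hasDerivAt (l := P) 0 (hPd 0 h0S) hline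
    refine h1.unique ((hasDerivAt_id (0 : ℝ)).congr_of_eventuallyEq ?_)
    filter_upwards [hline.continuousAt.eventually_mem (hS.mem_nhds h0S)] with t ht
      using hP0 0 t ht
  obtain ⟨U, hU1, hUo, h0U⟩ : ∃ U : Set V3, (∀ q ∈ U, q ∈ T ∧ χ q = 1) ∧ IsOpen U ∧ 0 ∈ U := by
    rw [nhdsSet_singleton] at hχ1
    obtain ⟨U, hU, hUo, hU0⟩ := eventually_nhds_iff.1 (hχ1.and (hTo.mem_nhds h0T))
    exact ⟨U, fun q hq => (hU q hq).symm, hUo, hU0⟩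
  set S₁ := (S ∩ Ψ ⁻¹' U) ∩ (S ∩ (fun q => fderiv ℝ P q (0, 0, 1)) ⁻¹' Set.Ioi 0) with hS₁
  have hS₁o : IsOpen S₁ := (hΨs.continuousOn.isOpen_inter_preimage hS hUo).inter
    ((contDiffOn_fderiv_apply hS hP _).continuousOn.isOpen_inter_preimage hS isOpen_Ioi)
  have h0S₁ : (0 : V3) ∈ S₁ := ⟨⟨h0S, by rw [Set.mem_preimage, hΨ0]; exact h0U⟩, h0S, by
    rw [Set.mem_preimage, hPc]; exact one_pos (α := ℝ)⟩
  have hS₁S : S₁ ⊆ S := fun q hq => hq.1.1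
  obtain ⟨A, hA⟩ := exists_equiv_of_injective _ (fun v
      (hv : ((ContinuousLinearMap.fst ℝ ℝ (ℝ × ℝ)).prod (((ContinuousLinearMap.fst ℝ ℝ ℝ).comp (ContinuousLinearMap.snd ℝ ℝ (ℝ × ℝ))).prod
        (fderiv ℝ P 0))) v = 0) => by
    have h1 : v.1 = 0 := congrArg Prod.fst hv
    have h2 : v.2.1 = 0 := congrArg (fun q => q.2.1) hv
    have h3 : fderiv ℝ P 0 v = 0 := congrArg (fun q => q.2.2) hv
    rw [clm_apply_eq, h1, h2, hPc] at h3
    exact Prod.ext h1 (Prod.ext h2 (by simpa using h3)))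
  have hΨA := hΨd 0 h0S
  rw [← hA] at hΨA
  obtain ⟨c, hc0, hcS, hcΨ, hcs⟩ := exists_openPartialHomeomorph_of_hasFDerivAt hS₁o
    (hΨs.mono hS₁S) h0S₁ hΨA
  have hcfun : (c : V3 → V3) = Ψ := funext hcΨ
  obtain ⟨h1, h2⟩ := he.trans_symm (c := c) (by rw [hcfun]; exact hΨs.mono (hcS.trans hS₁S)) hcs hc0
    (fun t ht => by
      rw [hcΨ]
      exact Prod.ext rfl (Prod.ext rfl (hP0 t 0 (hS₁S (hcS ht)))))
    (fun q hq hq0 => by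
      rw [hcΨ] at hq0
      have h3 : q.2.1 = 0 := congrArg Prod.fst hq0
      have h4 : P q = 0 := congrArg Prod.snd hq0
      have h5 : q = (q.1, 0, q.2.2) := Prod.ext rfl (Prod.ext h3 rfl)
      have h6 := hP0 q.1 q.2.2 (by rw [← h5]; exact hS₁S (hcS hq))
      rw [← h5, h4] at h6
      exact Prod.ext h3 h6.symm)
  refine ⟨_, h1, fun q hq => ?_⟩
  obtain ⟨h3, -, h5⟩ := h2 q hq
  have hqS := hcS h3
  obtain ⟨⟨-, h6⟩, h7⟩ := hU1 _ hqS.1.2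
  have h8 : 0 < β (Ψ q) (0, 0, 1) := h6
  rw [h5, hcfun, (hΨd q (hS₁S hqS)).fderiv]
  constructor
  · change β (Ψ q) (0, 1, fderiv ℝ P q (0, 1, 0)) = 0
    rw [clm_apply_eq, hPF q (hS₁S hqS)]
    change 0 * _ + 1 * _ + F (Ψ q) * _ = 0
    simp only [F, h7]
    field_simp
    ring
  · change 0 < β (Ψ q) (0, 0, fderiv ℝ P q (0, 0, 1))
    rw [clm_apply_eq]
    have h9 : 0 < fderiv ℝ P q (0, 0, 1) := hqS.2.2
    simp only [zero_mul, zero_add]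
    positivity

/-- If `β = a dx + b dz` along with `a = 0`, `b ≠ 0` at `q` is a contact form at `q`, then the
derivative of `a` in the second coordinate does not vanish. -/
theorem fderiv_ne_zero_of_wedge_ne_zero {β : V3 → V3 →L[ℝ] ℝ} {q : V3}
    (hβ : DifferentiableAt ℝ β q) (h1 : β q (1, 0, 0) = 0)
    (h2 : ∀ᶠ y in 𝓝 q, β y (0, 1, 0) = 0)
    (hw : ∃ u v w, β q u * extForm β q v w + β q v * extForm β q w u +
      β q w * extForm β q u v ≠ 0) : fderiv ℝ β q (0, 1, 0) (1, 0, 0) ≠ 0 := by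
  -- At q the form is b dz, so β ∧ dβ only sees the dx ∧ dy coefficient of dβ. This is minus the
  -- derivative of a in the second coordinate, as β has no second component near q.
  intro h0
  obtain ⟨u, v, w, h⟩ := hw
  have h3 : ∀ x, fderiv ℝ β q x (0, 1, 0) = 0 := fun x => by
    have h4 : fderiv ℝ (fun y => β y (0, 1, 0)) q x = fderiv ℝ β q x (0, 1, 0) := by
      rw [fderiv_clm_apply hβ (differentiableAt_const _)]
      simp
    have h5 : (fun y => β y (0, 1, 0)) =ᶠ[𝓝 q] fun _ => (0 : ℝ) := h2
    rw [← h4, h5.fderiv_eq]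
    simp
  have h6 : ∀ x y, fderiv ℝ β q x y = y.1 * (x.1 * fderiv ℝ β q (1, 0, 0) (1, 0, 0) +
      x.2.2 * fderiv ℝ β q (0, 0, 1) (1, 0, 0)) +
      y.2.2 * fderiv ℝ β q x (0, 0, 1) := fun x y => by
    have h7 := clm_apply_eq ((fderiv ℝ β q).flip (1, 0, 0)) x
    simp only [ContinuousLinearMap.flip_apply, h0] at h7
    rw [clm_apply_eq (fderiv ℝ β q x) y, h3, h7]
    ring
  have h8 : ∀ x, β q x = x.2.2 * β q (0, 0, 1) := fun x => by
    rw [clm_apply_eq, h1, h2.self_of_nhds]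
    ring
  refine h ?_
  simp only [extForm]
  rw [h6 v w, h6 w v, h6 w u, h6 u w, h6 u v, h6 v u, h8 u, h8 v, h8 w]
  ring

/-- A Legendrian chart can be improved to a Darboux chart. -/
theorem IsLegendrianChart.exists_isDarbouxChart (he : IsLegendrianChart α K e p)
    (hα : α.IsContact) {ξ : CoorientedContactStructure M}
    (hξ : ∀ (x : M) (v : TangentSpace (𝓡 3) x),
      (v ∈ ξ.plane x ↔ (α x v : ℝ) = 0) ∧ (v ∈ ξ.pos x ↔ 0 < (α x v : ℝ))) :
    ∃ e', IsDarbouxChart ξ K e' ∧ p ∈ e'.source := by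
  obtain ⟨e₁, he₁, hpos₁⟩ := he.exists_pos hα
  obtain ⟨e, he, hnorm⟩ := he₁.exists_normalized hpos₁
  have h0 : (0 : V3) ∈ e.target := he.zero ▸ e.map_source he.mem
  set β := α.pullback e.symm with hβ
  have hβs : ContDiffOn ℝ ∞ β e.target := α.contDiffOn_pullback e.open_target he.smooth.smooth_symm
  have hβd : DifferentiableAt ℝ β 0 :=
    (hβs.contDiffAt (e.open_target.mem_nhds h0)).differentiableAt (by simp)
  have hβv : ∀ v, ContDiffOn ℝ ∞ (fun q => β q v) e.target := fun v =>
    hβs.clm_apply contDiffOn_const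
  -- With no second component left, β = b (dz - y dx) where b > 0. Replacing the second coordinate
  -- by y gives the standard form up to the factor b.
  let y : V3 → ℝ := fun q => -(β q (1, 0, 0)) / β q (0, 0, 1)
  have hys : ContDiffOn ℝ ∞ y e.target := (hβv _).neg.div (hβv _) fun q hq => (hnorm q hq).2.ne'
  have hyd : ∀ q ∈ e.target, HasFDerivAt y (fderiv ℝ y q) q := fun q hq =>
    ((hys.contDiffAt (e.open_target.mem_nhds hq)).differentiableAt (by simp)).hasFDerivAt
  have hyt : ∀ t, (t, 0, 0) ∈ e.target → y (t, 0, 0) = 0 := fun t ht => by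
    simp only [y]
    rw [he.tangent t ht]
    simp
  have hyw : fderiv ℝ y 0 (0, 1, 0) ≠ 0 := by
    have h1 := fderiv_ne_zero_of_wedge_ne_zero hβd (he.tangent 0 h0)
      (by filter_upwards [e.open_target.mem_nhds h0] with q hq using (hnorm q hq).1)
      (by simpa only [he.zero] using he.smooth.exists_wedge_ne_zero hα he.mem)
    intro h2
    refine h1 ?_
    have hd : ∀ v, HasFDerivAt (fun q => β q v) ((fderiv ℝ β 0).flip v) 0 := fun v => by
      have := hβd.hasFDerivAt.clm_apply (hasFDerivAt_const v (0 : V3))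
      simpa using this
    have h3 := (hyd 0 h0).mul (hd (0, 0, 1))
    have h4 : (fun q => y q * β q (0, 0, 1)) =ᶠ[𝓝 0] fun q => -(β q (1, 0, 0)) := by
      filter_upwards [e.open_target.mem_nhds h0] with q hq
      exact div_mul_cancel₀ _ (hnorm q hq).2.ne'
    have h5 := h3.unique ((hd (1, 0, 0)).neg.congr_of_eventuallyEq h4)
    have h6 := DFunLike.congr_fun h5 (0, 1, 0)
    have h7 : y 0 = 0 := hyt 0 h0
    simpa [h7, h2] using h6.symm
  let Θ : V3 → V3 := fun q => (q.1, y q, q.2.2)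
  have hΘs : ContDiffOn ℝ ∞ Θ e.target :=
    contDiffOn_fst.prodMk (hys.prodMk (by fun_prop : ContDiffOn ℝ ∞ (fun q : V3 => q.2.2) e.target))
  have hΘd : ∀ q ∈ e.target, HasFDerivAt Θ ((ContinuousLinearMap.fst ℝ ℝ (ℝ × ℝ)).prod
      ((fderiv ℝ y q).prod
        ((ContinuousLinearMap.snd ℝ ℝ ℝ).comp (ContinuousLinearMap.snd ℝ ℝ (ℝ × ℝ))))) q :=
    fun q hq => hasFDerivAt_fst.prodMk ((hyd q hq).prodMk ((ContinuousLinearMap.snd ℝ ℝ ℝ).comp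
      (ContinuousLinearMap.snd ℝ ℝ (ℝ × ℝ))).hasFDerivAt)
  have hΘt : ∀ t, (t, 0, 0) ∈ e.target → Θ (t, 0, 0) = (t, 0, 0) := fun t ht =>
    Prod.ext rfl (Prod.ext (hyt t ht) rfl)
  obtain ⟨A, hA⟩ := exists_equiv_of_injective _ (fun v
      (hv : ((ContinuousLinearMap.fst ℝ ℝ (ℝ × ℝ)).prod ((fderiv ℝ y 0).prod
        ((ContinuousLinearMap.snd ℝ ℝ ℝ).comp (ContinuousLinearMap.snd ℝ ℝ (ℝ × ℝ))))) v = 0) => by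
    have h1 : v.1 = 0 := congrArg Prod.fst hv
    have h2 : fderiv ℝ y 0 v = 0 := congrArg (fun q => q.2.1) hv
    have h3 : v.2.2 = 0 := congrArg (fun q => q.2.2) hv
    rw [clm_apply_eq, h1, h3] at h2
    exact Prod.ext h1 (Prod.ext (by simpa [hyw] using h2) h3))
  have hΘA := hΘd 0 h0
  rw [← hA] at hΘA
  obtain ⟨c, hc0, hcS, hcΘ, hcs⟩ := exists_openPartialHomeomorph_of_hasFDerivAt e.open_target
    hΘs h0 hΘA
  have hcfun : (c : V3 → V3) = Θ := funext hcΘ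
  -- The domain must contain the axis projection of each of its points. A point with y = z = 0 has
  -- the same image under `Θ` as its projection, so injectivity puts it on the axis.
  have hOo : IsOpen ((fun q : V3 => ((q.1, 0, 0) : V3)) ⁻¹' c.source) :=
    c.open_source.preimage (by fun_prop)
  set c' := c.restrOpen _ hOo with hc'
  have hc's : ∀ q ∈ c'.source, q ∈ c.source ∧ ((q.1, 0, 0) : V3) ∈ c.source := fun q hq => hq
  have hc'fun : (c' : V3 → V3) = Θ := hcfun
  have hsm : IsSmoothChart (e.trans c') := by
    refine he.smooth.trans_symm (c := c'.symm) (hcs.mono fun q hq => ?_) ?_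
    · exact hq.1
    · rw [OpenPartialHomeomorph.symm_symm, hc'fun]
      exact hΘs.mono fun q hq => hcS (hc's q hq).1
  refine ⟨e.trans c', ⟨hsm, fun x hx v => ?_, fun x hx => ?_⟩, he.mem, ?_⟩
  · have hxe : x ∈ e.source := hx.1
    have hxt : e x ∈ e.target := e.map_source hxe
    have h1 := mfderiv_comp (g := Θ) (f := e) x (hΘd _ hxt).differentiableAt.mdifferentiableAt
      ((he.smooth.smooth.contMDiffAt (e.open_source.mem_nhds hxe)).mdifferentiableAt (by simp))
    rw [mfderiv_eq_fderiv, (hΘd _ hxt).fderiv] at h1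
    have h2 : ((e.trans c' : OpenPartialHomeomorph M V3) : M → V3) = Θ ∘ e := by
      rw [OpenPartialHomeomorph.coe_trans, hc'fun]
    set D : E3 →L[ℝ] V3 := mfderiv (𝓡 3) 𝓘(ℝ, V3) e x with hD
    have h3 : stdForm ((e.trans c') x) ((mfderiv (𝓡 3) 𝓘(ℝ, V3) (e.trans c') x : E3 →L[ℝ] V3) v) =
        (D v).2.2 - y (e x) * (D v).1 := by
      rw [h2]
      exact (congrArg (stdForm (Θ (e x))) (DFunLike.congr_fun h1 v) :)
    have h4 : (α x : E3 →L[ℝ] ℝ) v = β (e x) (0, 0, 1) * ((D v).2.2 - y (e x) * (D v).1) := by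
      refine (he.smooth.pullback_apply α hxe v).symm.trans ?_
      change β (e x) (D v) = β (e x) (0, 0, 1) *
        ((D v).2.2 - -(β (e x) (1, 0, 0)) / β (e x) (0, 0, 1) * (D v).1)
      have h5 := (hnorm _ hxt).2.ne'
      rw [clm_apply_eq, (hnorm _ hxt).1]
      field_simp
      ring
    have h6 := (hnorm _ hxt).2
    have h7 := hξ x v
    refine ⟨h7.1.trans ?_, h7.2.trans ?_⟩
    · refine (Iff.of_eq (congrArg (· = 0) h4)).trans
        (Iff.trans ?_ (Iff.of_eq (congrArg (· = 0) h3)).symm)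
      simp [h6.ne']
    · refine (Iff.of_eq (congrArg (0 < ·) h4)).trans
        (Iff.trans ?_ (Iff.of_eq (congrArg (0 < ·) h3)).symm)
      exact mul_pos_iff_of_pos_left h6
  · obtain ⟨h1, h2⟩ := hc's (e x) hx.2
    rw [he.axis x hx.1]
    change _ ↔ (c (e x)).2 = 0
    rw [hcΘ]
    constructor
    · intro h3
      rw [eq_of_snd_eq_zero h3, hΘt _ (hcS h2)]
      rfl
    · intro h3
      have h4 : c (e x) = c ((e x).1, 0, 0) := by
        rw [hcΘ, hcΘ, hΘt _ (hcS h2)]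
        exact Prod.ext rfl h3
      rw [c.injOn h1 h2 h4]
      rfl
  · change e p ∈ c'.source
    rw [he.zero]
    exact ⟨hc0, hc0⟩

end Darboux

/-! ### Straightening the knot and Darboux charts along it. -/

section Straightening

variable {M : Type*} [TopologicalSpace M] [ChartedSpace E3 M]

/-- An embedded curve in a `3`-manifold can be straightened: in suitable local coordinates it is
the first coordinate axis. -/
theorem exists_straightening_chart {γ : Circle → M}
    (hγ : Manifold.IsSmoothEmbedding (𝓡 1) (𝓡 3) ∞ γ) (z : Circle) :
    ∃ e : OpenPartialHomeomorph M V3, IsSmoothChart e ∧ γ z ∈ e.source ∧ e (γ z) = 0 ∧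
      (∀ x ∈ e.source, x ∈ Set.range γ ↔ (e x).2 = 0) ∧
      ∀ t, (t, 0, 0) ∈ e.target → ∃ m : ℝ → Circle, MDifferentiableAt 𝓘(ℝ, ℝ) (𝓡 1) m t ∧
        ∀ᶠ s in 𝓝 t, e.symm (s, 0, 0) = γ (m s) := by
  obtain ⟨F, _, _, h⟩ := hγ.isImmersion.isImmersionAt z
  set d := h.domChart with hd
  set k := h.codChart with hk
  have hfinF : FiniteDimensional ℝ F := by
    have h1 : Function.Injective (h.equiv.toLinearMap ∘ₗ LinearMap.inr ℝ _ F) :=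
      h.equiv.injective.comp LinearMap.inr_injective
    exact FiniteDimensional.of_injective _ h1
  have hrank : Module.finrank ℝ F = 2 := by
    have h1 := h.equiv.toLinearEquiv.finrank_eq
    rw [Module.finrank_prod, finrank_euclideanSpace_fin, finrank_euclideanSpace_fin] at h1
    omega
  obtain ⟨i⟩ : Nonempty (EuclideanSpace ℝ (Fin 1) ≃L[ℝ] ℝ) :=
    ⟨ContinuousLinearEquiv.ofFinrankEq (by simp)⟩
  obtain ⟨j⟩ : Nonempty (F ≃L[ℝ] ℝ × ℝ) :=
    ⟨ContinuousLinearEquiv.ofFinrankEq (by simp [hrank])⟩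
  let Λ : E3 ≃L[ℝ] V3 := h.equiv.symm.trans (i.prodCongr j)
  set t₀ : ℝ := i (d z) with ht₀
  let T : E3 ≃ₜ V3 := Λ.toHomeomorph.trans (Homeomorph.addRight (-(t₀, 0, 0)))
  have hT : ∀ y, T y = Λ y + -(t₀, 0, 0) := fun y => rfl
  have hTs : ∀ q, T.symm q = Λ.symm (q + (t₀, 0, 0)) := fun q => by
    rw [Homeomorph.symm_apply_eq, hT, Λ.apply_symm_apply]
    abel
  let e₀ : OpenPartialHomeomorph M V3 := k.trans T.toOpenPartialHomeomorph
  have he₀s : e₀.source = k.source := by simp [e₀]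
  have he₀t : ∀ q ∈ e₀.target, T.symm q ∈ k.target := fun q hq => hq.2
  have hγk : ∀ w ∈ d.source, γ w ∈ e₀.source ∧ e₀ (γ w) = (i (d w) - t₀, 0, 0) := by
    intro w hw
    refine ⟨he₀s ▸ h.source_subset_preimage_source hw, ?_⟩
    have hdw : d w ∈ (d.extend (𝓡 1)).target := by
      rw [OpenPartialHomeomorph.extend_target]
      exact ⟨d.map_source hw, by simp⟩
    have h1 := h.writtenInCharts hdw
    have h2 : k (γ w) = h.equiv (d w, 0) := by
      have h3 : k (γ (d.symm (d w))) = h.equiv (d w, 0) := h1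
      rwa [d.left_inv hw] at h3
    change T (k (γ w)) = _
    rw [hT, h2]
    change (i.prodCongr j) (h.equiv.symm (h.equiv (d w, 0))) + _ = _
    rw [h.equiv.symm_apply_apply]
    ext <;> simp [sub_eq_add_neg]
  -- Since γ is a topological embedding, `U` excludes other strands of the curve. The set `B` keeps
  -- the first coordinate in the parameter domain, so conversely each axis point of the chart lies
  -- on the curve.
  obtain ⟨U, hUo, hU⟩ := hγ.isEmbedding.isOpen_iff.1 d.open_source
  let B : Set V3 := {q | i.symm (q.1 + t₀) ∈ d.target}
  have hB : IsOpen B := d.open_target.preimage (by fun_prop)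
  have hOo : IsOpen (U ∩ (e₀.source ∩ e₀ ⁻¹' B)) := hUo.inter (e₀.isOpen_inter_preimage hB)
  let e := e₀.restrOpen _ hOo
  have hes : ∀ x ∈ e.source, x ∈ e₀.source ∧ x ∈ U ∧ e₀ x ∈ B := fun x hx =>
    ⟨hx.1, hx.2.1, hx.2.2.2⟩
  have het : ∀ q ∈ e.target, q ∈ e₀.target := fun q hq => hq.1
  have hesymm : ∀ q, e.symm q = e₀.symm q := fun q => rfl
  have hlift : ∀ s, i.symm (s + t₀) ∈ d.target →
      γ (d.symm (i.symm (s + t₀))) ∈ e₀.source ∧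
        e₀ (γ (d.symm (i.symm (s + t₀)))) = (s, 0, 0) := fun s hs => by
    obtain ⟨h1, h2⟩ := hγk _ (d.map_target hs)
    refine ⟨h1, h2.trans ?_⟩
    rw [d.right_inv hs, i.apply_symm_apply, add_sub_cancel_right]
  have hsm₀ : IsSmoothChart e₀ := by
    constructor
    · have h1 : ContMDiffOn (𝓡 3) (𝓡 3) ∞ k k.source :=
        contMDiffOn_of_mem_maximalAtlas h.codChart_mem_maximalAtlas
      have h2 : ContDiff ℝ ∞ T := by
        rw [show (T : E3 → V3) = fun y => Λ y + -(t₀, 0, 0) from funext hT]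
        exact Λ.contDiff.add contDiff_const
      rw [he₀s]
      exact h2.contMDiff.comp_contMDiffOn h1
    · have h1 : ContMDiffOn (𝓡 3) (𝓡 3) ∞ k.symm k.target :=
        contMDiffOn_symm_of_mem_maximalAtlas h.codChart_mem_maximalAtlas
      have h2 : ContDiff ℝ ∞ T.symm := by
        rw [show (T.symm : V3 → E3) = fun q => Λ.symm (q + (t₀, 0, 0)) from funext hTs]
        exact Λ.symm.contDiff.comp (contDiff_id.add contDiff_const)
      exact h1.comp h2.contMDiff.contMDiffOn he₀t
  have hzd : z ∈ d.source := h.mem_domChart_source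
  obtain ⟨hz1, hz2⟩ := hγk z hzd
  have hz3 : e₀ (γ z) = 0 := hz2.trans (by rw [← ht₀, sub_self]; rfl)
  refine ⟨e, ⟨hsm₀.smooth.mono fun x hx => (hes x hx).1, hsm₀.smooth_symm.mono het⟩,
    ⟨hz1, ?_, hz1, ?_⟩, hz3, fun x hx => ?_, fun t ht => ?_⟩
  · have : z ∈ γ ⁻¹' U := hU ▸ hzd
    exact this
  · rw [Set.mem_preimage, hz3]
    change i.symm (0 + t₀) ∈ d.target
    rw [zero_add, ht₀, i.symm_apply_apply]
    exact d.map_source hzd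
  · obtain ⟨h1, h2, h3⟩ := hes x hx
    change _ ↔ (e₀ x).2 = 0
    constructor
    · rintro ⟨w, rfl⟩
      have hw : w ∈ d.source := hU ▸ h2
      rw [(hγk w hw).2]
      rfl
    · intro h4
      obtain ⟨h5, h6⟩ := hlift _ h3
      refine ⟨_, e₀.injOn h5 h1 (h6.trans ?_)⟩
      exact (eq_of_snd_eq_zero h4).symm
  · have h1 : i.symm (t + t₀) ∈ d.target := by
      have h2 := (hes _ (e.map_target ht)).2.2
      rw [hesymm, e₀.right_inv (het _ ht)] at h2
      exact h2
    refine ⟨fun s => d.symm (i.symm (s + t₀)), ?_, ?_⟩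
    · have h2 : ContMDiffOn (𝓡 1) (𝓡 1) ∞ d.symm d.target :=
        contMDiffOn_symm_of_mem_maximalAtlas h.domChart_mem_maximalAtlas
      have h3 : ContDiff ℝ ∞ fun s : ℝ => i.symm (s + t₀) :=
        i.symm.contDiff.comp (contDiff_id.add contDiff_const)
      exact ((h2.contMDiffAt (d.open_target.mem_nhds h1)).comp t
        h3.contMDiff.contMDiffAt).mdifferentiableAt (by simp)
    · have h2 : Continuous fun s : ℝ => i.symm (s + t₀) := by fun_prop
      filter_upwards [h2.continuousAt.eventually_mem (d.open_target.mem_nhds h1)] with s hs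
      obtain ⟨h3, h4⟩ := hlift s hs
      rw [hesymm, ← h4, e₀.left_inv h3]

variable [IsManifold (𝓡 3) ∞ M] {ξ : CoorientedContactStructure M} {K : Set M}

theorem CoorientedContactStructure.IsLegendrianKnot.isCompact (hK : ξ.IsLegendrianKnot K) :
    IsCompact K := by
  obtain ⟨γ, hγ, rfl, -⟩ := hK
  exact isCompact_range hγ.isEmbedding.continuous

/-- A Legendrian knot is covered by Darboux charts. -/
theorem CoorientedContactStructure.IsLegendrianKnot.exists_isDarbouxChart
    (hK : ξ.IsLegendrianKnot K) {x : M} (hx : x ∈ K) :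
    ∃ e : OpenPartialHomeomorph M V3, IsDarbouxChart ξ K e ∧ x ∈ e.source := by
  obtain ⟨γ, hγ, rfl, hγξ⟩ := hK
  obtain ⟨z, rfl⟩ := hx
  obtain ⟨α, hα, hξ⟩ := ξ.exists_form
  obtain ⟨e, he, hze, hz0, haxis, htan⟩ := exists_straightening_chart hγ z
  refine IsLegendrianChart.exists_isDarbouxChart (α := α) (e := e)
    ⟨he, hze, hz0, haxis, fun t ht => ?_⟩ hα hξ
  obtain ⟨m, hm, hme⟩ := htan t ht
  have hline : HasDerivAt (fun t : ℝ => ((t, 0, 0) : V3)) (1, 0, 0) t :=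
    (hasDerivAt_id t).prodMk (hasDerivAt_const t (0 : ℝ × ℝ))
  have h1 := α.pullback_comp (f := e.symm) (c := fun t : ℝ => ((t, 0, 0) : V3)) (q := t)
    ((he.smooth_symm.contMDiffAt (e.open_target.mem_nhds ht)).mdifferentiableAt (by simp))
    hline.differentiableAt
  have h2 : fderiv ℝ (fun t : ℝ => ((t, 0, 0) : V3)) t 1 = (1, 0, 0) := by
    rw [hline.hasFDerivAt.fderiv]
    simp
  have h3 := DFunLike.congr_fun h1 1
  rw [ContinuousLinearMap.comp_apply, h2] at h3
  rw [← h3]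
  have h4 : (fun s : ℝ => e.symm (s, 0, 0)) =ᶠ[𝓝 t] γ ∘ m := hme
  have hγd : MDifferentiableAt (𝓡 1) (𝓡 3) γ (m t) :=
    (hγ.isImmersion.contMDiff).mdifferentiable (by simp) _
  have h5 := mfderiv_comp (g := γ) (f := m) t hγd hm
  have h6 : (mfderiv 𝓘(ℝ, ℝ) (𝓡 3) (fun s : ℝ => e.symm (s, 0, 0)) t : ℝ →L[ℝ] E3) 1 =
      (mfderiv (𝓡 1) (𝓡 3) γ (m t) : EuclideanSpace ℝ (Fin 1) →L[ℝ] E3)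
        ((mfderiv 𝓘(ℝ, ℝ) (𝓡 1) m t : ℝ →L[ℝ] EuclideanSpace ℝ (Fin 1)) 1) :=
    DFunLike.congr_fun (h4.mfderiv_eq.trans h5) (1 : ℝ)
  have h7 : ∀ y, y = γ (m t) → (α y : E3 →L[ℝ] ℝ) = (α (γ (m t)) : E3 →L[ℝ] ℝ) := by
    rintro y rfl; rfl
  have h8 := (hξ (γ (m t)) _).1.1 (hγξ (m t) ((mfderiv 𝓘(ℝ, ℝ) (𝓡 1) m t :
    ℝ →L[ℝ] EuclideanSpace ℝ (Fin 1)) 1))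
  change (α (e.symm (t, 0, 0)) : E3 →L[ℝ] ℝ)
    ((mfderiv 𝓘(ℝ, ℝ) (𝓡 3) (fun s : ℝ => e.symm (s, 0, 0)) t : ℝ →L[ℝ] E3) 1) = 0
  exact (congrArg _ h6).trans ((DFunLike.congr_fun (h7 (e.symm (t, 0, 0)) h4.eq_of_nhds) _).trans h8)

end Straightening

end ContactTopology

end

theorem mainTheorem5 {M : Type*} [TopologicalSpace M] [T2Space M] [SecondCountableTopology M]
    [ChartedSpace ContactTopology.E3 M] [IsManifold (𝓡 3) ∞ M]
    (ξ : ContactTopology.CoorientedContactStructure M)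
    (K : Set M) (hK : ξ.IsLegendrianKnot K)
    (g : M ≃ₘ^∞⟮𝓡 3, 𝓡 3⟯ M) (hg : ξ.IsContactomorphism g)
    (hgK : ∀ x ∈ K, g x = x) :
    ∃ h : M ≃ₘ^∞⟮𝓡 3, 𝓡 3⟯ M,
      ξ.IsContactomorphism h ∧ ξ.ContactIsotopic g h ∧
      ∃ U : Set M, IsOpen U ∧ K ⊆ U ∧ ∀ x ∈ U, h x = x := by
  obtain ⟨h, h1, h2, h3⟩ := ContactTopology.exists_contactIsotopic_eq_self_near hK.isCompact
    (fun x hx => hK.exists_isDarbouxChart hx) hg hgK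
  exact ⟨h, h1, h2, interior {x | h x = x}, isOpen_interior,
    fun a ha => mem_interior_iff_mem_nhds.2 (h3 a ha), fun x hx => interior_subset (s := {x | h x = x}) hx⟩
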